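/- Let $K$ be a field, equipped with the trivial absolute value, and let $X$ be a regular projective curve over $\operatorname{Spec} K$ (an integral regular projective $K$-scheme of dimension $1$) such that $\dim_{\mathbb Q}(\operatorname{Pic}(X)\otimes_{\mathbb Z}\mathbb Q)=1$. Let $X^{\mathrm{an}}$ be the Berkovich space of $X$: the set of pairs $\xi=(p,|\cdot|_\xi)$, where $p\in X$ and $|\cdot|_\xi$ is an absolute value on the residue field $\kappa(p)$ that is trivial on $K$, with the coarsest topology for which $U^{\mathrm{an}}=\{\xi : p\in U\}$ is open and $|f|:U^{\mathrm{an}}\to\mathbb R$ is continuous for all Zariski open $U\subseteq X$ and all regular functions $f$ on $U$. An adelic $\mathbb R$-Cartier divisor on $X$ is a pair $(D,g)$ where $D\in\operatorname{Div}(X)\otimes_{\mathbb Z}\mathbb R$ and $g$ is a Green function of $D$. That is, $g$ is a continuous real function on $U^{\mathrm{an}}$ for some non-empty Zariski open $U$ (two such functions being identified if they agree on $V^{\mathrm{an}}$ for some non-empty Zariski open $V$) such that, whenever $f\in\operatorname{Rat}(X)^\times\otimes_{\mathbb Z}\mathbb R$ is a local equation of $D$ on a non-empty Zariski open $U$, the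 function $g+\log|f|$ extends to a continuous function on $U^{\mathrm{an}}$. The pair $(D,g)$ is effective if $D$ is a linear combination of effective Cartier divisors with positive real coefficients and $g\geqslant 0$ on $X^{\mathrm{an}}$, where $g$ is viewed as a function $X^{\mathrm{an}}\to\mathbb R\cup\{+\infty\}$ through the continuous extension of $\mathrm e^{-g}$ to $X^{\mathrm{an}}$. The pair $(D,g)$ has the Dirichlet property if $(D+(s),\,g-\log|s|)$ is effective for some $s\in\operatorname{Rat}(X)^\times\otimes_{\mathbb Z}\mathbb R$. For a closed point $x$ of $X$ and $t\in\,]0,+\infty[$, let $\xi_{x,t}\in X^{\mathrm{an}}$ be the generic point of $X$ with the absolute value $\mathrm e^{-t\operatorname{ord}_x(\cdot)}$ on $\operatorname{Rat}(X)$, and put \[\mu_x(g)=\inf_{t>0}\frac{g(\xi_{x,t})}{t}\in\mathbb R\cup\{-\infty\},\qquad \mu_{\mathrm{tot}}(g)=\sum_{x}\mu_x(g)\,[\kappa(x):K]\in[-\infty,+\infty[\,,\] where the sum runs over all closed points $x$ of $X$ and is understood as an integral with respect to the counting measure (only finitely many terms are positive). Then, for every adelic $\mathbb R$-Cartier divisor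 $(D,g)$ on $X$, the following conditions are equivalent: (1) for every $\varepsilon>0$, the adelic $\mathbb R$-Cartier divisor $(D,g+\varepsilon)$ has the Dirichlet property; (2) $\mu_{\mathrm{tot}}(g)\geqslant 0$. -/

import Mathlib

universe u

open AlgebraicGeometry CategoryTheory Topology TensorProduct

noncomputable section

namespace TrivialArakelov

/-! ### Projective schemes over a field -/

section Projective

attribute [local instance] MvPolynomial.gradedAlgebra

variable (K : Type u) [Field K]

/-- Projective `n`-space over `K`: the `Proj` of `K[T_0, …, T_n]` with its standard grading. -/
abbrev projSpace (n : ℕ) : Scheme.{u} :=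
  Proj (MvPolynomial.homogeneousSubmodule (Fin (n + 1)) K)

/-- The structure morphism of projective `n`-space over `K`. -/
def projSpaceToSpec (n : ℕ) : projSpace K n ⟶ Spec (CommRingCat.of K) :=
  Proj.toSpecZero (MvPolynomial.homogeneousSubmodule (Fin (n + 1)) K) ≫
    Spec.map (CommRingCat.ofHom
      (algebraMap K (MvPolynomial.homogeneousSubmodule (Fin (n + 1)) K 0)))

variable {K}

/-- A `K`-scheme is projective if it is a closed subscheme of some projective space over `K`. -/
def IsProjective {X : Scheme.{u}} (π : X ⟶ Spec (CommRingCat.of K)) : Prop :=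
  ∃ (n : ℕ) (i : X ⟶ projSpace K n), IsClosedImmersion i ∧ i ≫ projSpaceToSpec K n = π

end Projective

/-! ### Cartier divisors and `ℝ`-Cartier divisors on an integral scheme -/

section Cartier

/-- The unit group of a commutative ring. -/
abbrev unitsOf (R : CommRingCat.{u}) : Type u := Rˣ

/-- The unit group of a commutative ring is a commutative group. -/
abbrev unitsOfCommGroup (R : CommRingCat.{u}) : CommGroup (unitsOf R) := inferInstance

variable (X : Scheme.{u}) [AlgebraicGeometry.IsIntegral X]

/-- The group `Rat(X)ˣ` of non-zero rational functions. -/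
def RatUnits : Type u := unitsOf X.functionField

instance : CommGroup (RatUnits X) := unitsOfCommGroup X.functionField

variable {X} in
/-- The underlying rational function. -/
def RatUnits.val (f : RatUnits X) : X.functionField := Units.val (α := X.functionField) f

variable {X} in
theorem RatUnits.val_mul (f g : RatUnits X) : (f * g).val = f.val * g.val := rfl

variable {X} in
theorem RatUnits.val_mul_val_inv (f : RatUnits X) : f.val * (f⁻¹).val = 1 :=
  Units.mul_inv (α := X.functionField) f

/-- The subgroup `𝒪_{X,x}ˣ` of `Rat(X)ˣ`. -/
def stalkUnits (x : X) : Subgroup (RatUnits X) :=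
  (show unitsOf (X.presheaf.stalk x) →* RatUnits X from
    Units.map (algebraMap (X.presheaf.stalk x) X.functionField).toMonoidHom).range

/-- Cartier divisors, i.e. global sections of `ℳ_Xˣ / 𝒪_Xˣ`: families of elements of the stalks
`Rat(X)ˣ / 𝒪_{X,x}ˣ` which are locally given by one rational function. -/
def CartierDiv : Subgroup (∀ x : X, RatUnits X ⧸ stalkUnits X x) where
  carrier := {D | ∀ x : X, ∃ U : X.Opens, x ∈ U ∧ ∃ f : RatUnits X,
    ∀ y ∈ U, D y = QuotientGroup.mk f}
  one_mem' := fun x => ⟨⊤, trivial, 1, fun _ _ => rfl⟩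
  mul_mem' := by
    intro D E hD hE x
    obtain ⟨U, hxU, f, hf⟩ := hD x
    obtain ⟨V, hxV, g, hg⟩ := hE x
    refine ⟨U ⊓ V, ⟨hxU, hxV⟩, f * g, fun y hy => ?_⟩
    rw [Pi.mul_apply, hf y hy.1, hg y hy.2]
    rfl
  inv_mem' := by
    intro D hD x
    obtain ⟨U, hxU, f, hf⟩ := hD x
    refine ⟨U, hxU, f⁻¹, fun y hy => ?_⟩
    rw [Pi.inv_apply, hf y hy]
    rfl

/-- The principal divisor `(f)` of a non-zero rational function, as a homomorphism. -/
def principalDiv : RatUnits X →* CartierDiv X where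
  toFun f := ⟨fun _ => QuotientGroup.mk f, fun _ => ⟨⊤, trivial, f, fun _ _ => rfl⟩⟩
  map_one' := rfl
  map_mul' _ _ := rfl

/-- The Picard group `Div(X) / PDiv(X)`. -/
abbrev Pic : Type u := CartierDiv X ⧸ (principalDiv X).range

/-- `dim_ℚ (Pic(X) ⊗ ℚ) = 1`. -/
def PicRankOne : Prop := Module.rank ℚ (ℚ ⊗[ℤ] Additive (Pic X)) = 1

variable {X} in
/-- A Cartier divisor is effective if locally it has an equation which is a regular function. -/
def IsEffectiveCartier (D : CartierDiv X) : Prop :=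
  ∀ x : X, ∃ U : X.Opens, x ∈ U ∧ ∃ f : RatUnits X, ∀ y ∈ U,
    D.1 y = QuotientGroup.mk f ∧
      f.val ∈ (algebraMap (X.presheaf.stalk y) X.functionField).range

/-- `ℝ`-rational functions `Rat(X)ˣ ⊗ ℝ` (written additively). -/
abbrev RRat : Type u := ℝ ⊗[ℤ] Additive (RatUnits X)

/-- `ℝ`-Cartier divisors `Div(X) ⊗ ℝ`. -/
abbrev RDiv : Type u := ℝ ⊗[ℤ] Additive (CartierDiv X)

/-- The `ℝ`-principal divisor of an `ℝ`-rational function. -/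
def principalRDiv : RRat X →ₗ[ℝ] RDiv X :=
  (principalDiv X).toAdditive.toIntLinearMap.baseChange ℝ

/-- The germ at `x` of an `ℝ`-Cartier divisor, in `(Rat(X)ˣ / 𝒪_{X,x}ˣ) ⊗ ℝ`. -/
def stalkRDiv (x : X) : RDiv X →ₗ[ℝ] ℝ ⊗[ℤ] Additive (RatUnits X ⧸ stalkUnits X x) :=
  (((Pi.evalMonoidHom _ x).comp (CartierDiv X).subtype).toAdditive.toIntLinearMap).baseChange ℝ

/-- The class of an `ℝ`-rational function in `(Rat(X)ˣ / 𝒪_{X,x}ˣ) ⊗ ℝ`. -/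
def stalkRRat (x : X) : RRat X →ₗ[ℝ] ℝ ⊗[ℤ] Additive (RatUnits X ⧸ stalkUnits X x) :=
  ((QuotientGroup.mk' (stalkUnits X x)).toAdditive.toIntLinearMap).baseChange ℝ

variable {X}

/-- `f` is a local equation on `U` of the `ℝ`-Cartier divisor `D`. -/
def IsLocalEquation (D : RDiv X) (U : X.Opens) (f : RRat X) : Prop :=
  ∀ y ∈ U, stalkRDiv X y D = stalkRRat X y f

/-- An `ℝ`-Cartier divisor is effective if it is a combination of effective Cartier divisors with
positive real coefficients. -/
def IsEffectiveRDiv (D : RDiv X) : Prop :=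
  ∃ (r : ℕ) (a : Fin r → ℝ) (E : Fin r → CartierDiv X),
    (∀ i, 0 < a i) ∧ (∀ i, IsEffectiveCartier (E i)) ∧
      D = ∑ i, a i ⊗ₜ[ℤ] Additive.ofMul (E i)

end Cartier

/-! ### The Berkovich space over the trivially valued field `K` -/

section Berkovich

variable {K : Type u} [Field K] {X : Scheme.{u}} (π : X ⟶ Spec (CommRingCat.of K))

/-- The homomorphism `K → κ(x)` given by the structure morphism. -/
def toResidueField (x : X) : K →+* X.residueField x :=
  ((Scheme.ΓSpecIso (CommRingCat.of K)).inv ≫ π.appTop ≫ X.Γevaluation x).hom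

/-- The degree `[κ(x) : K]`. -/
def degreeAt (x : X) : ℕ :=
  @Module.finrank K (X.residueField x) _ _ (toResidueField π x).toModule

/-- A point of `X^an`: a point of `X` with an absolute value on its residue field which extends
the trivial absolute value of `K`. -/
structure Berkovich where
  /-- the specification map `j : X^an → X` -/
  point : X
  /-- the absolute value on the residue field -/
  abv : AbsoluteValue (X.residueField point) ℝ
  trivial_on_base : ∀ a : K, a ≠ 0 → abv (toResidueField π point a) = 1

variable {π}

/-- `|f|(ξ)` for a regular function `f` on `U` and `ξ ∈ U^an`. -/
def Berkovich.absEval (ξ : Berkovich π) {U : X.Opens} (hU : ξ.point ∈ U) (f : Γ(X, U)) : ℝ :=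
  ξ.abv (X.evaluation U ξ.point hU f)

variable (π)

/-- `U^an`, as a subset of `X^an`. -/
def anOpen (U : X.Opens) : Set (Berkovich π) := {ξ | ξ.point ∈ U}

/-- The Berkovich topology: the coarsest one for which all `U^an` are open and all functions `|f|`
are continuous on `U^an`, for `f` regular on the Zariski open set `U`. -/
instance : TopologicalSpace (Berkovich π) :=
  TopologicalSpace.generateFrom
    ({S | ∃ U : X.Opens, S = anOpen π U} ∪
      {S | ∃ (U : X.Opens) (f : Γ(X, U)) (A : Set ℝ), IsOpen A ∧
        S = {ξ | ∃ h : ξ.point ∈ U, ξ.absEval h f ∈ A}})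

variable [AlgebraicGeometry.IsIntegral X]

/-- The filter generated by the sets `U^an` with `U` a non-empty Zariski open subset of `X`
(equivalently, an open neighbourhood of the generic point). -/
def genericFilter : Filter (Berkovich π) :=
  Filter.comap Berkovich.point (𝓝 (genericPoint X))

/-- Real functions on `X^an`, modulo equality on `U^an` for some non-empty Zariski open `U`. -/
abbrev GenericGerm : Type u := Filter.Germ (genericFilter π) ℝ

/-- The set `Ĉ⁰(X^an)` of the classes of functions that are continuous on `U^an` for some non-empty
Zariski open `U`. -/
def CHat : Set (GenericGerm π) :=
  {g | ∃ U : X.Opens, (U : Set X).Nonempty ∧ ∃ φ : Berkovich π → ℝ,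
    ContinuousOn φ (anOpen π U) ∧ (φ : GenericGerm π) = g}

variable {π}

/-- The value of a class at a point of `X^an` lying over the generic point of `X`. -/
def germValue (g : GenericGerm π) (ξ : Berkovich π) (hξ : ξ.point = genericPoint X) : ℝ :=
  Quotient.liftOn' g (fun φ => φ ξ) (fun φ ψ (h : ∀ᶠ ζ in genericFilter π, φ ζ = ψ ζ) => by
    obtain ⟨s, hs, hsub⟩ := Filter.mem_comap.mp h
    exact hsub (show ξ.point ∈ s from hξ ▸ mem_of_mem_nhds hs))

open Classical in
/-- The function `log|f|`, at all points `ξ` at which the rational function `f` is an invertible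
regular function (and an irrelevant value at the other points). -/
def logAbsFun (f : RatUnits X) (ξ : Berkovich π) : ℝ :=
  if h : ∃ a : (X.presheaf.stalk ξ.point)ˣ,
      algebraMap (X.presheaf.stalk ξ.point) X.functionField a = f.val
  then Real.log (ξ.abv (X.residue ξ.point h.choose.1)) else 0

theorem algebraMap_stalk_injective (x : X) :
    Function.Injective (algebraMap (X.presheaf.stalk x) X.functionField) :=
  IsFractionRing.injective _ _

theorem logAbsFun_eq (f : RatUnits X) (ξ : Berkovich π) (a : (X.presheaf.stalk ξ.point)ˣ)
    (ha : algebraMap (X.presheaf.stalk ξ.point) X.functionField a = f.val) :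
    logAbsFun f ξ = Real.log (ξ.abv (X.residue ξ.point a.1)) := by
  have h : ∃ a : (X.presheaf.stalk ξ.point)ˣ,
      algebraMap (X.presheaf.stalk ξ.point) X.functionField a = f.val := ⟨a, ha⟩
  have e : h.choose.1 = a.1 :=
    algebraMap_stalk_injective ξ.point (h.choose_spec.trans ha.symm)
  rw [logAbsFun, dif_pos h, e]

theorem eventually_isUnit (f : RatUnits X) :
    ∀ᶠ ξ in genericFilter π, ∃ a : (X.presheaf.stalk ξ.point)ˣ,
      algebraMap (X.presheaf.stalk ξ.point) X.functionField a = f.val := by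
  obtain ⟨U, hU, s, hs⟩ := X.presheaf.exists_germ_eq (x := genericPoint X) f.val
  obtain ⟨V, hV, t, ht⟩ :=
    X.presheaf.exists_germ_eq (x := genericPoint X) (f⁻¹).val
  refine Filter.mem_comap.mpr ⟨((U ⊓ V : X.Opens) : Set X),
    (U ⊓ V).isOpen.mem_nhds ⟨hU, hV⟩, fun ξ hξ => ?_⟩
  have : Nonempty U := ⟨⟨_, hU⟩⟩
  have : Nonempty V := ⟨⟨_, hV⟩⟩
  have h1 : algebraMap (X.presheaf.stalk ξ.point) X.functionField
      (X.presheaf.germ U ξ.point hξ.1 s) = f.val := by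
    rw [Scheme.algebraMap_germ_eq_germToFunctionField]; exact hs
  have h2 : algebraMap (X.presheaf.stalk ξ.point) X.functionField
      (X.presheaf.germ V ξ.point hξ.2 t) = (f⁻¹).val := by
    rw [Scheme.algebraMap_germ_eq_germToFunctionField]; exact ht
  refine ⟨Units.mkOfMulEqOne (X.presheaf.germ U ξ.point hξ.1 s)
    (X.presheaf.germ V ξ.point hξ.2 t) (algebraMap_stalk_injective ξ.point ?_), h1⟩
  rw [map_mul, h1, h2, map_one, RatUnits.val_mul_val_inv]

theorem logAbsFun_mul (f g : RatUnits X) :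
    ((logAbsFun (f * g) : Berkovich π → ℝ) : GenericGerm π) =
      (logAbsFun f : Berkovich π → ℝ) + (logAbsFun g : Berkovich π → ℝ) := by
  refine Filter.Germ.coe_eq.mpr ?_
  filter_upwards [eventually_isUnit (π := π) f, eventually_isUnit (π := π) g] with ξ hf hg
  obtain ⟨a, ha⟩ := hf
  obtain ⟨b, hb⟩ := hg
  have hne : ∀ c : (X.presheaf.stalk ξ.point)ˣ, ξ.abv (X.residue ξ.point c.1) ≠ 0 := fun c =>
    ξ.abv.ne_zero ((c.isUnit.map (X.residue ξ.point).hom).ne_zero)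
  rw [logAbsFun_eq f ξ a ha, logAbsFun_eq g ξ b hb,
    logAbsFun_eq (f * g) ξ (a * b) (by rw [Units.val_mul, map_mul, ha, hb, RatUnits.val_mul]), ← Real.log_mul (hne a) (hne b),
    ← map_mul, ← map_mul]
  rfl

variable (π)

/-- The `ℝ`-linear map `log|·|` from `Rat(X)ˣ ⊗ ℝ` to classes of functions on `X^an`. -/
def logAbs : RRat X →ₗ[ℝ] GenericGerm π :=
  LinearMap.liftBaseChange ℝ
    (AddMonoidHom.mk' (fun f : Additive (RatUnits X) =>
      ((logAbsFun f.toMul : Berkovich π → ℝ) : GenericGerm π))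
      (fun f g => logAbsFun_mul f.toMul g.toMul)).toIntLinearMap

variable {π}

/-- `g` is a Green function (of `C⁰`-type) of the `ℝ`-Cartier divisor `D`: for each local equation
`f` of `D` on a non-empty Zariski open `U`, the class `g + log|f|` extends to a continuous
function on `U^an`. -/
def IsGreenFunction (D : RDiv X) (g : GenericGerm π) : Prop :=
  g ∈ CHat π ∧ ∀ (U : X.Opens) (f : RRat X), (U : Set X).Nonempty → IsLocalEquation D U f →
    ∃ φ : Berkovich π → ℝ, ContinuousOn φ (anOpen π U) ∧ (φ : GenericGerm π) = g + logAbs π f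

variable (π)

/-- Adelic `ℝ`-Cartier divisors `(D, g)` on `X`. -/
structure AdelicDivisor where
  /-- the underlying `ℝ`-Cartier divisor -/
  D : RDiv X
  /-- the Green function -/
  g : GenericGerm π
  isGreen : IsGreenFunction D g

variable {π}

/-- `(D, g + ε)`. -/
def AdelicDivisor.addConst (A : AdelicDivisor π) (ε : ℝ) : AdelicDivisor π where
  D := A.D
  g := A.g + ((fun _ => ε : Berkovich π → ℝ) : GenericGerm π)
  isGreen := by
    obtain ⟨⟨U, hU, φ, hφ, e⟩, hg⟩ := A.isGreen
    refine ⟨⟨U, hU, φ + fun _ => ε, hφ.add continuousOn_const, by rw [← e]; rfl⟩, ?_⟩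
    intro V f hV hf
    obtain ⟨ψ, hψ, e'⟩ := hg V f hV hf
    refine ⟨ψ + fun _ => ε, hψ.add continuousOn_const, ?_⟩
    rw [Filter.Germ.coe_add, e', add_right_comm]

/-- `(D, g)` is effective if `D` is effective and `g ≥ 0` on `X^an`, where `g` is regarded as the
function `-log(e^{-g}) : X^an → ℝ ∪ {+∞}`, with `e^{-g}` extended continuously to `X^an`. -/
def AdelicDivisor.IsEffective (A : AdelicDivisor π) : Prop :=
  IsEffectiveRDiv A.D ∧ ∃ h : Berkovich π → ℝ, Continuous h ∧
    (h : GenericGerm π) = A.g.map (fun r => Real.exp (-r)) ∧ ∀ ξ, 0 ≤ h ξ ∧ h ξ ≤ 1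

/-- `B = A + ((s), -log|s|)` for some `ℝ`-rational function `s`. -/
def AdelicDivisor.LinEquiv (A B : AdelicDivisor π) : Prop :=
  ∃ s : RRat X, B.D = A.D + principalRDiv X s ∧ B.g = A.g - logAbs π s

/-- The Dirichlet property: `ℝ`-linear equivalence to an effective adelic `ℝ`-Cartier divisor. -/
def AdelicDivisor.Dirichlet (A : AdelicDivisor π) : Prop :=
  ∃ B : AdelicDivisor π, A.LinEquiv B ∧ B.IsEffective

/-! ### The invariants `μ_x` and `μ_tot` on a curve -/

variable [IsLocallyNoetherian X]

/-- `ξ` is the point with parameter `t` of the branch `]η₀, x[`: it lies over the generic point of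
`X` and its absolute value on `Rat(X)ˣ` is `e^{-t ord_x(·)}`. (The map from the stalk at `ξ.point`
to the function field is the identity of `Rat(X)` here.) -/
def IsBranchPoint (x : X) (t : ℝ) (ξ : Berkovich π) : Prop :=
  ξ.point = genericPoint X ∧ ∀ a : X.presheaf.stalk ξ.point, a ≠ 0 →
    ξ.abv (X.residue ξ.point a) =
      Real.exp (-t * (Scheme.ord (algebraMap (X.presheaf.stalk ξ.point) X.functionField a) x : ℝ))

/-- `μ_x(g) = inf g(ξ) / t(ξ)`, over the points `ξ` of the open branch `]η₀, x[`. -/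
def mu (g : GenericGerm π) (x : X) : EReal :=
  ⨅ (t : ℝ) (_ : 0 < t) (ξ : Berkovich π) (h : IsBranchPoint x t ξ),
    ((germValue g ξ h.1 / t : ℝ) : EReal)

variable (X) in
/-- The set of closed points of `X`. -/
abbrev ClosedPoint : Type u := {x : X // IsClosed ({x} : Set X)}

/-- `μ_tot(g) = ∑_x μ_x(g) [κ(x) : K]`, the integral of the summand with respect to the counting
measure on the set of closed points: the sum of its positive parts minus the sum of its negative
parts. -/
def muTot (g : GenericGerm π) : EReal :=
  ((∑' x : ClosedPoint X, (mu g x.1 * (degreeAt π x.1 : EReal)).toENNReal : ENNReal) : EReal) -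
    ((∑' x : ClosedPoint X, (-(mu g x.1 * (degreeAt π x.1 : EReal))).toENNReal : ENNReal) : EReal)

end Berkovich

end TrivialArakelov

end

open TrivialArakelov

/-!
The Berkovich space of the curve is a tree: a root (the generic point with the trivial absolute
value), and for every closed point `x` a branch `t ↦ ξ_{x,t}` from the root to the trivial absolute
value on `κ(x)`. There are no other points (`eq_root_or_branch`, by the valuative criterion of
properness, and `eq_closedPt`), and a neighbourhood of the root contains all but finitely many
whole branches (`tendsto_branch_cofinite`). An adelic divisor `(D, g)` is therefore seen through the
functions `t ↦ g(ξ_{x,t})`: these are continuous, have the common value `g(root)` at `t = 0`, are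
uniformly close to it outside finitely many branches, and grow with slope `ord_x(D)`
(`IsGreenFunction.tendsto_branchVal_sub`). It is effective if and only if all orders of `D` and all
values on the branches are non-negative (`AdelicDivisor.isEffective_iff`), so that the Dirichlet
property asks for an `ℝ`-rational function `s` with `ord_x(D) + ord_x(s) ≥ 0` and
`g(ξ_{x,t}) + t ord_x(s) ≥ 0` for all `x` and `t` (`AdelicDivisor.dirichlet_iff`).

If such an `s` exists for `g + ε`, then `-ord_x(s) ≤ (g(ξ_{x,t}) + ε) / t`. By the degree formula
`∑_x ord_x(s) [κ(x) : K] = 0`, the right-hand sides have a non-negative weighted sum over any finite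
set containing the support of `D`, for any choice of the parameters `t`, and as `ε → 0` this gives
`μ_tot(g) ≥ 0` (`zero_le_muTot_of_dirichlet`).

Conversely, `μ_tot(g) ≥ 0` forces `g(root) ≥ 0`, and so `g + ε` is positive on all but finitely many
branches. On those that remain, the slopes `M_x = inf_t (g(ξ_{x,t}) + ε) / t` are finite, and
`μ_x(g) ≤ M_x ≤ ord_x(D)`. Hence `∑ M_x [κ(x) : K] ≥ 0`, and because `Pic(X) ⊗ ℚ` is a line, on which
the degree is injective, there is an `s` with `M_x + ord_x(s) ≥ 0` for all `x`
(`exists_nonneg_add_ordR`). This `s` shows that `(D, g + ε)` has the Dirichlet property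
(`dirichlet_of_zero_le_muTot`).

The degree formula is proved for a family of discrete valuation rings of a field by a dimension
count (`sum_fracOrd_mul_degree_eq_zero`): the zeros of `f` give, by weak approximation, as many
elements linearly independent over `K[f]` as their degree, and counting the polar parts of the
combinations of these elements bounds their number by the degree of the poles of `f`. The
functions without poles form a finite-dimensional space: by the valuative criterion again they are
algebraic over `K`, hence without zeros, and so embed in the residue field of a closed point.
-/

set_option linter.unusedSectionVars false

namespace TrivialArakelov

/-! ### Orders with respect to discrete valuation rings of a field -/

section DVROrder

variable (R : Type*) {L : Type*} [CommRing R] [IsDomain R] [IsDiscreteValuationRing R]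
  [Field L] [Algebra R L] [IsFractionRing R L]

/-- The normalised order of an element of the fraction field of a discrete valuation ring, with
the value `0` at `0`. -/
noncomputable def fracOrd (a : L) : ℤ :=
  Multiplicative.toAdd ((Ring.ordFrac R a).unzeroD 1)

@[simp] lemma fracOrd_zero : fracOrd R (0 : L) = 0 := by
  simp [fracOrd, WithZero.unzeroD]

lemma coe_fracOrd {a : L} (ha : a ≠ 0) :
    Ring.ordFrac R a = ((Multiplicative.ofAdd (fracOrd R a) : Multiplicative ℤ) :
      WithZero (Multiplicative ℤ)) := by
  have : Ring.ordFrac R a ≠ 0 := (map_ne_zero _).mpr ha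
  obtain ⟨b, hb⟩ := WithZero.ne_zero_iff_exists.mp this
  rw [fracOrd, ← hb]
  rfl

lemma fracOrd_eq_iff {a : L} (ha : a ≠ 0) (n : ℤ) :
    fracOrd R a = n ↔ Ring.ordFrac R a = WithZero.exp n := by
  rw [coe_fracOrd R ha]
  simp [WithZero.exp]

lemma fracOrd_mul {a b : L} (ha : a ≠ 0) (hb : b ≠ 0) :
    fracOrd R (a * b) = fracOrd R a + fracOrd R b := by
  rw [fracOrd_eq_iff R (mul_ne_zero ha hb), map_mul, coe_fracOrd R ha, coe_fracOrd R hb]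
  rfl

@[simp] lemma fracOrd_one : fracOrd R (1 : L) = 0 := by
  rw [fracOrd_eq_iff R one_ne_zero, map_one]; rfl

lemma fracOrd_inv (a : L) : fracOrd R a⁻¹ = - fracOrd R a := by
  by_cases ha : a = 0
  · simp [ha]
  have := fracOrd_mul R ha (inv_ne_zero ha)
  rw [mul_inv_cancel₀ ha, fracOrd_one] at this
  omega

lemma fracOrd_pow (a : L) (n : ℕ) : fracOrd R (a ^ n) = n * fracOrd R a := by
  by_cases ha : a = 0
  · cases n <;> simp [ha]
  induction n with
  | zero => simp
  | succ n ih => rw [pow_succ, fracOrd_mul R (pow_ne_zero _ ha) ha, ih]; push_cast; ring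

lemma fracOrd_zpow (a : L) (n : ℤ) : fracOrd R (a ^ n) = n * fracOrd R a := by
  cases n with
  | ofNat n => simpa using fracOrd_pow R a n
  | negSucc n =>
    rw [zpow_negSucc, fracOrd_inv, fracOrd_pow, Int.negSucc_eq]; push_cast; ring

lemma fracOrd_irreducible {ϖ : R} (h : Irreducible ϖ) : fracOrd R (algebraMap R L ϖ) = 1 := by
  rw [fracOrd_eq_iff R (by simpa using h.ne_zero)]
  exact Ring.ordFrac_irreducible h

lemma fracOrd_of_isUnit {r : R} (h : IsUnit r) : fracOrd R (algebraMap R L r) = 0 := by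
  rw [fracOrd_eq_iff R (by simpa using h.ne_zero), Ring.ordFrac_of_isUnit h]
  rfl

lemma exists_eq_unit_mul_zpow {ϖ : R} (h : Irreducible ϖ) {a : L} (ha : a ≠ 0) :
    ∃ v : Rˣ, a = algebraMap R L v * algebraMap R L ϖ ^ fracOrd R a := by
  have hϖ : algebraMap R L ϖ ≠ 0 := by simpa using h.ne_zero
  obtain ⟨n, v, rfl⟩ :=
    IsDiscreteValuationRing.exists_units_eq_smul_zpow_of_irreducible (K := L) h ha
  have hv : algebraMap R L v ≠ 0 := by simp
  refine ⟨v, ?_⟩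
  have : fracOrd R (v • algebraMap R L ϖ ^ n) = n := by
    rw [Units.smul_def, Algebra.smul_def, fracOrd_mul R hv (zpow_ne_zero _ hϖ),
      fracOrd_of_isUnit R v.isUnit, fracOrd_zpow, fracOrd_irreducible R h]
    ring
  rw [this, Units.smul_def, Algebra.smul_def]

lemma fracOrd_nonneg (r : R) : 0 ≤ fracOrd R (algebraMap R L r) := by
  by_cases hr : r = 0
  · simp [hr]
  obtain ⟨ϖ, hϖ⟩ := IsDiscreteValuationRing.exists_irreducible R
  obtain ⟨n, v, rfl⟩ := IsDiscreteValuationRing.eq_unit_mul_pow_irreducible hr hϖ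
  rw [map_mul, map_pow, fracOrd_mul R (by simp) (by simpa using fun h => absurd h hϖ.ne_zero),
    fracOrd_of_isUnit R v.isUnit, fracOrd_pow, fracOrd_irreducible R hϖ]
  simp

lemma mem_range_of_fracOrd_nonneg {a : L} (ha : 0 ≤ fracOrd R a) :
    a ∈ (algebraMap R L).range := by
  by_cases h0 : a = 0
  · exact h0 ▸ zero_mem _
  obtain ⟨ϖ, hϖ⟩ := IsDiscreteValuationRing.exists_irreducible R
  obtain ⟨v, hv⟩ := exists_eq_unit_mul_zpow R hϖ h0
  obtain ⟨n, hn⟩ := Int.eq_ofNat_of_zero_le ha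
  rw [hv, hn]
  exact ⟨v * ϖ ^ n, by simp⟩

lemma mem_range_iff_fracOrd_nonneg {a : L} :
    a ∈ (algebraMap R L).range ↔ 0 ≤ fracOrd R a :=
  ⟨by rintro ⟨r, rfl⟩; exact fracOrd_nonneg R r, mem_range_of_fracOrd_nonneg R⟩

lemma exists_unit_of_fracOrd_eq_zero {a : L} (h0 : a ≠ 0) (ha : fracOrd R a = 0) :
    ∃ v : Rˣ, algebraMap R L v = a := by
  obtain ⟨ϖ, hϖ⟩ := IsDiscreteValuationRing.exists_irreducible R
  obtain ⟨v, hv⟩ := exists_eq_unit_mul_zpow R hϖ h0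
  exact ⟨v, by rw [hv, ha]; simp⟩

lemma fracOrd_pos_iff {r : R} (hr : r ≠ 0) :
    0 < fracOrd R (algebraMap R L r) ↔ r ∈ IsLocalRing.maximalIdeal R := by
  rw [IsLocalRing.mem_maximalIdeal, mem_nonunits_iff, ← not_iff_not, not_not, not_lt]
  refine ⟨fun h => ?_, fun h => (fracOrd_of_isUnit R h).le⟩
  obtain ⟨v, hv⟩ := exists_unit_of_fracOrd_eq_zero R (a := algebraMap R L r) (by simpa using hr)
    (le_antisymm h (fracOrd_nonneg R r))
  rw [← IsFractionRing.injective R L hv]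
  exact v.isUnit

lemma min_fracOrd_le_fracOrd_add {a b : L} (ha : a ≠ 0) (hb : b ≠ 0) (hab : a + b ≠ 0) :
    min (fracOrd R a) (fracOrd R b) ≤ fracOrd R (a + b) := by
  have := Ring.ordFrac_add (R := R) a b hab
  rw [coe_fracOrd R ha, coe_fracOrd R hb, coe_fracOrd R hab, min_le_iff] at this
  simpa [min_le_iff] using this

open Classical in
/-- The absolute value `a ↦ e^{-t ord(a)}` on the fraction field, for `t ≥ 0`. The parameter is
truncated below at `0`, so that all real numbers are allowed, and `t ≤ 0` gives the trivial
absolute value. -/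
noncomputable def expAbv (L : Type*) [Field L] [Algebra R L] [IsFractionRing R L] (t : ℝ) :
    AbsoluteValue L ℝ where
  toFun a := if a = 0 then 0 else Real.exp (-(max t 0) * fracOrd R a)
  map_mul' a b := by
    by_cases ha : a = 0
    · simp [ha]
    by_cases hb : b = 0
    · simp [hb]
    simp only [mul_eq_zero, ha, hb, or_self, if_false, fracOrd_mul R ha hb, ← Real.exp_add]
    push_cast; ring_nf
  nonneg' a := by
    split_ifs
    exacts [le_rfl, (Real.exp_pos _).le]
  eq_zero' a := by
    split_ifs with h <;> simp [h]
  add_le' a b := by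
    by_cases ha : a = 0
    · simp [ha]
    by_cases hb : b = 0
    · simp [hb]
    have h1 := Real.exp_pos (-(max t 0) * fracOrd R a)
    have h2 := Real.exp_pos (-(max t 0) * fracOrd R b)
    by_cases hab : a + b = 0
    · simp only [hab, ha, hb, if_true, if_false]; positivity
    simp only [hab, ha, hb, if_false]
    have ht : 0 ≤ max t 0 := le_max_right _ _
    rcases min_le_iff.mp (min_fracOrd_le_fracOrd_add R ha hb hab) with h | h
    · have h' : (fracOrd R a : ℝ) ≤ fracOrd R (a + b) := by exact_mod_cast h
      have : Real.exp (-(max t 0) * fracOrd R (a + b)) ≤ Real.exp (-(max t 0) * fracOrd R a) :=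
        Real.exp_le_exp.mpr (by nlinarith)
      linarith
    · have h' : (fracOrd R b : ℝ) ≤ fracOrd R (a + b) := by exact_mod_cast h
      have : Real.exp (-(max t 0) * fracOrd R (a + b)) ≤ Real.exp (-(max t 0) * fracOrd R b) :=
        Real.exp_le_exp.mpr (by nlinarith)
      linarith

lemma expAbv_apply (t : ℝ) {a : L} (ha : a ≠ 0) :
    expAbv R L t a = Real.exp (-(max t 0) * fracOrd R a) := if_neg ha

lemma expAbv_isNontrivial {t : ℝ} (ht : 0 < t) : (expAbv R L t).IsNontrivial := by
  obtain ⟨ϖ, hϖ⟩ := IsDiscreteValuationRing.exists_irreducible R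
  have h0 : algebraMap R L ϖ ≠ 0 := by simpa using hϖ.ne_zero
  refine ⟨algebraMap R L ϖ, h0, ?_⟩
  rw [expAbv_apply R t h0, fracOrd_irreducible R hϖ, max_eq_left ht.le]
  simp [ht.ne']

lemma expAbv_le_one_iff {t : ℝ} (ht : 0 < t) (a : L) :
    expAbv R L t a ≤ 1 ↔ a ∈ (algebraMap R L).range := by
  rw [mem_range_iff_fracOrd_nonneg]
  by_cases ha : a = 0
  · simp [ha]
  rw [expAbv_apply R t ha, max_eq_left ht.le, Real.exp_le_one_iff]
  constructor
  · intro h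
    by_contra h'
    have : (fracOrd R a : ℝ) < 0 := by exact_mod_cast not_le.mp h'
    nlinarith
  · intro h
    have : (0 : ℝ) ≤ fracOrd R a := by exact_mod_cast h
    nlinarith

/-- Two discrete valuation rings of the same field, the first of which is not contained in the
second, have inequivalent absolute values. -/
lemma not_isEquiv_expAbv {R' : Type*} [CommRing R'] [IsDomain R'] [IsDiscreteValuationRing R']
    [Algebra R' L] [IsFractionRing R' L]
    (h : ¬ (algebraMap R L).range ≤ (algebraMap R' L).range) :
    ¬ (expAbv R L 1).IsEquiv (expAbv R' L 1) := by
  intro he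
  refine h fun a ha => ?_
  rw [← expAbv_le_one_iff R' one_pos]
  rw [← expAbv_le_one_iff R one_pos] at ha
  have := (he.le_iff_le (x := a) (y := 1))
  simpa using this.mp (by simpa using ha)

end DVROrder

/-! ### The degree of a principal divisor, for a family of discrete valuation rings -/

section Length

variable (K : Type*) {R : Type*} [Field K] [CommRing R] [IsDomain R] [IsDiscreteValuationRing R]
  [Algebra K R] [Module.Finite K (IsLocalRing.ResidueField R)]

open Pointwise in
/-- The `K`-dimension of `R / (ϖ ^ n)` is `n` times that of the residue field: multiplication by `ϖ`
embeds `R / (ϖ ^ n)` in `R / (ϖ ^ (n + 1))` with quotient `R / (ϖ)`. -/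
lemma finite_finrank_quotient_pow {ϖ : R} (hϖ : Irreducible ϖ) (n : ℕ) :
    Module.Finite K (R ⧸ Ideal.span {ϖ ^ n}) ∧
      Module.finrank K (R ⧸ Ideal.span {ϖ ^ n}) =
        n * Module.finrank K (IsLocalRing.ResidueField R) := by
  have key : Module.length K (R ⧸ Ideal.span {ϖ ^ n}) =
      ((n * Module.finrank K (IsLocalRing.ResidueField R) : ℕ) : ℕ∞) := by
    induction n with
    | zero =>
      have : Subsingleton (R ⧸ Ideal.span {ϖ ^ 0}) := by
        rw [pow_zero, Ideal.span_singleton_one]; exact Ideal.Quotient.subsingleton_iff.mpr rfl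
      simp [Module.length_eq_zero]
    | succ n ih =>
      have e : (ϖ • Ideal.span {ϖ ^ n} : Ideal R) = Ideal.span {ϖ ^ (n + 1)} := by
        rw [← Submodule.singleton_set_smul, ← Ideal.submodule_span_eq, Submodule.set_smul_span]
        simp [pow_succ']
      have h := Module.length_eq_add_of_exact
        ((Ideal.mulQuot ϖ (Ideal.span {ϖ ^ n})).restrictScalars K)
        ((Ideal.quotOfMul ϖ (Ideal.span {ϖ ^ n})).restrictScalars K)
        (Ideal.mulQuot_injective _ (mem_nonZeroDivisors_of_ne_zero hϖ.ne_zero))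
        (Ideal.quotOfMul_surjective _) (Ideal.exact_mulQuot_quotOfMul _)
      have h1 : Module.length K (R ⧸ Ideal.span {ϖ}) =
          Module.finrank K (IsLocalRing.ResidueField R) := by
        rw [← hϖ.maximalIdeal_eq, ← Module.length_eq_finrank]
        rfl
      rw [e, ih, h1] at h
      rw [h]; push_cast; ring
  have hfin : Module.Finite K (R ⧸ Ideal.span {ϖ ^ n}) := by
    have : IsFiniteLength K (R ⧸ Ideal.span {ϖ ^ n}) := by
      rw [← Module.length_ne_top_iff, key]; exact ENat.natCast_ne_top _
    have := (isFiniteLength_iff_isNoetherian_isArtinian.mp this).1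
    infer_instance
  refine ⟨hfin, ?_⟩
  rw [Module.length_eq_finrank] at key
  exact_mod_cast key

end Length

section Degree

variable {K L P : Type*} [Field K] [Field L] [Algebra K L] (R : P → Type*)
  [∀ x, CommRing (R x)] [∀ x, IsDomain (R x)] [∀ x, IsDiscreteValuationRing (R x)]
  [∀ x, Algebra (R x) L] [∀ x, IsFractionRing (R x) L] [∀ x, Algebra K (R x)]
  [∀ x, IsScalarTower K (R x) L]

/-- The image of `R x` in `L`, as a `K`-subspace. -/
def rangeSubmodule (K : Type*) (R : Type*) (L : Type*) [Field K] [CommRing R] [Field L]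
    [Algebra K L] [Algebra R L] [Algebra K R] [IsScalarTower K R L] : Submodule K L :=
  LinearMap.range (IsScalarTower.toAlgHom K R L).toLinearMap

lemma mem_rangeSubmodule {K : Type*} {R : Type*} {L : Type*} [Field K] [CommRing R] [Field L]
    [Algebra K L] [Algebra R L] [Algebra K R] [IsScalarTower K R L] {a : L} :
    a ∈ rangeSubmodule K R L ↔ a ∈ (algebraMap R L).range := by
  simp [rangeSubmodule]

/-- The elements `b j` of `L` are linearly independent over `K[f]`. -/
def PolyIndep (K : Type*) {L : Type*} [Field K] [Field L] [Algebra K L] (f : L) {m : ℕ}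
    (b : Fin m → L) : Prop :=
  ∀ p : Fin m → Polynomial K, ∑ j, Polynomial.aeval f (p j) * b j = 0 → p = 0

/-- Weak approximation, for finitely many distinct discrete valuation rings of `L`: there is an
element of `L` which is congruent to given elements modulo given powers of the maximal ideals. -/
lemma exists_approx
    (hdist : ∀ x y, x ≠ y → ¬ (algebraMap (R x) L).range ≤ (algebraMap (R y) L).range)
    (Z : Finset P) (n : P → ℕ) (r : ∀ x, R x) :
    ∃ b : L, ∀ x ∈ Z, b ≠ algebraMap (R x) L (r x) →
      (n x : ℤ) ≤ fracOrd (R x) (b - algebraMap (R x) L (r x)) := by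
  have hd := AbsoluteValue.denseRange_algebraMap_pi (F := L) (ι := Z)
    (v := fun x => expAbv (R x.1) L 1) (fun x => expAbv_isNontrivial (R x.1) one_pos)
    (fun x y hxy => not_isEquiv_expAbv (R x.1) (hdist _ _ (fun h => hxy (Subtype.ext h))))
  -- An approximation up to `e^{-N+1}` has order greater than `N - 1`, which is at least every
  -- `n x - 1`.
  let N : ℕ := ∑ x ∈ Z, n x
  obtain ⟨b, hb⟩ := Metric.denseRange_iff.mp hd
    (fun x => WithAbs.toAbs _ (algebraMap (R x.1) L (r x.1))) (Real.exp (-(N : ℝ) + 1))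
    (Real.exp_pos _)
  refine ⟨b, fun x hx hne => ?_⟩
  have h1 := (dist_pi_lt_iff (Real.exp_pos _)).mp hb ⟨x, hx⟩
  rw [dist_comm, dist_eq_norm] at h1
  have h2 : expAbv (R x) L 1 (b - algebraMap (R x) L (r x)) < Real.exp (-(N : ℝ) + 1) := h1
  rw [expAbv_apply _ _ (sub_ne_zero.mpr hne), Real.exp_lt_exp] at h2
  have h3 : (n x : ℝ) ≤ N := by exact_mod_cast Finset.single_le_sum (fun _ _ => Nat.zero_le _) hx
  have h4 : ((n x : ℤ) : ℝ) - 1 < fracOrd (R x) (b - algebraMap (R x) L (r x)) := by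
    simp at h2 ⊢; linarith
  have h5 : (n x : ℤ) - 1 < fracOrd (R x) (b - algebraMap (R x) L (r x)) := by exact_mod_cast h4
  omega

lemma exists_fracOrd_mul_eq {x : P} {ϖ : R x} (hϖ : Irreducible ϖ) {a : L} {n : ℕ}
    (h : a ≠ 0 → (n : ℤ) ≤ fracOrd (R x) a) :
    ∃ c : R x, a = algebraMap (R x) L (c * ϖ ^ n) := by
  have h0 : algebraMap (R x) L ϖ ≠ 0 := by simpa using hϖ.ne_zero
  by_cases ha : a = 0
  · exact ⟨0, by simp [ha]⟩
  obtain ⟨c, hc⟩ := mem_range_of_fracOrd_nonneg (R x)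
    (a := a * (algebraMap (R x) L ϖ ^ n)⁻¹) (by
      rw [fracOrd_mul _ ha (inv_ne_zero (pow_ne_zero _ h0)), fracOrd_inv, fracOrd_pow,
        fracOrd_irreducible _ hϖ]
      linarith [h ha])
  refine ⟨c, ?_⟩
  rw [map_mul, hc, map_pow]
  field_simp

/-- The zeros of `f` produce as many elements that are linearly independent over `K[f]` as the
degree of the divisor of zeros: lift a basis of `∏ R x / (f)`. -/
lemma exists_polyIndep
    (hdist : ∀ x y, x ≠ y → ¬ (algebraMap (R x) L).range ≤ (algebraMap (R y) L).range)
    (hfin : ∀ x, Module.Finite K (IsLocalRing.ResidueField (R x))) {f : L} (hf : f ≠ 0)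
    (Z : Finset P) (hZ : ∀ x ∈ Z, 0 ≤ fracOrd (R x) f) :
    ∃ m : ℕ, m = ∑ x ∈ Z, (fracOrd (R x) f).toNat *
        Module.finrank K (IsLocalRing.ResidueField (R x)) ∧
      ∃ b : Fin m → L, PolyIndep K f b := by
  classical
  choose ϖ hϖ using fun x => IsDiscreteValuationRing.exists_irreducible (R x)
  let n : P → ℕ := fun x => (fracOrd (R x) f).toNat
  let Q : Z → Type _ := fun x => R x.1 ⧸ Ideal.span {ϖ x.1 ^ n x.1}
  have hQ : ∀ x : Z, Module.Finite K (Q x) :=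
    fun x => (finite_finrank_quotient_pow K (hϖ x.1) (n x.1)).1
  let bas := Module.finBasis K (∀ x, Q x)
  refine ⟨Module.finrank K (∀ x, Q x), ?_, ?_⟩
  · rw [Module.finrank_pi_fintype]
    exact (Finset.sum_congr rfl fun (x : Z) _ =>
      (finite_finrank_quotient_pow K (hϖ x.1) (n x.1)).2).trans
        (Finset.sum_coe_sort Z fun x => n x * Module.finrank K (IsLocalRing.ResidueField (R x)))
  -- Lift the basis vectors to elements `r j x` of the rings, and then to elements of `L`.
  choose r hr using fun (j : Fin (Module.finrank K (∀ x, Q x))) (x : P) =>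
    show ∃ r : R x, ∀ h : x ∈ Z, Ideal.Quotient.mk _ r = (bas j ⟨x, h⟩ : Q ⟨x, h⟩) by
      by_cases h : x ∈ Z
      · obtain ⟨r, hr⟩ := Ideal.Quotient.mk_surjective (bas j ⟨x, h⟩ : Q ⟨x, h⟩)
        exact ⟨r, fun _ => hr⟩
      · exact ⟨0, fun h' => absurd h' h⟩
  choose b hb using fun j => exists_approx R hdist Z n (r j)
  have hb' : ∀ j, ∀ x ∈ Z, ∃ c : R x, b j = algebraMap (R x) L (r j x + c * ϖ x ^ n x) := by
    intro j x hx
    obtain ⟨c, hc⟩ := exists_fracOrd_mul_eq R (hϖ x) (a := b j - algebraMap (R x) L (r j x))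
      (n := n x) (fun h => hb j x hx (sub_ne_zero.mp h))
    exact ⟨c, by rw [map_add, ← hc]; ring⟩
  have hf' : ∀ x ∈ Z, ∃ c : R x, f = algebraMap (R x) L (c * ϖ x ^ n x) := fun x hx =>
    exists_fracOrd_mul_eq R (hϖ x) (fun _ => (Int.toNat_of_nonneg (hZ x hx)).le)
  refine ⟨b, ?_⟩
  -- The constant terms of a relation vanish, since its reduction modulo `f` is a relation
  -- between basis vectors.
  have hconst : ∀ p : Fin (Module.finrank K (∀ x, Q x)) → Polynomial K,
      ∑ j, Polynomial.aeval f (p j) * b j = 0 → ∀ j, (p j).coeff 0 = 0 := by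
    intro p hp
    refine Fintype.linearIndependent_iff.mp bas.linearIndependent (fun j => (p j).coeff 0) ?_
    funext ⟨x, hx⟩
    obtain ⟨c, hc⟩ := hf' x hx
    choose d hd using fun j => hb' j x hx
    have h1 : ∑ j, Polynomial.aeval (c * ϖ x ^ n x) (p j) * (r j x + d j * ϖ x ^ n x) = 0 := by
      apply IsFractionRing.injective (R x) L
      rw [map_sum, map_zero, ← hp]
      refine Finset.sum_congr rfl fun j _ => ?_
      rw [map_mul, ← hd j, ← Polynomial.aeval_algebraMap_apply, ← hc]
    let q : R x →+* Q ⟨x, hx⟩ := Ideal.Quotient.mk _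
    have hq : q (ϖ x ^ n x) = 0 :=
      Ideal.Quotient.eq_zero_iff_mem.mpr (Ideal.subset_span rfl)
    have h2 := congrArg q h1
    rw [map_sum, map_zero] at h2
    simp only [Finset.sum_apply, Pi.smul_apply, Pi.zero_apply]
    rw [← h2]
    refine Finset.sum_congr rfl fun j _ => ?_
    have h3 : q (Polynomial.aeval (c * ϖ x ^ n x) (p j)) =
        q (algebraMap K (R x) ((p j).coeff 0)) := by
      conv_lhs => rw [← Polynomial.X_mul_divX_add (p j)]
      rw [map_add, map_mul, Polynomial.aeval_X, Polynomial.aeval_C, map_add, map_mul, map_mul, hq,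
        mul_zero, zero_mul, zero_add]
    rw [map_mul, h3, map_add, map_mul, hq, mul_zero, add_zero, show q (r j x) = bas j ⟨x, hx⟩
      from hr j x hx, Algebra.smul_def]
    rfl
  -- By division by powers of `f`, all coefficients of a relation vanish.
  have hdvd : ∀ N : ℕ, ∀ p : Fin (Module.finrank K (∀ x, Q x)) → Polynomial K,
      ∑ j, Polynomial.aeval f (p j) * b j = 0 → ∀ j, Polynomial.X ^ N ∣ p j := by
    intro N
    induction N with
    | zero => intro p _ j; simp
    | succ N ih =>
      intro p hp j
      choose q hq using fun j => Polynomial.X_dvd_iff.mpr (hconst p hp j)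
      have hq0 : ∑ j, Polynomial.aeval f (q j) * b j = 0 := by
        apply mul_left_cancel₀ hf
        rw [mul_zero, ← hp, Finset.mul_sum]
        refine Finset.sum_congr rfl fun j _ => ?_
        rw [hq j, map_mul, Polynomial.aeval_X, mul_assoc]
      rw [hq j, pow_succ']
      exact mul_dvd_mul_left _ (ih q hq0 j)
  intro p hp
  funext j
  by_contra hne
  have := Polynomial.natDegree_le_of_dvd (hdvd ((p j).natDegree + 1) p hp j) hne
  rw [Polynomial.natDegree_X_pow] at this
  omega

/-- The elements of pole order at most `n` modulo the elements of `R x`: a space of dimension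
`n [κ(x) : K]`. -/
lemma finrank_polar (x : P) (hfin : Module.Finite K (IsLocalRing.ResidueField (R x))) (n : ℕ) :
    ∃ T : Submodule K (L ⧸ rangeSubmodule K (R x) L), Module.Finite K T ∧
      Module.finrank K T = n * Module.finrank K (IsLocalRing.ResidueField (R x)) ∧
      ∀ a : L, (a ≠ 0 → -(n : ℤ) ≤ fracOrd (R x) a) →
        (rangeSubmodule K (R x) L).mkQ a ∈ T := by
  obtain ⟨ϖ, hϖ⟩ := IsDiscreteValuationRing.exists_irreducible (R x)
  have h0 : algebraMap (R x) L ϖ ≠ 0 := by simpa using hϖ.ne_zero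
  let θ : R x →ₗ[K] L ⧸ rangeSubmodule K (R x) L :=
    (rangeSubmodule K (R x) L).mkQ ∘ₗ
      (LinearMap.mulLeft K ((algebraMap (R x) L ϖ ^ n)⁻¹)) ∘ₗ
        (IsScalarTower.toAlgHom K (R x) L).toLinearMap
  have hθ : ∀ r, θ r = (rangeSubmodule K (R x) L).mkQ
      ((algebraMap (R x) L ϖ ^ n)⁻¹ * algebraMap (R x) L r) := fun r => rfl
  have hker : LinearMap.ker θ = (Ideal.span {ϖ ^ n}).restrictScalars K := by
    ext r
    rw [LinearMap.mem_ker, hθ, Submodule.mkQ_apply, Submodule.Quotient.mk_eq_zero,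
      mem_rangeSubmodule, Submodule.restrictScalars_mem, Ideal.mem_span_singleton]
    constructor
    · rintro ⟨s, hs⟩
      refine ⟨s, IsFractionRing.injective (R x) L ?_⟩
      rw [map_mul, hs, map_pow]
      field_simp
    · rintro ⟨s, rfl⟩
      exact ⟨s, by rw [map_mul, map_pow]; field_simp⟩
  obtain ⟨h1, h2⟩ := finite_finrank_quotient_pow K hϖ n
  let e : (R x ⧸ Ideal.span {ϖ ^ n}) ≃ₗ[K] LinearMap.range θ :=
    (Submodule.quotEquivOfEq ((Ideal.span {ϖ ^ n}).restrictScalars K) _ hker.symm).trans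
      θ.quotKerEquivRange
  refine ⟨LinearMap.range θ, Module.Finite.equiv e, by rw [← h2, e.finrank_eq], fun a ha => ?_⟩
  obtain ⟨c, hc⟩ := mem_range_of_fracOrd_nonneg (R x) (a := algebraMap (R x) L ϖ ^ n * a) (by
    by_cases h : a = 0
    · simp [h]
    rw [fracOrd_mul _ (pow_ne_zero _ h0) h, fracOrd_pow, fracOrd_irreducible _ hϖ]
    linarith [ha h])
  refine ⟨c, ?_⟩
  rw [hθ, hc]
  congr 1
  field_simp

/-- A polynomial of degree at most `l` in `f` has a pole of order at most `l` times that of `f`, and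
`b` adds at most `c` to it. -/
lemma fracOrd_aeval_mul_ge (x : P) {f b : L} {c l : ℕ} {p : Polynomial K} (hp : p.natDegree ≤ l)
    (hb : b ≠ 0 → -(c : ℤ) ≤ fracOrd (R x) b) (h : Polynomial.aeval f p * b ≠ 0) :
    -((l * (-fracOrd (R x) f).toNat + c : ℕ) : ℤ) ≤ fracOrd (R x) (Polynomial.aeval f p * b) := by
  obtain ⟨ϖ, hϖ⟩ := IsDiscreteValuationRing.exists_irreducible (R x)
  have h0 : algebraMap (R x) L ϖ ≠ 0 := by simpa using hϖ.ne_zero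
  set n := (-fracOrd (R x) f).toNat with hn
  have hb0 : b ≠ 0 := right_ne_zero_of_mul h
  have hp0 : Polynomial.aeval f p ≠ 0 := left_ne_zero_of_mul h
  -- `ϖ ^ (l n)` clears the denominators of every monomial.
  have hmon : ∀ i ∈ p.support, algebraMap (R x) L ϖ ^ (l * n) *
      (algebraMap K L (p.coeff i) * f ^ i) ∈ (algebraMap (R x) L).range := by
    intro i hi
    have hil : i ≤ l := (Polynomial.le_natDegree_of_mem_supp i hi).trans hp
    have h1 : algebraMap (R x) L ϖ ^ (l * n) * f ^ i ∈ (algebraMap (R x) L).range := by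
      apply mem_range_of_fracOrd_nonneg
      by_cases hf : f = 0
      · rcases Nat.eq_zero_or_pos i with rfl | hi
        · simp [fracOrd_pow, fracOrd_irreducible _ hϖ]; positivity
        · simp [hf, hi.ne']
      rw [fracOrd_mul _ (pow_ne_zero _ h0) (pow_ne_zero _ hf), fracOrd_pow, fracOrd_pow,
        fracOrd_irreducible _ hϖ]
      have h2 : -(n : ℤ) ≤ fracOrd (R x) f := by omega
      have h3 : (i : ℤ) * n ≤ l * n := by exact_mod_cast Nat.mul_le_mul_right n hil
      have h4 : (i : ℤ) * (-n) ≤ i * fracOrd (R x) f :=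
        mul_le_mul_of_nonneg_left h2 (by positivity)
      push_cast
      linarith
    rw [mul_left_comm, IsScalarTower.algebraMap_apply K (R x) L]
    exact mul_mem ⟨_, rfl⟩ h1
  have hmem : algebraMap (R x) L ϖ ^ (l * n) * Polynomial.aeval f p ∈
      (algebraMap (R x) L).range := by
    rw [Polynomial.aeval_eq_sum_range, Finset.mul_sum]
    refine sum_mem fun i _ => ?_
    by_cases hi : i ∈ p.support
    · rw [Algebra.smul_def]; exact hmon i hi
    · rw [Polynomial.notMem_support_iff.mp hi]; simp
  have h5 := (mem_range_iff_fracOrd_nonneg (R x)).mp hmem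
  rw [fracOrd_mul _ (pow_ne_zero _ h0) hp0, fracOrd_pow, fracOrd_irreducible _ hϖ] at h5
  rw [fracOrd_mul _ hp0 hb0]
  have := hb hb0
  push_cast at h5 ⊢
  linarith

/-- There are at most as many elements independent over `K[f]` as the degree of the divisor of
poles of `f`: the combinations of the `b j` with coefficients of degree at most `l` in `K[f]` form
a space of dimension `m (l + 1)`, whose polar parts lie in a space of dimension
`l deg (f)_∞ + O(1)`. -/
lemma PolyIndep.le_degree_poles
    (hsupp : ∀ a : L, {x | fracOrd (R x) a ≠ 0}.Finite)
    (hfin : ∀ x, Module.Finite K (IsLocalRing.ResidueField (R x)))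
    (hconst : Module.Finite K (⨅ x, rangeSubmodule K (R x) L : Submodule K L))
    {f : L} {m : ℕ} {b : Fin m → L} (hb : PolyIndep K f b)
    (S : Finset P) (hS : ∀ x ∉ S, 0 ≤ fracOrd (R x) f) :
    m ≤ ∑ x ∈ S, (-fracOrd (R x) f).toNat *
      Module.finrank K (IsLocalRing.ResidueField (R x)) := by
  classical
  set deg : P → ℕ := fun x => Module.finrank K (IsLocalRing.ResidueField (R x))
  set n : P → ℕ := fun x => (-fracOrd (R x) f).toNat with hn
  let c : P → ℕ := fun x => ∑ j, (-fracOrd (R x) (b j)).toNat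
  have hc : ∀ x j, -(c x : ℤ) ≤ fracOrd (R x) (b j) := by
    intro x j
    have : (-fracOrd (R x) (b j)).toNat ≤ c x :=
      Finset.single_le_sum (f := fun j => (-fracOrd (R x) (b j)).toNat)
        (fun _ _ => Nat.zero_le _) (Finset.mem_univ j)
    omega
  let S' : Finset P := S ∪ Finset.univ.biUnion fun j => (hsupp (b j)).toFinset
  have hn' : ∀ x ∉ S, n x = 0 := fun x hx =>
    Int.toNat_of_nonpos (neg_nonpos.mpr (hS x hx))
  have hc' : ∀ x ∉ S', c x = 0 := by
    intro x hx
    refine Finset.sum_eq_zero fun j _ => ?_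
    simp only [S', Finset.mem_union, Finset.mem_biUnion, Finset.mem_univ, true_and,
      Set.Finite.mem_toFinset, Set.mem_ofPred_eq, not_or, not_exists, not_not] at hx
    rw [hx.2 j]; rfl
  have hn'' : ∀ x ∉ S', n x = 0 := fun x hx => hn' x fun h => hx (Finset.mem_union_left _ h)
  set H := (⨅ x, rangeSubmodule K (R x) L : Submodule K L) with hH
  have key : ∀ l : ℕ, m * (l + 1) ≤ l * ∑ x ∈ S, n x * deg x +
      (∑ x ∈ S', c x * deg x + Module.finrank K H) := by
    intro l
    -- `Ψ` maps the coefficients of a combination of the `b j` to its value, and `Θ` to its polar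
    -- parts; the kernel of `Θ` consists of combinations without poles.
    let V := Fin m → Polynomial.degreeLT K (l + 1)
    have hV : Module.finrank K V = m * (l + 1) := by
      rw [Module.finrank_pi_fintype]
      simp [(Polynomial.degreeLTEquiv K (l + 1)).finrank_eq]
    have hVf : Module.Finite K (Polynomial.degreeLT K (l + 1)) :=
      Module.Finite.equiv (Polynomial.degreeLTEquiv K (l + 1)).symm
    let Ψ : V →ₗ[K] L := ∑ j, (LinearMap.mulRight K (b j)) ∘ₗ
      (Polynomial.aeval f).toLinearMap ∘ₗ (Submodule.subtype _) ∘ₗ LinearMap.proj j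
    have hΨ : ∀ p, Ψ p = ∑ j, Polynomial.aeval f (p j : Polynomial K) * b j := by
      intro p; simp [Ψ]; rfl
    have hinj : Function.Injective Ψ := by
      rw [injective_iff_map_eq_zero]
      intro p hp
      have := hb (fun j => (p j : Polynomial K)) (by rw [← hΨ, hp])
      funext j
      exact Subtype.ext (congrFun this j)
    choose T hT1 hT2 hT3 using fun x => finrank_polar (L := L) R x (hfin x) (l * n x + c x)
    have hmem : ∀ p x, (rangeSubmodule K (R x) L).mkQ (Ψ p) ∈ T x := by
      intro p x
      rw [hΨ, map_sum]
      refine sum_mem fun j _ => hT3 x _ fun hne => ?_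
      refine fracOrd_aeval_mul_ge R x ?_ (fun _ => hc x j) hne
      have := Polynomial.mem_degreeLT.mp (p j).2
      by_cases h0 : (p j : Polynomial K) = 0
      · rw [h0]; simp
      · have := (Polynomial.natDegree_lt_iff_degree_lt h0).mpr this
        omega
    have hfree : ∀ x : S', Module.Free K (T x.1) := fun x => Module.Free.of_divisionRing K _
    let Θ : V →ₗ[K] (∀ x : S', T x.1) := LinearMap.pi fun x =>
      ((rangeSubmodule K (R x.1) L).mkQ ∘ₗ Ψ).codRestrict (T x.1) (fun p => hmem p x.1)
    have hΘker : ∀ p ∈ LinearMap.ker Θ, Ψ p ∈ H := by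
      intro p hp
      rw [hH, Submodule.mem_iInf]
      intro x
      rw [← Submodule.Quotient.mk_eq_zero]
      by_cases hx : x ∈ S'
      · exact congrArg Subtype.val (congrFun hp ⟨x, hx⟩)
      · have h1 := hmem p x
        have h2 : T x = ⊥ := by
          rw [← Submodule.finrank_eq_zero (R := K), hT2, hn'' x hx, hc' x hx]; simp
        rw [h2] at h1
        exact h1
    have hker : Module.finrank K (LinearMap.ker Θ) ≤ Module.finrank K H :=
      LinearMap.finrank_le_finrank_of_injective
        (f := (Ψ.domRestrict (LinearMap.ker Θ)).codRestrict H (fun p => hΘker p.1 p.2))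
        (fun p q h => Subtype.ext (hinj (congrArg Subtype.val h)))
    have hrange : Module.finrank K (LinearMap.range Θ) ≤ ∑ x ∈ S', (l * n x + c x) * deg x := by
      refine (Submodule.finrank_le _).trans ?_
      rw [Module.finrank_pi_fintype, ← Finset.sum_coe_sort S']
      exact (Finset.sum_congr rfl fun (x : S') _ => hT2 x.1).le
    have hrn := LinearMap.finrank_range_add_finrank_ker (V := V) (V₂ := ∀ x : S', T x.1) Θ
    have hsum : ∑ x ∈ S', n x * deg x = ∑ x ∈ S, n x * deg x :=
      (Finset.sum_subset Finset.subset_union_left fun x _ hx => by rw [hn' x hx, zero_mul]).symm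
    have hexp : ∑ x ∈ S', (l * n x + c x) * deg x =
        l * ∑ x ∈ S, n x * deg x + ∑ x ∈ S', c x * deg x := by
      rw [← hsum, Finset.mul_sum, ← Finset.sum_add_distrib]
      exact Finset.sum_congr rfl fun x _ => by ring
    rw [hV] at hrn
    omega
  -- The inequality `key` is linear in `l`, so that its leading coefficients compare.
  by_contra hlt
  push Not at hlt
  have h1 := key (∑ x ∈ S', c x * deg x + Module.finrank K H)
  set A := ∑ x ∈ S', c x * deg x + Module.finrank K H
  set D := ∑ x ∈ S, n x * deg x
  have h2 : (D + 1) * (A + 1) ≤ m * (A + 1) := Nat.mul_le_mul_right _ hlt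
  nlinarith

/-- The degree of a principal divisor is zero: the number of elements independent over `K[f]` shows
that the degree of the zeros of `f` is at most that of its poles, and the same holds for `f⁻¹`. -/
theorem sum_fracOrd_mul_degree_eq_zero
    (hdist : ∀ x y, x ≠ y → ¬ (algebraMap (R x) L).range ≤ (algebraMap (R y) L).range)
    (hsupp : ∀ a : L, {x | fracOrd (R x) a ≠ 0}.Finite)
    (hfin : ∀ x, Module.Finite K (IsLocalRing.ResidueField (R x)))
    (hconst : Module.Finite K (⨅ x, rangeSubmodule K (R x) L : Submodule K L))
    {f : L} (hf : f ≠ 0) (S : Finset P) (hS : ∀ x ∉ S, fracOrd (R x) f = 0) :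
    ∑ x ∈ S, fracOrd (R x) f * Module.finrank K (IsLocalRing.ResidueField (R x)) = 0 := by
  classical
  have key : ∀ g : L, g ≠ 0 → (∀ x ∉ S, fracOrd (R x) g = 0) →
      ∑ x ∈ S, (fracOrd (R x) g).toNat * Module.finrank K (IsLocalRing.ResidueField (R x)) ≤
        ∑ x ∈ S, (-fracOrd (R x) g).toNat *
          Module.finrank K (IsLocalRing.ResidueField (R x)) := by
    intro g hg hgS
    obtain ⟨m, hm, b, hb⟩ := exists_polyIndep R hdist hfin hg
      (S.filter fun x => 0 ≤ fracOrd (R x) g) (fun x hx => (Finset.mem_filter.mp hx).2)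
    have := hb.le_degree_poles R hsupp hfin hconst S (fun x hx => (hgS x hx).ge)
    rw [hm, Finset.sum_filter] at this
    refine le_trans (Finset.sum_le_sum fun x _ => ?_) this
    split_ifs with h
    · exact le_rfl
    · rw [Int.toNat_of_nonpos (not_le.mp h).le]; simp
  have h1 := key f hf hS
  have h2 := key f⁻¹ (inv_ne_zero hf) (fun x hx => by rw [fracOrd_inv, hS x hx, neg_zero])
  simp only [fracOrd_inv, neg_neg] at h2
  have h3 := le_antisymm h1 h2
  have h4 : ∀ x, fracOrd (R x) f = ((fracOrd (R x) f).toNat : ℤ) - (-fracOrd (R x) f).toNat :=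
    fun x => by omega
  calc _ = ∑ x ∈ S, (((fracOrd (R x) f).toNat : ℤ) *
          Module.finrank K (IsLocalRing.ResidueField (R x)) - (-fracOrd (R x) f).toNat *
          Module.finrank K (IsLocalRing.ResidueField (R x))) :=
        Finset.sum_congr rfl fun x _ => by rw [← sub_mul, ← h4]
    _ = 0 := by
        rw [Finset.sum_sub_distrib, sub_eq_zero]
        exact_mod_cast h3

end Degree

/-! ### Regular curves -/

section Proper

attribute [local instance] MvPolynomial.gradedAlgebra

variable {K : Type u} [Field K]

instance isProper_projSpaceToSpec (n : ℕ) : IsProper (projSpaceToSpec K n) := by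
  have h1 : Algebra.FiniteType (MvPolynomial.homogeneousSubmodule (Fin (n + 1)) K 0)
      (MvPolynomial (Fin (n + 1)) K) :=
    have : IsScalarTower K (MvPolynomial.homogeneousSubmodule (Fin (n + 1)) K 0)
        (MvPolynomial (Fin (n + 1)) K) :=
      IsScalarTower.of_algebraMap_eq (R := K)
        (S := MvPolynomial.homogeneousSubmodule (Fin (n + 1)) K 0) fun _ => rfl
    Algebra.FiniteType.of_restrictScalars_finiteType K _ _
  -- The homogeneous polynomials of degree zero are the constants.
  have h2 : Function.Bijective
      (algebraMap K (MvPolynomial.homogeneousSubmodule (Fin (n + 1)) K 0)) := by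
    refine ⟨fun a b hab => MvPolynomial.C_injective (Fin (n + 1)) K (congrArg Subtype.val hab),
      fun ⟨p, hp⟩ => ?_⟩
    have hp' : p.totalDegree = 0 :=
      Nat.le_zero.mp (MvPolynomial.IsHomogeneous.totalDegree_le
        ((MvPolynomial.mem_homogeneousSubmodule _ _).mp hp))
    exact ⟨p.coeff 0, Subtype.ext (MvPolynomial.totalDegree_eq_zero_iff_eq_C.mp hp').symm⟩
  have h3 : IsIso (CommRingCat.ofHom
      (algebraMap K (MvPolynomial.homogeneousSubmodule (Fin (n + 1)) K 0))) :=
    (ConcreteCategory.isIso_iff_bijective _).mpr h2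
  unfold projSpaceToSpec
  infer_instance

lemma IsProjective.isProper {X : Scheme.{u}} {π : X ⟶ Spec (CommRingCat.of K)}
    (h : IsProjective π) : IsProper π := by
  obtain ⟨n, i, hi, rfl⟩ := h
  infer_instance

end Proper

/-- Quasi-compact regular schemes of dimension one. -/
class IsRegularCurve (X : Scheme.{u}) : Prop where
  compact : CompactSpace X
  dim : topologicalKrullDim X = 1
  regular : ∀ x : X, IsRegularLocalRing (X.presheaf.stalk x)

section Topology

variable {X : Scheme.{u}} [AlgebraicGeometry.IsIntegral X] [IsLocallyNoetherian X]
  [IsRegularCurve X]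

instance IsRegularCurve.isNoetherian : IsNoetherian X :=
  { IsRegularCurve.compact (X := X) with }

lemma IsRegularCurve.krullDim_eq_one : Order.krullDim X = 1 := by
  rw [← IsRegularCurve.dim (X := X)]
  exact (Order.krullDim_eq_of_orderIso (irreducibleSetEquivPoints (α := X))).symm

lemma lt_of_specializes_of_ne {x y : X} (h : x ⤳ y) (hne : x ≠ y) : y < x :=
  lt_iff_le_not_ge.mpr ⟨h, fun h' => hne (h.antisymm h').eq⟩

lemma isClosed_singleton_of_ne_generic {x : X} (hx : x ≠ genericPoint X) :
    IsClosed ({x} : Set X) := by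
  rw [← closure_eq_iff_isClosed]
  refine Set.Subset.antisymm (fun y hy => ?_) subset_closure
  by_contra hne
  have h1 : y < x := lt_of_specializes_of_ne (specializes_iff_mem_closure.mpr hy)
    fun h => hne h.symm
  have h2 : x < genericPoint X := lt_of_specializes_of_ne (genericPoint_specializes x) hx.symm
  -- A point in the closure of `x` would be the end of a chain of length two.
  let s : LTSeries X := ⟨2, ![y, x, genericPoint X], fun i => by
    fin_cases i
    exacts [h1, h2]⟩
  have h3 := Order.LTSeries.length_le_krullDim s
  rw [IsRegularCurve.krullDim_eq_one] at h3
  have h4 : s.length = 2 := rfl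
  rw [h4] at h3
  exact absurd h3 (by decide)

lemma exists_ne_genericPoint : ∃ x : X, x ≠ genericPoint X := by
  by_contra! h
  have : Subsingleton X := ⟨fun a b => (h a).trans (h b).symm⟩
  have h1 := IsRegularCurve.krullDim_eq_one (X := X)
  rw [Order.krullDim_eq_zero] at h1
  exact absurd h1 (by decide)

lemma ClosedPoint.ne_generic (x : ClosedPoint X) : x.1 ≠ genericPoint X := by
  intro h
  obtain ⟨y, hy⟩ := exists_ne_genericPoint (X := X)
  have h1 : closure ({genericPoint X} : Set X) = {genericPoint X} := (h ▸ x.2).closure_eq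
  have h2 : y ∈ closure ({genericPoint X} : Set X) :=
    specializes_iff_mem_closure.mp (genericPoint_specializes y)
  rw [h1] at h2
  exact hy h2

lemma point_cases (y : X) : y = genericPoint X ∨ ∃ x : ClosedPoint X, x.1 = y := by
  by_cases h : y = genericPoint X
  · exact Or.inl h
  · exact Or.inr ⟨⟨y, isClosed_singleton_of_ne_generic h⟩, rfl⟩

instance : Nonempty (ClosedPoint X) := by
  obtain ⟨y, hy⟩ := exists_ne_genericPoint (X := X)
  exact ⟨⟨y, isClosed_singleton_of_ne_generic hy⟩⟩

lemma coheight_closedPoint (x : ClosedPoint X) : Order.coheight x.1 = 1 := by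
  apply le_antisymm
  · have h := Order.coheight_le_krullDim x.1
    rw [IsRegularCurve.krullDim_eq_one] at h
    exact_mod_cast h
  · rw [Order.one_le_iff_pos]
    exact Order.coheight_pos_of_lt_top
      (lt_of_specializes_of_ne (genericPoint_specializes x.1) x.ne_generic.symm)

instance isDiscreteValuationRing_stalk (x : ClosedPoint X) :
    IsDiscreteValuationRing (X.presheaf.stalk x.1) := by
  have hreg := IsRegularCurve.regular x.1
  have hdim : ringKrullDim (X.presheaf.stalk x.1) = 1 := by
    rw [ringKrullDim_stalk_eq_coheight, coheight_closedPoint]; rfl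
  have h1 := hreg.spanFinrank_maximalIdeal
  rw [hdim] at h1
  have hnf : ¬ IsField (X.presheaf.stalk x.1) := by
    intro h
    rw [ringKrullDim_eq_zero_of_isField h] at hdim
    exact absurd hdim (by decide)
  have h2 : (IsLocalRing.maximalIdeal (X.presheaf.stalk x.1)).IsPrincipal := by
    have h3 : (IsLocalRing.maximalIdeal (X.presheaf.stalk x.1)).spanFinrank = 1 := by
      exact_mod_cast h1
    exact ((Submodule.spanFinrank_eq_one_iff _).mp h3).1
  exact ((IsDiscreteValuationRing.TFAE _ hnf).out 0 4).mpr h2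

lemma finite_compl_of_isOpen {U : Set X} (hU : IsOpen U) (hne : genericPoint X ∈ U) :
    Uᶜ.Finite := by
  obtain ⟨S, hS, hcl, hirr, hsup⟩ :=
    TopologicalSpace.NoetherianSpace.exists_finite_set_isClosed_irreducible hU.isClosed_compl
  rw [hsup]
  refine hS.sUnion fun t ht => ?_
  have hgen := (hirr t ht).isGenericPoint_genericPoint (hcl t ht)
  have hy : (hirr t ht).genericPoint ≠ genericPoint X := fun h =>
    (hsup ▸ Set.mem_sUnion_of_mem hgen.mem ht : (hirr t ht).genericPoint ∈ Uᶜ) (h ▸ hne)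
  rw [← hgen.def, (isClosed_singleton_of_ne_generic hy).closure_eq]
  exact Set.finite_singleton _

/-- A set which contains the generic point and all but finitely many closed points is open. -/
lemma isOpen_of_finite_compl {U : Set X} (h : Uᶜ.Finite) (hne : genericPoint X ∈ U) :
    IsOpen U := by
  rw [← isClosed_compl_iff, ← Set.biUnion_of_singleton Uᶜ]
  refine h.isClosed_biUnion fun x hx => isClosed_singleton_of_ne_generic ?_
  rintro rfl
  exact hx hne

lemma genericPoint_mem (U : X.Opens) (hU : (U : Set X).Nonempty) : genericPoint X ∈ U :=
  ((genericPoint_spec X).mem_open_set_iff U.isOpen).mpr (by simpa using hU)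

lemma ord_eq_fracOrd (x : ClosedPoint X) (f : X.functionField) :
    Scheme.ord f x.1 = fracOrd (X.presheaf.stalk x.1) f :=
  Scheme.ord_eq_ordHom_of_coheight_eq_one (coheight_closedPoint x) f

lemma finite_fracOrd_ne_zero (f : X.functionField) :
    {x : ClosedPoint X | fracOrd (X.presheaf.stalk x.1) f ≠ 0}.Finite := by
  by_cases hf : f = 0
  · simp [hf]
  obtain ⟨U, -, s, hne, rfl, hs⟩ := exists_isUnit_germ_eq X f hf
  have h1 := finite_compl_of_isOpen U.isOpen (genericPoint_mem U ⟨_, hne.some.2⟩)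
  refine (h1.preimage Subtype.val_injective.injOn).subset fun x hx => ?_
  intro hxU
  apply hx
  rw [← ord_eq_fracOrd]
  exact Scheme.ord_of_isUnit hs hxU

end Topology

/-! ### Centers of valuation rings of the function field -/

section Center

variable {K : Type u} [Field K] {X : Scheme.{u}} [AlgebraicGeometry.IsIntegral X]
  (π : X ⟶ Spec (CommRingCat.of K))

/-- The homomorphism `K → 𝒪_{X,x}` given by the structure morphism. -/
noncomputable def toStalk (x : X) : K →+* X.presheaf.stalk x :=
  ((Scheme.ΓSpecIso (CommRingCat.of K)).inv ≫ π.appTop ≫ X.presheaf.germ ⊤ x trivial).hom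

lemma residue_toStalk (x : X) (a : K) :
    X.residue x (toStalk π x a) = toResidueField π x a := rfl

lemma algebraMap_toStalk (x : X) (a : K) :
    algebraMap (X.presheaf.stalk x) X.functionField (toStalk π x a) =
      toStalk π (genericPoint X) a := by
  have : Nonempty (⊤ : X.Opens) := ⟨⟨x, trivial⟩⟩
  exact Scheme.algebraMap_germ_eq_germToFunctionField X (U := ⊤) (x := x) trivial _

lemma fromSpecStalk_comp (x : X) :
    X.fromSpecStalk x ≫ π = Spec.map (CommRingCat.ofHom (toStalk π x)) := by
  have h1 : π = X.toSpecΓ ≫ Spec.map ((Scheme.ΓSpecIso (CommRingCat.of K)).inv ≫ π.appTop) := by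
    rw [Spec.map_comp, ← Scheme.toSpecΓ_naturality_assoc]
    simp
  have h2 : CommRingCat.ofHom (toStalk π x) = ((Scheme.ΓSpecIso (CommRingCat.of K)).inv ≫
    π.appTop) ≫ X.presheaf.germ ⊤ x trivial := rfl
  conv_lhs => rw [h1]
  rw [h2, Spec.map_comp _ (X.presheaf.germ ⊤ x trivial), Scheme.fromSpecStalk_toSpecΓ_assoc]

/-- Let `O` be a local ring with a homomorphism to `Rat(X)`. A morphism `Spec O ⟶ X` which restricts
to the generic point on `Spec Rat(X)` is given by a homomorphism over `Rat(X)` from a local ring of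
`X` to `O`. -/
lemma algebraMap_stalkClosedPointTo {O : Type u} [CommRing O] [IsLocalRing O]
    [Algebra O X.functionField] (f : Spec (CommRingCat.of O) ⟶ X)
    (hf : Spec.map (CommRingCat.ofHom (algebraMap O X.functionField)) ≫ f =
      X.fromSpecStalk (genericPoint X))
    (a : X.presheaf.stalk (f (IsLocalRing.closedPoint O))) :
    algebraMap O X.functionField ((Scheme.stalkClosedPointTo f).hom a) =
      algebraMap (X.presheaf.stalk (f (IsLocalRing.closedPoint O))) X.functionField a := by
  have h1 : Spec.map (Scheme.stalkClosedPointTo f ≫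
        CommRingCat.ofHom (algebraMap O X.functionField)) =
      Spec.map (X.presheaf.stalkSpecializes
        ((genericPoint_spec X).specializes (trivial : f (IsLocalRing.closedPoint O) ∈ _))) := by
    rw [← cancel_mono (X.fromSpecStalk (f (IsLocalRing.closedPoint O))), Spec.map_comp,
      Category.assoc, Scheme.Spec_stalkClosedPointTo_fromSpecStalk, hf,
      Scheme.SpecMap_stalkSpecializes_fromSpecStalk]
  exact congrArg (fun φ => φ.hom a) (Spec.map_injective h1)

/-- Every valuation ring of the function field which contains `K` dominates a local ring of `X`,
by the valuative criterion of properness. -/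
lemma exists_center [IsProper π] (O : ValuationSubring X.functionField)
    (hO : ∀ a : K, toStalk π (genericPoint X) a ∈ O) :
    ∃ (x : X) (φ : X.presheaf.stalk x →+* O), IsLocalHom φ ∧
      ∀ a, (φ a : X.functionField) = algebraMap (X.presheaf.stalk x) X.functionField a := by
  let i₂ : K →+* O := (toStalk π (genericPoint X)).codRestrict O.toSubring hO
  have hcomm : X.fromSpecStalk (genericPoint X) ≫ π =
      Spec.map (CommRingCat.ofHom (algebraMap O X.functionField)) ≫
        Spec.map (CommRingCat.ofHom i₂) := by
    rw [fromSpecStalk_comp, ← Spec.map_comp]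
    rfl
  have hvc : ValuativeCriterion π :=
    ((congrFun (congrFun (congrFun IsProper.eq_valuativeCriterion X) _) π).mp ‹_›).1.1.1
  let S : ValuativeCommSq π :=
    { R := O, K := X.functionField, i₁ := X.fromSpecStalk (genericPoint X),
      i₂ := Spec.map (CommRingCat.ofHom i₂), commSq := ⟨hcomm⟩ }
  obtain ⟨⟨l⟩⟩ := hvc.existence S
  refine ⟨l.l (IsLocalRing.closedPoint O), (Scheme.stalkClosedPointTo l.l).hom, inferInstance,
    fun a => algebraMap_stalkClosedPointTo l.l l.fac_left a⟩

/-- The local rings of a separated curve at two different closed points are not comparable as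
subrings of the function field, by the uniqueness part of the valuative criterion. -/
lemma eq_of_range_le [IsLocallyNoetherian X] [IsRegularCurve X] [IsSeparated π]
    {x y : ClosedPoint X}
    (h : (algebraMap (X.presheaf.stalk x.1) X.functionField).range ≤
      (algebraMap (X.presheaf.stalk y.1) X.functionField).range) : x = y := by
  have hinj := IsFractionRing.injective (X.presheaf.stalk y.1) X.functionField
  -- the inclusion of the local ring at `x` into the local ring at `y`
  let e := RingEquiv.ofLeftInverse (f := algebraMap (X.presheaf.stalk y.1) X.functionField)
    (Function.leftInverse_invFun hinj)
  let φ : X.presheaf.stalk x.1 →+* X.presheaf.stalk y.1 :=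
    e.symm.toRingHom.comp ((algebraMap (X.presheaf.stalk x.1) X.functionField).codRestrict
      (algebraMap (X.presheaf.stalk y.1) X.functionField).range fun a => h ⟨a, rfl⟩)
  have hφ : ∀ a, algebraMap (X.presheaf.stalk y.1) X.functionField (φ a) =
      algebraMap (X.presheaf.stalk x.1) X.functionField a :=
    fun a => congrArg Subtype.val (e.apply_symm_apply _)
  have hφalg : (algebraMap (X.presheaf.stalk y.1) X.functionField).comp φ =
      algebraMap (X.presheaf.stalk x.1) X.functionField := RingHom.ext hφ
  -- It is local: otherwise the prime ideal below the maximal ideal at `y` is zero, and every element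
  -- of the function field, such as the inverse of a uniformizer at `y`, is in the local ring at `y`.
  have hcl : Spec.map (CommRingCat.ofHom φ) (IsLocalRing.closedPoint (X.presheaf.stalk y.1)) =
      IsLocalRing.closedPoint (X.presheaf.stalk x.1) := by
    refine PrimeSpectrum.ext ?_
    have hne : (IsLocalRing.maximalIdeal (X.presheaf.stalk y.1)).comap φ ≠ ⊥ := by
      intro hbot
      obtain ⟨ϖ, hϖ⟩ := IsDiscreteValuationRing.exists_irreducible (X.presheaf.stalk y.1)
      obtain ⟨a, b, hb, hab⟩ := IsFractionRing.div_surjective (A := X.presheaf.stalk x.1)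
        (algebraMap (X.presheaf.stalk y.1) X.functionField ϖ)⁻¹
      have hb0 : b ≠ 0 := nonZeroDivisors.ne_zero hb
      have hu : IsUnit (φ b) := by
        by_contra hnu
        have : b ∈ (IsLocalRing.maximalIdeal (X.presheaf.stalk y.1)).comap φ := hnu
        rw [hbot] at this
        exact hb0 this
      obtain ⟨v, hv⟩ := hu
      refine hϖ.not_isUnit (IsUnit.of_mul_eq_one (φ a * ↑v⁻¹) (hinj ?_))
      have h1 : algebraMap (X.presheaf.stalk y.1) X.functionField ϖ ≠ 0 := by
        simpa using hϖ.ne_zero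
      have h2 : algebraMap (X.presheaf.stalk x.1) X.functionField b ≠ 0 := by simpa using hb0
      have h3 : algebraMap (X.presheaf.stalk y.1) X.functionField ↑v⁻¹ =
          (algebraMap (X.presheaf.stalk x.1) X.functionField b)⁻¹ := by
        rw [← hφ, ← hv]
        exact eq_inv_of_mul_eq_one_left (by rw [← map_mul]; simp)
      rw [map_mul, map_mul, hφ, h3, ← div_eq_mul_inv, hab, mul_inv_cancel₀ h1, map_one]
    exact IsLocalRing.eq_maximalIdeal ((Ideal.IsPrime.comap φ).isMaximal hne)
  have hfac : Spec.map (CommRingCat.ofHom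
      (algebraMap (X.presheaf.stalk y.1) X.functionField)) ≫ X.fromSpecStalk y.1 =
        X.fromSpecStalk (genericPoint X) :=
    Scheme.SpecMap_stalkSpecializes_fromSpecStalk (genericPoint_specializes y.1)
  have hfac' : Spec.map (CommRingCat.ofHom
      (algebraMap (X.presheaf.stalk y.1) X.functionField)) ≫
        Spec.map (CommRingCat.ofHom φ) ≫ X.fromSpecStalk x.1 =
        X.fromSpecStalk (genericPoint X) := by
    rw [← Spec.map_comp_assoc, ← CommRingCat.ofHom_comp, hφalg]
    exact Scheme.SpecMap_stalkSpecializes_fromSpecStalk (genericPoint_specializes x.1)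
  have hφK : (φ.comp (toStalk π x.1)) = toStalk π y.1 := by
    ext a
    apply hinj
    rw [RingHom.comp_apply, hφ, algebraMap_toStalk, algebraMap_toStalk]
  -- The spectrum of the local ring at `y` maps to `X` with closed point `y`, and through `φ` with
  -- closed point `x`; the two maps agree by separatedness.
  let S : ValuativeCommSq π :=
    { R := X.presheaf.stalk y.1, K := X.functionField, i₁ := X.fromSpecStalk (genericPoint X),
      i₂ := Spec.map (CommRingCat.ofHom (toStalk π y.1)),
      commSq := ⟨by rw [← fromSpecStalk_comp, ← hfac, Category.assoc]⟩ }
  have huniq := IsSeparated.valuativeCriterion π S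
  let l₁ : S.commSq.LiftStruct :=
    { l := X.fromSpecStalk y.1, fac_left := hfac, fac_right := fromSpecStalk_comp π y.1 }
  let l₂ : S.commSq.LiftStruct :=
    { l := Spec.map (CommRingCat.ofHom φ) ≫ X.fromSpecStalk x.1
      fac_left := hfac'
      fac_right := by
        rw [Category.assoc, fromSpecStalk_comp, ← Spec.map_comp, ← CommRingCat.ofHom_comp, hφK] }
  have h12 : l₁.l = l₂.l := congrArg _ (Subsingleton.elim l₁ l₂)
  have h13 := congrArg (fun f : Spec (X.presheaf.stalk y.1) ⟶ X =>
    f (IsLocalRing.closedPoint (X.presheaf.stalk y.1))) h12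
  apply Subtype.ext
  have ha : X.fromSpecStalk y.1 (IsLocalRing.closedPoint (X.presheaf.stalk y.1)) = y.1 :=
    Scheme.fromSpecStalk_closedPoint
  have hb : (Spec.map (CommRingCat.ofHom φ) ≫ X.fromSpecStalk x.1)
      (IsLocalRing.closedPoint (X.presheaf.stalk y.1)) = x.1 :=
    (Scheme.Hom.comp_apply _ _ _).trans
      ((congrArg (X.fromSpecStalk x.1) hcl).trans Scheme.fromSpecStalk_closedPoint)
  exact hb.symm.trans (h13.symm.trans ha)

end Center

/-! ### The degree formula on a proper regular curve -/

section Degree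

variable {K : Type u} [Field K] {X : Scheme.{u}} [AlgebraicGeometry.IsIntegral X]
  (π : X ⟶ Spec (CommRingCat.of K))

/-- The local rings of a `K`-scheme as `K`-algebras. -/
@[reducible] noncomputable def stalkAlgebra (x : X) : Algebra K (X.presheaf.stalk x) :=
  (toStalk π x).toAlgebra

lemma finite_toResidueField [LocallyOfFiniteType π] (x : ClosedPoint X) :
    (toResidueField π x.1).Finite := by
  have h1 : IsFinite (X.fromSpecResidueField x.1 ≫ π) := by
    have := isClosed_singleton_iff_isClosedImmersion.mp x.2
    rw [isFinite_iff_locallyOfFiniteType_of_jacobsonSpace]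
    infer_instance
  have h2 : X.fromSpecResidueField x.1 ≫ π = Spec.map (CommRingCat.ofHom (toResidueField π x.1)) := by
    rw [Scheme.fromSpecResidueField, Category.assoc, fromSpecStalk_comp, ← Spec.map_comp]
    rfl
  rw [h2, IsFinite.SpecMap_iff] at h1
  exact h1

lemma degreeAt_pos [LocallyOfFiniteType π] (x : ClosedPoint X) : 0 < degreeAt π x.1 := by
  let : Module K (X.residueField x.1) := (toResidueField π x.1).toModule
  have : Module.Finite K (X.residueField x.1) := finite_toResidueField π x
  exact Module.finrank_pos

lemma finite_and_finrank_toModule {K κ : Type*} [Field K] [CommRing κ] [inst : Algebra K κ]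
    (f : K →+* κ) (hf : ∀ c, algebraMap K κ c = f c) :
    (f.Finite → Module.Finite K κ) ∧
      @Module.finrank K κ _ _ f.toModule = Module.finrank K κ := by
  obtain rfl : inst = f.toAlgebra := Algebra.algebra_ext _ _ hf
  exact ⟨id, rfl⟩

lemma finite_residueField [LocallyOfFiniteType π] (x : ClosedPoint X) :
    letI := stalkAlgebra π x.1
    Module.Finite K (IsLocalRing.ResidueField (X.presheaf.stalk x.1)) ∧
      Module.finrank K (IsLocalRing.ResidueField (X.presheaf.stalk x.1)) = degreeAt π x.1 := by
  let := stalkAlgebra π x.1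
  have h := finite_and_finrank_toModule (κ := IsLocalRing.ResidueField (X.presheaf.stalk x.1))
    (toResidueField π x.1) fun _ => rfl
  exact ⟨h.1 (finite_toResidueField π x), h.2.symm⟩

/-- At the generic point, the embedding of the local ring into the function field is the
identity. -/
lemma algebraMap_genericPoint (a : X.functionField) :
    (stalkFunctionFieldAlgebra X (genericPoint X)).algebraMap a = a := by
  change (X.presheaf.stalkSpecializes _).hom a = a
  rw [TopCat.Presheaf.stalkSpecializes_refl]
  rfl

variable [IsLocallyNoetherian X] [IsRegularCurve X]

/-- A rational function without poles is algebraic over the base field: a valuation ring which does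
not contain it would have no center on `X`. -/
lemma isAlgebraic_of_regular [IsProper π] {a : X.functionField}
    (ha : ∀ x : ClosedPoint X, a ∈ (algebraMap (X.presheaf.stalk x.1) X.functionField).range) :
    letI := stalkAlgebra π (genericPoint X)
    IsAlgebraic K a := by
  let := stalkAlgebra π (genericPoint X)
  rw [isAlgebraic_iff_isIntegral]
  by_contra hint
  have hcl : IsIntegrallyClosedIn (integralClosure K X.functionField).toSubring X.functionField :=
    inferInstanceAs (IsIntegrallyClosedIn (integralClosure K X.functionField) X.functionField)
  obtain ⟨V, hV, haV⟩ := Subring.exists_le_valuationSubring_of_isIntegrallyClosedIn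
    (x := a) (R := (integralClosure K X.functionField).toSubring) hint
  obtain ⟨x, φ, -, hφ⟩ := exists_center π V
    (fun c => hV (algebraMap_mem (integralClosure K X.functionField) c))
  have key : a ∈ (algebraMap (X.presheaf.stalk x) X.functionField).range := by
    rcases point_cases x with rfl | ⟨y, rfl⟩
    · exact ⟨a, algebraMap_genericPoint a⟩
    · exact ha y
  obtain ⟨r, rfl⟩ := key
  exact haV (hφ r ▸ (φ r).2)

lemma fracOrd_eq_zero_of_isAlgebraic {a : X.functionField}
    (ha : letI := stalkAlgebra π (genericPoint X); IsAlgebraic K a) (x : ClosedPoint X) :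
    fracOrd (X.presheaf.stalk x.1) a = 0 := by
  let := stalkAlgebra π (genericPoint X)
  let := stalkAlgebra π x.1
  have : IsScalarTower K (X.presheaf.stalk x.1) X.functionField :=
    IsScalarTower.of_algebraMap_eq fun c => (algebraMap_toStalk π x.1 c).symm
  have key : ∀ b : X.functionField, IsAlgebraic K b → 0 ≤ fracOrd (X.presheaf.stalk x.1) b := by
    intro b hb
    rw [← mem_range_iff_fracOrd_nonneg]
    obtain ⟨r, hr⟩ := IsIntegrallyClosed.isIntegral_iff.mp
      ((isAlgebraic_iff_isIntegral.mp hb).tower_top (A := X.presheaf.stalk x.1))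
    exact ⟨r, hr⟩
  have h1 := key a ha
  have h2 := key a⁻¹ (IsAlgebraic.inv_iff.mpr ha)
  rw [fracOrd_inv] at h2
  omega

/-- The degree formula: a non-zero rational function on a proper regular curve has as many zeros
as poles, counted with multiplicities and degrees. -/
theorem sum_ord_mul_degree_eq_zero [IsProper π] {f : X.functionField} (hf : f ≠ 0)
    (S : Finset (ClosedPoint X)) (hS : ∀ x ∉ S, fracOrd (X.presheaf.stalk x.1) f = 0) :
    ∑ x ∈ S, fracOrd (X.presheaf.stalk x.1) f * degreeAt π x.1 = 0 := by
  let := stalkAlgebra π (genericPoint X)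
  let : ∀ x : ClosedPoint X, Algebra K (X.presheaf.stalk x.1) := fun x => stalkAlgebra π x.1
  have : ∀ x : ClosedPoint X, IsScalarTower K (X.presheaf.stalk x.1) X.functionField := fun x =>
    IsScalarTower.of_algebraMap_eq fun c => (algebraMap_toStalk π x.1 c).symm
  have hconst : Module.Finite K (⨅ x : ClosedPoint X,
      rangeSubmodule K (X.presheaf.stalk x.1) X.functionField : Submodule K X.functionField) := by
    -- The functions without poles have order zero everywhere, so that they are determined by their
    -- value at one closed point.
    set H := (⨅ x : ClosedPoint X,
      rangeSubmodule K (X.presheaf.stalk x.1) X.functionField : Submodule K X.functionField) with hH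
    obtain ⟨x₀⟩ : Nonempty (ClosedPoint X) := inferInstance
    have := (finite_residueField π x₀).1
    have hmem : ∀ a ∈ H, ∀ x : ClosedPoint X,
        a ∈ (algebraMap (X.presheaf.stalk x.1) X.functionField).range := fun a ha x =>
      mem_rangeSubmodule.mp (Submodule.mem_iInf _ |>.mp ha x)
    let e := LinearEquiv.ofInjective
      (IsScalarTower.toAlgHom K (X.presheaf.stalk x₀.1) X.functionField).toLinearMap
      (IsFractionRing.injective (X.presheaf.stalk x₀.1) X.functionField)
    let θ : H →ₗ[K] IsLocalRing.ResidueField (X.presheaf.stalk x₀.1) :=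
      (IsScalarTower.toAlgHom K (X.presheaf.stalk x₀.1) _).toLinearMap ∘ₗ e.symm.toLinearMap ∘ₗ
        Submodule.inclusion (iInf_le _ x₀)
    refine Module.Finite.of_injective θ ((injective_iff_map_eq_zero θ).mpr fun a ha => ?_)
    set r := e.symm (Submodule.inclusion (iInf_le _ x₀) a) with hr
    have hra : algebraMap (X.presheaf.stalk x₀.1) X.functionField r = a.1 :=
      congrArg Subtype.val (e.apply_symm_apply (Submodule.inclusion (iInf_le _ x₀) a))
    have hr0 : IsLocalRing.residue (X.presheaf.stalk x₀.1) r = 0 := ha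
    by_contra hne
    have h0 : a.1 ≠ 0 := fun h => hne (Subtype.ext h)
    have h1 := fracOrd_eq_zero_of_isAlgebraic π (isAlgebraic_of_regular π (hmem a.1 a.2)) x₀
    have hr' : r ≠ 0 := by
      rintro h; rw [h, map_zero] at hra; exact h0 hra.symm
    have h2 := (fracOrd_pos_iff (L := X.functionField) _ hr').mpr
      ((IsLocalRing.residue_eq_zero_iff r).mp hr0)
    rw [hra, h1] at h2
    exact lt_irrefl _ h2
  have := sum_fracOrd_mul_degree_eq_zero (K := K) (fun x : ClosedPoint X => X.presheaf.stalk x.1)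
    (fun x y hxy h => hxy (eq_of_range_le π h)) finite_fracOrd_ne_zero
    (fun x => (finite_residueField π x).1) hconst hf S hS
  rw [← this]
  exact Finset.sum_congr rfl fun x _ => by rw [(finite_residueField π x).2]

end Degree

/-! ### Divisors on a regular curve -/

section Divisors

variable {X : Scheme.{u}} [AlgebraicGeometry.IsIntegral X]

lemma RatUnits.val_ne_zero (f : RatUnits X) : f.val ≠ 0 := fun h => by
  have := f.val_mul_val_inv
  rw [h, zero_mul] at this
  exact zero_ne_one this

lemma RatUnits.val_one : (1 : RatUnits X).val = 1 := rfl

/-- A non-zero rational function as an element of `RatUnits X`. -/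
noncomputable def RatUnits.mk (a : X.functionField) (ha : a ≠ 0) : RatUnits X :=
  Units.mk0 (G₀ := X.functionField) a ha

lemma mem_stalkUnits_iff {x : X} {f : RatUnits X} : f ∈ stalkUnits X x ↔
    ∃ v : (X.presheaf.stalk x)ˣ, algebraMap (X.presheaf.stalk x) X.functionField v = f.val := by
  constructor
  · rintro ⟨v, rfl⟩; exact ⟨v, rfl⟩
  · rintro ⟨v, hv⟩; exact ⟨v, Units.ext hv⟩

lemma mem_stalkUnits_genericPoint (f : RatUnits X) : f ∈ stalkUnits X (genericPoint X) :=
  mem_stalkUnits_iff.mpr ⟨f, algebraMap_genericPoint f.val⟩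

variable [IsLocallyNoetherian X] [IsRegularCurve X]

/-- The order at a closed point, as a homomorphism on the group of non-zero rational functions. -/
noncomputable def ordMul (x : ClosedPoint X) : RatUnits X →* Multiplicative ℤ where
  toFun f := Multiplicative.ofAdd (fracOrd (X.presheaf.stalk x.1) f.val)
  map_one' := by rw [RatUnits.val_one, fracOrd_one]; rfl
  map_mul' f g := by
    rw [RatUnits.val_mul, fracOrd_mul _ f.val_ne_zero g.val_ne_zero]; rfl

lemma mem_stalkUnits_iff_fracOrd {x : ClosedPoint X} {f : RatUnits X} :
    f ∈ stalkUnits X x.1 ↔ fracOrd (X.presheaf.stalk x.1) f.val = 0 := by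
  rw [mem_stalkUnits_iff]
  refine ⟨?_, exists_unit_of_fracOrd_eq_zero _ f.val_ne_zero⟩
  rintro ⟨v, hv⟩
  rw [← hv, fracOrd_of_isUnit _ v.isUnit]

lemma stalkUnits_eq_ker (x : ClosedPoint X) : stalkUnits X x.1 = (ordMul x).ker := by
  ext f
  rw [mem_stalkUnits_iff_fracOrd]
  rfl

/-- The order of a germ of a Cartier divisor at a closed point. -/
noncomputable def ordQuot (x : ClosedPoint X) :
    RatUnits X ⧸ stalkUnits X x.1 →* Multiplicative ℤ :=
  QuotientGroup.lift _ (ordMul x) (stalkUnits_eq_ker x).le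

lemma ordQuot_mk (x : ClosedPoint X) (f : RatUnits X) :
    ordQuot x (QuotientGroup.mk f) =
      Multiplicative.ofAdd (fracOrd (X.presheaf.stalk x.1) f.val) := rfl

lemma ordQuot_injective (x : ClosedPoint X) : Function.Injective (ordQuot x) := by
  rw [injective_iff_map_eq_one]
  intro q hq
  obtain ⟨f, rfl⟩ := QuotientGroup.mk_surjective q
  rw [QuotientGroup.eq_one_iff, mem_stalkUnits_iff_fracOrd]
  exact hq

/-- The order of a Cartier divisor at a closed point. -/
noncomputable def cartierOrd (x : ClosedPoint X) (D : CartierDiv X) : ℤ :=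
  (ordQuot x (D.1 x.1)).toAdd

lemma cartierDiv_ext {D E : CartierDiv X} (h : ∀ x, cartierOrd x D = cartierOrd x E) : D = E := by
  apply Subtype.ext
  funext y
  rcases point_cases y with rfl | ⟨x, rfl⟩
  · obtain ⟨f, hf⟩ := QuotientGroup.mk_surjective (D.1 (genericPoint X))
    obtain ⟨g, hg⟩ := QuotientGroup.mk_surjective (E.1 (genericPoint X))
    rw [← hf, ← hg, QuotientGroup.eq]
    exact mem_stalkUnits_genericPoint _
  · exact ordQuot_injective x (h x)

/-- The order at a closed point, on the germs of `ℝ`-Cartier divisors. -/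
noncomputable def ordStalk (x : ClosedPoint X) :
    ℝ ⊗[ℤ] Additive (RatUnits X ⧸ stalkUnits X x.1) →ₗ[ℝ] ℝ :=
  LinearMap.liftBaseChange ℝ
    ((Int.castAddHom ℝ).comp (MonoidHom.toAdditiveLeft (ordQuot x))).toIntLinearMap

/-- The order of an `ℝ`-rational function at a closed point. -/
noncomputable def ordR (x : ClosedPoint X) : RRat X →ₗ[ℝ] ℝ := ordStalk x ∘ₗ stalkRRat X x.1

/-- The order of an `ℝ`-Cartier divisor at a closed point. -/
noncomputable def ordDiv (x : ClosedPoint X) : RDiv X →ₗ[ℝ] ℝ := ordStalk x ∘ₗ stalkRDiv X x.1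

lemma ordR_tmul (x : ClosedPoint X) (a : ℝ) (f : RatUnits X) :
    ordR x (a ⊗ₜ Additive.ofMul f) = a * fracOrd (X.presheaf.stalk x.1) f.val := by
  simp only [ordR, stalkRRat, ordStalk, LinearMap.comp_apply, LinearMap.baseChange_tmul,
    LinearMap.liftBaseChange_tmul, smul_eq_mul]
  rfl

lemma ordDiv_tmul (x : ClosedPoint X) (a : ℝ) (D : CartierDiv X) :
    ordDiv x (a ⊗ₜ Additive.ofMul D) = a * cartierOrd x D := by
  simp only [ordDiv, stalkRDiv, ordStalk, LinearMap.comp_apply, LinearMap.baseChange_tmul,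
    LinearMap.liftBaseChange_tmul, smul_eq_mul]
  rfl

lemma stalkRDiv_principalRDiv (x : X) (s : RRat X) :
    stalkRDiv X x (principalRDiv X s) = stalkRRat X x s := by
  rw [stalkRDiv, principalRDiv, stalkRRat, ← LinearMap.comp_apply, ← LinearMap.baseChange_comp]
  rfl

lemma ordDiv_principalRDiv (x : ClosedPoint X) (s : RRat X) :
    ordDiv x (principalRDiv X s) = ordR x s := by
  rw [ordDiv, LinearMap.comp_apply, stalkRDiv_principalRDiv]; rfl

lemma IsLocalEquation.ordDiv_eq {D : RDiv X} {U : X.Opens} {f : RRat X}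
    (h : IsLocalEquation D U f) {x : ClosedPoint X} (hx : x.1 ∈ U) : ordDiv x D = ordR x f := by
  rw [ordDiv, LinearMap.comp_apply, h _ hx]; rfl

lemma finite_ordR_ne_zero (s : RRat X) : {x : ClosedPoint X | ordR x s ≠ 0}.Finite := by
  induction s using TensorProduct.induction_on with
  | zero => simp
  | tmul a f =>
    refine (finite_fracOrd_ne_zero f.toMul.val).subset fun x hx h0 => hx ?_
    have := ordR_tmul x a f.toMul
    rw [h0] at this
    simpa using this
  | add s t hs ht =>
    refine (hs.union ht).subset fun x hx => ?_
    by_contra hn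
    simp only [Set.mem_union, Set.mem_ofPred_eq, not_or, not_not] at hn
    exact hx (by rw [map_add, hn.1, hn.2, add_zero])

/-- Locally at every point, an `ℝ`-Cartier divisor has an equation. -/
lemma exists_isLocalEquation (D : RDiv X) (p : X) :
    ∃ U : X.Opens, p ∈ U ∧ ∃ f : RRat X, IsLocalEquation D U f := by
  induction D using TensorProduct.induction_on with
  | zero => exact ⟨⊤, trivial, 0, fun y _ => by rw [map_zero, map_zero]⟩
  | tmul a D =>
    obtain ⟨U, hU, f, hf⟩ := D.toMul.2 p
    refine ⟨U, hU, a ⊗ₜ Additive.ofMul f, fun y hy => ?_⟩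
    rw [stalkRDiv, stalkRRat, LinearMap.baseChange_tmul, LinearMap.baseChange_tmul]
    exact congrArg (fun q => a ⊗ₜ[ℤ] (Additive.ofMul q)) (hf y hy)
  | add D E hD hE =>
    obtain ⟨U, hU, f, hf⟩ := hD
    obtain ⟨V, hV, g, hg⟩ := hE
    exact ⟨U ⊓ V, ⟨hU, hV⟩, f + g, fun y hy => by
      rw [map_add, map_add, hf y hy.1, hg y hy.2]⟩

/-- A rational function with a simple zero at `x`. -/
lemma exists_uniformizer (x : ClosedPoint X) :
    ∃ f : RatUnits X, fracOrd (X.presheaf.stalk x.1) f.val = 1 := by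
  obtain ⟨ϖ, hϖ⟩ := IsDiscreteValuationRing.exists_irreducible (X.presheaf.stalk x.1)
  exact ⟨RatUnits.mk (algebraMap (X.presheaf.stalk x.1) X.functionField ϖ)
    (by simpa using hϖ.ne_zero), fracOrd_irreducible _ hϖ⟩

/-- A chosen rational function with a simple zero at `x`. -/
noncomputable def uniformizer (x : ClosedPoint X) : RatUnits X := (exists_uniformizer x).choose

lemma fracOrd_uniformizer (x : ClosedPoint X) :
    fracOrd (X.presheaf.stalk x.1) (uniformizer x).val = 1 := (exists_uniformizer x).choose_spec

/-- The complement of the zeros and poles other than `x` of the chosen uniformizer at `x`. -/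
def uniformizerOpen (x : ClosedPoint X) : X.Opens where
  carrier := (Subtype.val ''
    {z : ClosedPoint X | z ≠ x ∧ fracOrd (X.presheaf.stalk z.1) (uniformizer x).val ≠ 0})ᶜ
  is_open' := by
    refine isOpen_of_finite_compl ?_ ?_
    · rw [compl_compl]
      exact ((finite_fracOrd_ne_zero _).subset fun z hz => hz.2).image _
    · rintro ⟨z, -, hz⟩
      exact ClosedPoint.ne_generic z hz

lemma mem_uniformizerOpen (x : ClosedPoint X) : x.1 ∈ uniformizerOpen x := by
  rintro ⟨z, hz, hzx⟩
  exact hz.1 (Subtype.ext hzx)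

lemma uniformizer_mem_stalkUnits {x : ClosedPoint X} {y : X} (hy : y ∈ uniformizerOpen x)
    (hne : y ≠ x.1) : uniformizer x ∈ stalkUnits X y := by
  rcases point_cases y with rfl | ⟨z, rfl⟩
  · exact mem_stalkUnits_genericPoint _
  · rw [mem_stalkUnits_iff_fracOrd]
    by_contra h
    exact hy ⟨z, ⟨fun h => hne (h ▸ rfl), h⟩, rfl⟩

open Classical in
/-- The germs of the prime divisor of a closed point. -/
noncomputable def pointDivFun (x : ClosedPoint X) (y : X) : RatUnits X ⧸ stalkUnits X y :=
  if y = x.1 then QuotientGroup.mk (uniformizer x) else 1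

lemma pointDivFun_of_mem {x : ClosedPoint X} {y : X} (hy : y ∈ uniformizerOpen x) :
    pointDivFun x y = QuotientGroup.mk (uniformizer x) := by
  rw [pointDivFun]
  split_ifs with h
  · rfl
  · exact ((QuotientGroup.eq_one_iff _).mpr (uniformizer_mem_stalkUnits hy h)).symm

/-- The complement of a closed point. -/
def complOpen (x : ClosedPoint X) : X.Opens := ⟨{x.1}ᶜ, x.2.isOpen_compl⟩

lemma pointDivFun_of_ne {x : ClosedPoint X} {y : X} (hy : y ≠ x.1) :
    pointDivFun x y = 1 := if_neg hy

/-- The prime divisor of a closed point. -/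
noncomputable def pointDiv (x : ClosedPoint X) : CartierDiv X :=
  ⟨pointDivFun x, fun p => by
    by_cases hp : p = x.1
    · exact ⟨uniformizerOpen x, hp ▸ mem_uniformizerOpen x, uniformizer x,
        fun y hy => pointDivFun_of_mem hy⟩
    · exact ⟨complOpen x, hp, 1, fun y hy => pointDivFun_of_ne hy⟩⟩

lemma isEffectiveCartier_pointDiv (x : ClosedPoint X) : IsEffectiveCartier (pointDiv x) := by
  intro p
  by_cases hp : p = x.1
  · refine ⟨uniformizerOpen x, hp ▸ mem_uniformizerOpen x, uniformizer x,
        fun y hy => ⟨pointDivFun_of_mem hy, ?_⟩⟩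
    by_cases h : y = x.1
    · subst h
      exact mem_range_of_fracOrd_nonneg _ (by rw [fracOrd_uniformizer]; exact zero_le_one)
    · obtain ⟨v, hv⟩ := mem_stalkUnits_iff.mp (uniformizer_mem_stalkUnits hy h)
      exact ⟨v, hv⟩
  · exact ⟨complOpen x, hp, 1, fun y hy => ⟨pointDivFun_of_ne hy, one_mem _⟩⟩

lemma cartierOrd_pointDiv_self (x : ClosedPoint X) : cartierOrd x (pointDiv x) = 1 := by
  change (ordQuot x (pointDivFun x x.1)).toAdd = 1
  rw [pointDivFun_of_mem (mem_uniformizerOpen x), ordQuot_mk, fracOrd_uniformizer]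
  rfl

lemma cartierOrd_pointDiv_of_ne {x y : ClosedPoint X} (h : y ≠ x) :
    cartierOrd y (pointDiv x) = 0 := by
  change (ordQuot y (pointDivFun x y.1)).toAdd = 0
  rw [pointDivFun_of_ne fun h' => h (Subtype.ext h'), map_one]
  rfl

lemma cartierOrd_mul (x : ClosedPoint X) (D E : CartierDiv X) :
    cartierOrd x (D * E) = cartierOrd x D + cartierOrd x E := by
  change (ordQuot x (D.1 x.1 * E.1 x.1)).toAdd = _
  rw [map_mul]; rfl

/-- The order at a closed point, as a homomorphism on the group of Cartier divisors. -/
noncomputable def cartierOrdHom (x : ClosedPoint X) : Additive (CartierDiv X) →+ ℤ :=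
  AddMonoidHom.mk' (fun D => cartierOrd x D.toMul) fun D E => cartierOrd_mul x D.toMul E.toMul

lemma cartierOrd_principalDiv (x : ClosedPoint X) (f : RatUnits X) :
    cartierOrd x (principalDiv X f) = fracOrd (X.presheaf.stalk x.1) f.val := rfl

lemma finite_cartierOrd_ne_zero (D : CartierDiv X) :
    {x : ClosedPoint X | cartierOrd x D ≠ 0}.Finite := by
  obtain ⟨U, hU, f, hf⟩ := D.2 (genericPoint X)
  have h1 := (finite_compl_of_isOpen U.isOpen hU).preimage
    (f := (Subtype.val : ClosedPoint X → X)) Subtype.val_injective.injOn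
  refine (h1.union (finite_fracOrd_ne_zero f.val)).subset fun x hx => ?_
  by_cases hxU : x.1 ∈ U
  · refine Or.inr fun h => hx ?_
    rw [cartierOrd, hf _ hxU, ordQuot_mk, h]; rfl
  · exact Or.inl hxU

/-- The `ℝ`-Cartier divisor with given orders at the closed points. -/
noncomputable def pointsRDiv : (ClosedPoint X →₀ ℝ) →ₗ[ℝ] RDiv X :=
  Finsupp.linearCombination ℝ fun x => (1 : ℝ) ⊗ₜ[ℤ] Additive.ofMul (pointDiv x)

lemma ordDiv_pointsRDiv (c : ClosedPoint X →₀ ℝ) (y : ClosedPoint X) :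
    ordDiv y (pointsRDiv c) = c y := by
  classical
  have h : (ordDiv y) ∘ₗ pointsRDiv = Finsupp.lapply y := by
    ext x
    simp only [pointsRDiv, LinearMap.comp_apply, Finsupp.lsingle_apply,
      Finsupp.linearCombination_single, one_smul, Finsupp.lapply_apply]
    rw [ordDiv_tmul, one_mul, Finsupp.single_apply]
    split_ifs with hxy
    · rw [hxy, cartierOrd_pointDiv_self]; simp
    · rw [cartierOrd_pointDiv_of_ne (Ne.symm hxy)]; simp
  exact congrArg (fun φ => φ c) h

lemma eq_sum_pointDiv (D : CartierDiv X) (S : Finset (ClosedPoint X))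
    (hS : ∀ x ∉ S, cartierOrd x D = 0) :
    Additive.ofMul D = ∑ x ∈ S, cartierOrd x D • Additive.ofMul (pointDiv x) := by
  classical
  suffices h : ∀ y, cartierOrdHom y (Additive.ofMul D) =
      cartierOrdHom y (∑ x ∈ S, cartierOrd x D • Additive.ofMul (pointDiv x)) from
    Additive.toMul.injective (cartierDiv_ext h)
  intro y
  rw [map_sum]
  simp only [map_zsmul]
  have h1 : ∀ x, cartierOrdHom y (Additive.ofMul (pointDiv x)) = if x = y then 1 else 0 := by
    intro x
    split_ifs with h
    · rw [h]; exact cartierOrd_pointDiv_self y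
    · exact cartierOrd_pointDiv_of_ne (Ne.symm h)
  simp only [h1, smul_eq_mul, mul_ite, mul_one, mul_zero, Finset.sum_ite_eq']
  split_ifs with h
  · rfl
  · exact hS y h

/-- On a regular curve, an `ℝ`-Cartier divisor is a combination of prime divisors. -/
lemma pointsRDiv_surjective : Function.Surjective (pointsRDiv (X := X)) := by
  rw [← LinearMap.range_eq_top, eq_top_iff]
  rintro D -
  induction D using TensorProduct.induction_on with
  | zero => exact zero_mem _
  | tmul a D =>
    have h1 := eq_sum_pointDiv D.toMul (finite_cartierOrd_ne_zero D.toMul).toFinset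
      (fun x hx => by simpa using hx)
    have h2 : a ⊗ₜ[ℤ] D = ∑ x ∈ (finite_cartierOrd_ne_zero D.toMul).toFinset,
        (a * cartierOrd x D.toMul) • ((1 : ℝ) ⊗ₜ[ℤ] Additive.ofMul (pointDiv x)) := by
      conv_lhs => rw [show D = Additive.ofMul D.toMul from rfl, h1, TensorProduct.tmul_sum]
      refine Finset.sum_congr rfl fun x _ => ?_
      rw [TensorProduct.tmul_smul, TensorProduct.smul_tmul', TensorProduct.smul_tmul']
      congr 1
      simp [mul_comm]
    rw [h2]
    refine sum_mem fun x _ => Submodule.smul_mem _ _ ⟨Finsupp.single x 1, ?_⟩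
    simp [pointsRDiv]
  | add D E hD hE => exact add_mem hD hE

lemma finite_ordDiv_ne_zero (D : RDiv X) : {x : ClosedPoint X | ordDiv x D ≠ 0}.Finite := by
  obtain ⟨c, rfl⟩ := pointsRDiv_surjective D
  refine c.support.finite_toSet.subset fun x hx => ?_
  rw [Set.mem_ofPred_eq, ordDiv_pointsRDiv] at hx
  simpa using hx

lemma cartierOrd_nonneg {D : CartierDiv X} (h : IsEffectiveCartier D) (x : ClosedPoint X) :
    0 ≤ cartierOrd x D := by
  obtain ⟨U, hU, f, hf⟩ := h x.1
  obtain ⟨h1, h2⟩ := hf x.1 hU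
  rw [cartierOrd, h1]
  exact (mem_range_iff_fracOrd_nonneg _).mp h2

lemma isEffectiveRDiv_iff {D : RDiv X} : IsEffectiveRDiv D ↔ ∀ x, 0 ≤ ordDiv x D := by
  constructor
  · rintro ⟨r, a, E, ha, hE, rfl⟩ x
    rw [map_sum]
    refine Finset.sum_nonneg fun i _ => ?_
    rw [ordDiv_tmul]
    exact mul_nonneg (ha i).le (by exact_mod_cast cartierOrd_nonneg (hE i) x)
  · intro h
    obtain ⟨c, rfl⟩ := pointsRDiv_surjective D
    simp only [ordDiv_pointsRDiv] at h
    let e := c.support.equivFin.symm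
    refine ⟨c.support.card, fun i => c (e i), fun i => pointDiv (e i).1,
      fun i => lt_of_le_of_ne (h _) (Ne.symm (Finsupp.mem_support_iff.mp (e i).2)),
      fun i => isEffectiveCartier_pointDiv _, ?_⟩
    rw [pointsRDiv, Finsupp.linearCombination_apply, Finsupp.sum, ← Finset.sum_coe_sort,
      ← e.sum_comp]
    refine Finset.sum_congr rfl fun i _ => ?_
    rw [TensorProduct.smul_tmul', smul_eq_mul, mul_one]

variable {K : Type u} [Field K] (π : X ⟶ Spec (CommRingCat.of K)) [IsProper π]

/-- Principal `ℝ`-divisors have degree zero. -/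
lemma sum_ordR_mul_degree_eq_zero (s : RRat X) (S : Finset (ClosedPoint X))
    (hS : ∀ x ∉ S, ordR x s = 0) : ∑ x ∈ S, ordR x s * degreeAt π x.1 = 0 := by
  have key : ∀ s : RRat X, ∑ᶠ x : ClosedPoint X, ordR x s * degreeAt π x.1 = 0 := by
    intro s
    induction s using TensorProduct.induction_on with
    | zero => simp
    | tmul a f =>
      have h := sum_ord_mul_degree_eq_zero π f.toMul.val_ne_zero
        (finite_fracOrd_ne_zero f.toMul.val).toFinset (fun x hx => by simpa using hx)
      rw [finsum_eq_sum_of_support_subset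
        (s := (finite_fracOrd_ne_zero f.toMul.val).toFinset)]
      · have h' : ∀ x, ordR x (a ⊗ₜ f) = a * fracOrd (X.presheaf.stalk x.1) f.toMul.val :=
          fun x => ordR_tmul x a f.toMul
        simp only [h', mul_assoc]
        rw [← Finset.mul_sum]
        have h2 := congrArg (Int.cast : ℤ → ℝ) h
        push_cast at h2
        rw [h2, mul_zero]
      · intro x hx
        have h' := ordR_tmul x a f.toMul
        simp only [Set.Finite.coe_toFinset, Set.mem_ofPred_eq]
        intro h0
        rw [h0] at h'
        apply hx
        change ordR x (a ⊗ₜ f) * _ = 0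
        have h3 : ordR x (a ⊗ₜ f) = 0 := by simpa using h'
        rw [h3, zero_mul]
    | add s t hs ht =>
      have hfin : ∀ s : RRat X, (Function.support fun x : ClosedPoint X =>
          ordR x s * (degreeAt π x.1 : ℝ)).Finite := fun s =>
        (finite_ordR_ne_zero s).subset fun x hx => left_ne_zero_of_mul hx
      simp only [map_add, add_mul]
      rw [finsum_add_distrib (hfin s) (hfin t), hs, ht, add_zero]
  rw [← key s, finsum_eq_sum_of_support_subset]
  intro x hx
  by_contra h
  exact hx (by simp [hS x h])

/-- The degree of a Cartier divisor. -/
noncomputable def cartierDegree : Additive (CartierDiv X) →+ ℤ :=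
  AddMonoidHom.mk' (fun D => ∑ᶠ x : ClosedPoint X, cartierOrd x D.toMul * degreeAt π x.1) (by
    intro D E
    have hfin : ∀ D : CartierDiv X, (Function.support fun x : ClosedPoint X =>
        cartierOrd x D * (degreeAt π x.1 : ℤ)).Finite := fun D =>
      (finite_cartierOrd_ne_zero D).subset fun x hx => left_ne_zero_of_mul hx
    rw [← finsum_add_distrib (hfin _) (hfin _)]
    refine finsum_congr fun x => ?_
    rw [← add_mul, ← cartierOrd_mul]
    rfl)

lemma cartierDegree_pointDiv (x : ClosedPoint X) :
    cartierDegree π (Additive.ofMul (pointDiv x)) = degreeAt π x.1 := by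
  change ∑ᶠ y : ClosedPoint X, cartierOrd y (pointDiv x) * (degreeAt π y.1 : ℤ) = _
  rw [finsum_eq_single _ x fun y hy => by rw [cartierOrd_pointDiv_of_ne hy, zero_mul],
    cartierOrd_pointDiv_self, one_mul]

lemma cartierDegree_principalDiv (f : RatUnits X) :
    cartierDegree π (Additive.ofMul (principalDiv X f)) = 0 := by
  change ∑ᶠ y : ClosedPoint X, fracOrd (X.presheaf.stalk y.1) f.val * (degreeAt π y.1 : ℤ) = _
  rw [finsum_eq_sum_of_support_subset (s := (finite_fracOrd_ne_zero f.val).toFinset)]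
  · exact sum_ord_mul_degree_eq_zero π f.val_ne_zero _ (fun x hx => by simpa using hx)
  · intro x hx
    simpa using left_ne_zero_of_mul hx

/-- The degree on the Picard group. -/
noncomputable def picDegree : Additive (Pic X) →+ ℤ :=
  MonoidHom.toAdditiveLeft (QuotientGroup.lift (principalDiv X).range
    (MonoidHom.toAdditiveLeft.symm (cartierDegree π)) (by
      rintro _ ⟨f, rfl⟩
      exact congrArg Multiplicative.ofAdd (cartierDegree_principalDiv π f)))

/-- If `Pic(X) ⊗ ℚ` is one-dimensional, divisor classes of degree zero are torsion. -/
lemma exists_zpow_eq_principalDiv (hpic : PicRankOne X) (D : CartierDiv X)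
    (hD : cartierDegree π (Additive.ofMul D) = 0) :
    ∃ n : ℤ, n ≠ 0 ∧ ∃ f : RatUnits X, D ^ n = principalDiv X f := by
  let d : ℚ ⊗[ℤ] Additive (Pic X) →ₗ[ℚ] ℚ := LinearMap.liftBaseChange ℚ
    ((Int.castAddHom ℚ).comp (picDegree π)).toIntLinearMap
  have hd : ∀ (q : ℚ) (D : CartierDiv X), d (q ⊗ₜ Additive.ofMul (QuotientGroup.mk D)) =
      q * cartierDegree π (Additive.ofMul D) := by
    intro q D
    rw [LinearMap.liftBaseChange_tmul]; rfl
  obtain ⟨x₀⟩ : Nonempty (ClosedPoint X) := inferInstance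
  have hd0 : d ((1 : ℚ) ⊗ₜ Additive.ofMul (QuotientGroup.mk (pointDiv x₀))) ≠ 0 := by
    rw [hd, cartierDegree_pointDiv, one_mul]
    exact_mod_cast (degreeAt_pos π x₀).ne'
  -- The degree is a non-zero linear form on a line.
  have hinj : Function.Injective d := by
    have hfin : Module.finrank ℚ (ℚ ⊗[ℤ] Additive (Pic X)) = 1 := by
      rw [Module.finrank, hpic]; simp
    rw [injective_iff_map_eq_zero]
    intro z hz
    obtain ⟨c, rfl⟩ := (finrank_eq_one_iff_of_nonzero'
      ((1 : ℚ) ⊗ₜ[ℤ] (Additive.ofMul (QuotientGroup.mk (pointDiv x₀) : Pic X)))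
      (fun h => hd0 (by rw [h, map_zero]))).mp hfin z
    rw [map_smul, smul_eq_mul] at hz
    rw [(mul_eq_zero.mp hz).resolve_right hd0, zero_smul]
  have h1 : (1 : ℚ) ⊗ₜ[ℤ] (Additive.ofMul (QuotientGroup.mk D : Pic X)) = 0 :=
    hinj (by rw [hd, hD, map_zero]; simp)
  obtain ⟨n, hn⟩ := (IsLocalizedModule.eq_zero_iff (nonZeroDivisors ℤ)
    (TensorProduct.mk ℤ ℚ (Additive (Pic X)) 1)).mp h1
  refine ⟨n.1, nonZeroDivisors.ne_zero n.2, ?_⟩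
  have h2 : (QuotientGroup.mk (D ^ n.1) : Pic X) = 1 := hn
  obtain ⟨f, hf⟩ := (QuotientGroup.eq_one_iff _).mp h2
  exact ⟨f, hf.symm⟩

/-- If `Pic(X) ⊗ ℚ` is one-dimensional, any closed point is `ℝ`-linearly equivalent to a multiple
of any other one. -/
lemma exists_ordR_eq (hpic : PicRankOne X) (x x₀ : ClosedPoint X) :
    ∃ s : RRat X, ∀ y, ordR y s = Finsupp.single x 1 y -
      (degreeAt π x.1 / degreeAt π x₀.1 : ℝ) * Finsupp.single x₀ 1 y := by
  classical
  let D : Additive (CartierDiv X) := (degreeAt π x₀.1 : ℤ) • Additive.ofMul (pointDiv x) -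
    (degreeAt π x.1 : ℤ) • Additive.ofMul (pointDiv x₀)
  have hD : cartierDegree π D = 0 := by
    rw [map_sub, map_zsmul, map_zsmul, cartierDegree_pointDiv, cartierDegree_pointDiv]
    simp [mul_comm]
  obtain ⟨n, hn, f, hf⟩ := exists_zpow_eq_principalDiv π hpic D.toMul hD
  have hn' : (n : ℝ) ≠ 0 := by exact_mod_cast hn
  have hd' : (degreeAt π x₀.1 : ℝ) ≠ 0 := by exact_mod_cast (degreeAt_pos π x₀).ne'
  refine ⟨(n * degreeAt π x₀.1 : ℝ)⁻¹ ⊗ₜ Additive.ofMul f, fun y => ?_⟩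
  have h1 : ∀ z : ClosedPoint X, cartierOrdHom y (Additive.ofMul (pointDiv z)) =
      if z = y then 1 else 0 := by
    intro z
    split_ifs with h
    · rw [h]; exact cartierOrd_pointDiv_self y
    · exact cartierOrd_pointDiv_of_ne (Ne.symm h)
  have h2 : fracOrd (X.presheaf.stalk y.1) f.val =
      n * (degreeAt π x₀.1 * (if x = y then 1 else 0) - degreeAt π x.1 * (if x₀ = y then 1 else 0)) := by
    rw [← cartierOrd_principalDiv, ← hf]
    change cartierOrdHom y (n • D) = _
    rw [map_zsmul, map_sub, map_zsmul, map_zsmul, h1, h1]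
    simp only [smul_eq_mul]
  rw [ordR_tmul, h2, Finsupp.single_apply, Finsupp.single_apply]
  push_cast
  field_simp

/-- If `Pic(X) ⊗ ℚ` is one-dimensional, an `ℝ`-divisor of non-negative degree is `ℝ`-linearly
equivalent to an effective one. -/
lemma exists_nonneg_add_ordR (hpic : PicRankOne X) (M : ClosedPoint X →₀ ℝ)
    (hM : 0 ≤ ∑ x ∈ M.support, M x * degreeAt π x.1) :
    ∃ s : RRat X, ∀ y, 0 ≤ M y + ordR y s := by
  obtain ⟨x₀⟩ : Nonempty (ClosedPoint X) := inferInstance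
  choose s hs using fun x => exists_ordR_eq π hpic x x₀
  -- Move all the points of the divisor to multiples of `x₀`.
  refine ⟨-∑ x ∈ M.support, M x • s x, fun y => ?_⟩
  have h1 : ordR y (∑ x ∈ M.support, M x • s x) =
      M y - (∑ x ∈ M.support, M x * degreeAt π x.1) / degreeAt π x₀.1 *
        Finsupp.single x₀ (1 : ℝ) y := by
    rw [map_sum]
    simp only [map_smul, hs, smul_eq_mul, mul_sub]
    rw [Finset.sum_sub_distrib, Finset.sum_div, Finset.sum_mul]
    congr 1
    · conv_rhs => rw [← Finsupp.sum_single M, Finsupp.sum, Finsupp.finsetSum_apply]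
      refine Finset.sum_congr rfl fun x _ => ?_
      classical
      simp [Finsupp.single_apply]
    · exact Finset.sum_congr rfl fun x _ => by ring
  rw [map_neg, h1]
  have h2 : (0 : ℝ) ≤ Finsupp.single x₀ (1 : ℝ) y := by
    classical
    rw [Finsupp.single_apply]; split_ifs <;> norm_num
  have := mul_nonneg (div_nonneg hM (Nat.cast_nonneg (degreeAt π x₀.1) : (0 : ℝ) ≤ _)) h2
  linarith

end Divisors

/-! ### The branches of the Berkovich space -/

section Branches

variable {K : Type u} [Field K] {X : Scheme.{u}} [AlgebraicGeometry.IsIntegral X]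
  {π : X ⟶ Spec (CommRingCat.of K)}

/-- The identification of the function field with the residue field of the generic point. -/
noncomputable def residueEquiv : X.functionField ≃+* X.residueField (genericPoint X) :=
  RingEquiv.ofBijective (X.residue (genericPoint X)).hom
    ⟨RingHom.injective (R := X.functionField) _, X.residue_surjective _⟩

lemma residueEquiv_apply (a : X.functionField) :
    residueEquiv a = X.residue (genericPoint X) a := rfl

variable (π) in
/-- The point of the Berkovich space given by an absolute value of the function field. -/
noncomputable def genericAbv (v : AbsoluteValue X.functionField ℝ)
    (hv : ∀ c : K, c ≠ 0 → v (toStalk π (genericPoint X) c) = 1) : Berkovich π where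
  point := genericPoint X
  abv := v.comp (f := (residueEquiv (X := X)).symm.toRingHom) (residueEquiv (X := X)).symm.injective
  trivial_on_base c hc := by
    rw [← residue_toStalk, ← residueEquiv_apply]
    change v (residueEquiv.symm (residueEquiv _)) = 1
    rw [RingEquiv.symm_apply_apply, hv c hc]

lemma genericAbv_residue (v : AbsoluteValue X.functionField ℝ) (hv) (a : X.functionField) :
    (genericAbv π v hv).abv (X.residue (genericPoint X) a) = v a := by
  rw [← residueEquiv_apply]
  change v (residueEquiv.symm (residueEquiv _)) = _
  rw [RingEquiv.symm_apply_apply]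

lemma genericAbv_absEval (v : AbsoluteValue X.functionField ℝ) (hv) {U : X.Opens}
    (hU : genericPoint X ∈ U) (f : Γ(X, U)) :
    (genericAbv π v hv).absEval hU f = v (X.presheaf.germ U (genericPoint X) hU f) :=
  genericAbv_residue v hv _

/-- A point over the generic point is determined by its absolute value on rational functions. -/
lemma eq_genericAbv (ξ : Berkovich π) (hξ : ξ.point = genericPoint X)
    (v : AbsoluteValue X.functionField ℝ) (hv)
    (h : ∀ a : X.presheaf.stalk ξ.point, ξ.abv (X.residue ξ.point a) =
      v (algebraMap (X.presheaf.stalk ξ.point) X.functionField a)) :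
    ξ = genericAbv π v hv := by
  obtain ⟨p, w, hw⟩ := ξ
  obtain rfl : p = genericPoint X := hξ
  have : w = (genericAbv π v hv).abv := by
    ext b
    obtain ⟨a, rfl⟩ := X.residue_surjective _ b
    exact ((h a).trans (congrArg v (algebraMap_genericPoint a))).trans
      (genericAbv_residue v hv a).symm
  subst this
  rfl

lemma abv_trivial_apply {F : Type*} [Field F] [DecidablePred fun a : F => a = 0] {a : F}
    (ha : a ≠ 0) : (AbsoluteValue.trivial : AbsoluteValue F ℝ) a = 1 := if_neg ha

variable (π) in
open Classical in
/-- The root of the tree `X^an`: the generic point with the trivial absolute value. -/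
noncomputable def root : Berkovich π :=
  genericAbv π AbsoluteValue.trivial fun c hc =>
    abv_trivial_apply (by simpa using hc)

variable (π) in
open Classical in
/-- The end of the branch of the closed point `x`: the trivial absolute value on `κ(x)`. -/
noncomputable def closedPt (x : ClosedPoint X) : Berkovich π where
  point := x.1
  abv := AbsoluteValue.trivial
  trivial_on_base c hc := abv_trivial_apply (by simpa using hc)

lemma root_point : (root π).point = genericPoint X := rfl

variable [IsLocallyNoetherian X] [IsRegularCurve X]

lemma fracOrd_toStalk (x : ClosedPoint X) (c : K) (hc : c ≠ 0) :
    fracOrd (X.presheaf.stalk x.1) (toStalk π (genericPoint X) c) = 0 := by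
  rw [← algebraMap_toStalk π x.1, fracOrd_of_isUnit]
  exact (Ne.isUnit hc).map _

variable (π) in
/-- The point `ξ_{x,t}` with absolute value `e^{-t ord_x(·)}`. The parameter is truncated at `0`, so
that it can be any real number, and parameters `t ≤ 0` give the root. -/
noncomputable def branch (x : ClosedPoint X) (t : ℝ) : Berkovich π :=
  genericAbv π (expAbv (X.presheaf.stalk x.1) X.functionField t) fun c hc => by
    rw [expAbv_apply _ _ (by simpa using hc), fracOrd_toStalk x c hc]; simp

lemma branch_point (x : ClosedPoint X) (t : ℝ) : (branch π x t).point = genericPoint X := rfl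

lemma branch_residue (x : ClosedPoint X) (t : ℝ) {a : X.functionField} (ha : a ≠ 0) :
    (branch π x t).abv (X.residue (genericPoint X) a) =
      Real.exp (-(max t 0) * fracOrd (X.presheaf.stalk x.1) a) :=
  (genericAbv_residue _ _ a).trans (expAbv_apply _ t ha)

lemma branch_of_nonpos (x : ClosedPoint X) {t : ℝ} (ht : t ≤ 0) : branch π x t = root π := by
  classical
  have h : expAbv (X.presheaf.stalk x.1) X.functionField t = AbsoluteValue.trivial := by
    ext a
    by_cases ha : a = 0
    · simp [ha]
    · rw [abv_trivial_apply ha, expAbv_apply _ _ ha, max_eq_right ht]; simp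
  unfold branch root
  congr 1

lemma branch_absEval (x : ClosedPoint X) (t : ℝ) {U : X.Opens}
    (hU : genericPoint X ∈ U) (f : Γ(X, U)) :
    (branch π x t).absEval hU f = expAbv (X.presheaf.stalk x.1) X.functionField t
      (X.presheaf.germ U (genericPoint X) hU f) :=
  genericAbv_absEval _ _ hU f

lemma continuous_expAbv (x : ClosedPoint X) (a : X.functionField) :
    Continuous fun t => expAbv (X.presheaf.stalk x.1) X.functionField t a := by
  by_cases ha : a = 0
  · simpa [ha] using continuous_const
  · simp only [expAbv_apply _ _ ha]
    fun_prop

lemma continuous_branch (x : ClosedPoint X) : Continuous (branch π x) := by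
  refine continuous_generateFrom_iff.mpr ?_
  rintro _ (⟨U, rfl⟩ | ⟨U, f, A, hA, rfl⟩)
  · by_cases hU : genericPoint X ∈ U
    · convert isOpen_univ
      exact Set.eq_univ_of_forall fun t => hU
    · convert isOpen_empty
      exact Set.eq_empty_of_forall_notMem fun t => hU
  · by_cases hU : genericPoint X ∈ U
    · have h := (continuous_expAbv x (X.presheaf.germ U (genericPoint X) hU f)).isOpen_preimage A hA
      convert h using 1
      ext t
      constructor
      · rintro ⟨_, h⟩
        simpa [← branch_absEval (π := π)] using h
      · intro h
        refine ⟨hU, ?_⟩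
        simpa [← branch_absEval (π := π)] using h
    · convert isOpen_empty
      exact Set.eq_empty_of_forall_notMem fun t h => hU h.1

lemma tendsto_branch_atTop (x : ClosedPoint X) :
    Filter.Tendsto (branch π x) Filter.atTop (𝓝 (closedPt π x)) := by
  classical
  refine TopologicalSpace.tendsto_nhds_generateFrom_iff.mpr ?_
  rintro _ (⟨U, rfl⟩ | ⟨U, f, A, hA, rfl⟩) hx
  · exact Filter.Eventually.of_forall fun t => genericPoint_mem U ⟨_, hx⟩
  · obtain ⟨hxU, hxA⟩ := hx
    change x.1 ∈ U at hxU
    have hU : genericPoint X ∈ U := genericPoint_mem U ⟨_, hxU⟩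
    have : Nonempty U := ⟨⟨_, hU⟩⟩
    set b := X.presheaf.germ U x.1 hxU f with hb
    have hab : algebraMap (X.presheaf.stalk x.1) X.functionField b =
        X.presheaf.germ U (genericPoint X) hU f :=
      Scheme.algebraMap_germ_eq_germToFunctionField X hxU f
    suffices h : Filter.Tendsto (fun t => expAbv (X.presheaf.stalk x.1) X.functionField t
        (X.presheaf.germ U (genericPoint X) hU f)) Filter.atTop
        (𝓝 ((closedPt π x).absEval hxU f)) by
      filter_upwards [h.eventually (hA.mem_nhds hxA)] with t ht
      exact ⟨hU, by rw [branch_absEval]; exact ht⟩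
    have hval : (closedPt π x).absEval hxU f =
      (AbsoluteValue.trivial : AbsoluteValue (X.residueField x.1) ℝ) (X.residue x.1 b) := rfl
    rw [hval, ← hab]
    by_cases hb0 : b = 0
    · simp [hb0]
    have hb0' : algebraMap (X.presheaf.stalk x.1) X.functionField b ≠ 0 := by simpa using hb0
    simp only [expAbv_apply _ _ hb0']
    by_cases hbm : b ∈ IsLocalRing.maximalIdeal (X.presheaf.stalk x.1)
    · have hres : X.residue x.1 b = 0 := (IsLocalRing.residue_eq_zero_iff b).mpr hbm
      rw [hres, map_zero]
      refine Real.tendsto_exp_atBot.comp ?_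
      have hpos : (0 : ℝ) < fracOrd (X.presheaf.stalk x.1)
          (algebraMap (X.presheaf.stalk x.1) X.functionField b) := by
        exact_mod_cast (fracOrd_pos_iff _ hb0).mpr hbm
      have h1 : Filter.Tendsto (fun t : ℝ => max t 0) Filter.atTop Filter.atTop :=
        Filter.tendsto_atTop_mono (fun t => le_max_left t 0) Filter.tendsto_id
      exact (Filter.tendsto_neg_atTop_atBot.comp h1).atBot_mul_const hpos
    · have hu : IsUnit b := by simpa using hbm
      have hres : X.residue x.1 b ≠ 0 := fun h => hbm ((IsLocalRing.residue_eq_zero_iff b).mp h)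
      rw [abv_trivial_apply hres, fracOrd_of_isUnit _ hu]
      simp

/-- The branches converge to the root uniformly in the parameter: a neighbourhood of the root
contains all but finitely many whole branches. -/
lemma tendsto_branch_cofinite :
    Filter.Tendsto (fun p : ClosedPoint X × ℝ => branch π p.1 p.2)
      (Filter.comap Prod.fst Filter.cofinite) (𝓝 (root π)) := by
  classical
  refine TopologicalSpace.tendsto_nhds_generateFrom_iff.mpr ?_
  rintro _ (⟨U, rfl⟩ | ⟨U, f, A, hA, rfl⟩) hx
  · exact Filter.Eventually.of_forall fun p => hx
  · obtain ⟨hU, hA⟩ := hx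
    change genericPoint X ∈ U at hU
    set a := X.presheaf.germ U (genericPoint X) hU f with ha
    refine Filter.mem_comap.mpr ⟨_, (finite_fracOrd_ne_zero a).compl_mem_cofinite, ?_⟩
    rintro ⟨x, t⟩ hx
    have hx : fracOrd (X.presheaf.stalk x.1) a = 0 := by simpa using hx
    refine ⟨hU, ?_⟩
    rw [branch_absEval, ← ha]
    have hr : (root π).absEval hU f = (AbsoluteValue.trivial : AbsoluteValue X.functionField ℝ) a :=
      genericAbv_absEval _ _ hU f
    rw [hr] at hA
    convert hA using 1
    by_cases h0 : a = 0
    · simp [h0]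
    · rw [abv_trivial_apply h0, expAbv_apply _ _ h0, hx]; simp

lemma isBranchPoint_branch (x : ClosedPoint X) {t : ℝ} (ht : 0 < t) :
    IsBranchPoint x.1 t (branch π x t) := by
  refine ⟨rfl, fun (a : X.functionField) ha => ?_⟩
  refine (branch_residue x t ha).trans ?_
  rw [max_eq_left ht.le, ← ord_eq_fracOrd]
  exact congrArg (fun c => Real.exp (-t * (Scheme.ord c x.1 : ℝ))) (algebraMap_genericPoint a).symm

lemma IsBranchPoint.eq_branch {x : ClosedPoint X} {t : ℝ} (ht : 0 < t) {ξ : Berkovich π}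
    (h : IsBranchPoint x.1 t ξ) : ξ = branch π x t := by
  refine eq_genericAbv ξ h.1 _ _ fun a => ?_
  by_cases ha : a = 0
  · simp [ha]
  rw [h.2 a ha, expAbv_apply _ _ (by simpa using ha), max_eq_left ht.le, ord_eq_fracOrd]

lemma eq_of_generic (ξ : Berkovich π) (hξ : ξ.point = genericPoint X) :
    ∃ (v : AbsoluteValue X.functionField ℝ) (hv : _), ξ = genericAbv π v hv := by
  obtain ⟨p, w, hw⟩ := ξ
  obtain rfl : p = genericPoint X := hξ
  refine ⟨w.comp (f := (residueEquiv (X := X)).toRingHom) (residueEquiv (X := X)).injective,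
    hw, eq_genericAbv _ rfl _ _ fun a => ?_⟩
  exact congrArg (fun b => w (X.residue (genericPoint X) b)) (algebraMap_genericPoint a).symm

lemma add_le_max_of_natCast_le_one {F : Type*} [Field F] (v : AbsoluteValue F ℝ)
    (h : ∀ n : ℕ, v n ≤ 1) (a b : F) : v (a + b) ≤ max (v a) (v b) := by
  let := v.toNormedField
  have := IsUltrametricDist.isUltrametricDist_of_forall_norm_natCast_le_one (R := F) h
  exact IsUltrametricDist.norm_add_le_max (S := F) a b

/-- An absolute value of the function field which is trivial on `K` is either trivial or given by
a point on a branch: its valuation ring has a center on the curve, by properness. -/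
lemma eq_root_or_branch [IsProper π] (ξ : Berkovich π) (hξ : ξ.point = genericPoint X) :
    ξ = root π ∨ ∃ (x : ClosedPoint X) (t : ℝ), 0 < t ∧ ξ = branch π x t := by
  classical
  obtain ⟨v, hv, rfl⟩ := eq_of_generic ξ hξ
  -- `v` is ultrametric, since it is trivial on the image of `ℤ`.
  have hna := add_le_max_of_natCast_le_one v fun n => by
    have h : (n : X.functionField) = toStalk π (genericPoint X) (n : K) := by simp
    rw [h]
    by_cases hn : (n : K) = 0
    · simp [hn]
    · rw [hv _ hn]
  let O : ValuationSubring X.functionField :=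
    { carrier := {a | v a ≤ 1}
      mul_mem' := fun {a b} ha hb => by
        change v (a * b) ≤ 1; rw [map_mul]; exact mul_le_one₀ ha (v.nonneg _) hb
      one_mem' := by simp
      add_mem' := fun {a b} ha hb => (hna a b).trans (max_le ha hb)
      zero_mem' := by simp
      neg_mem' := fun {a} ha => by change v (-a) ≤ 1; rw [v.map_neg]; exact ha
      mem_or_inv_mem' := fun a => by
        change v a ≤ 1 ∨ v a⁻¹ ≤ 1
        rw [map_inv₀]
        exact (le_total (v a) 1).imp_right inv_le_one_of_one_le₀ }
  have hmem : ∀ a, a ∈ O ↔ v a ≤ 1 := fun a => Iff.rfl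
  obtain ⟨x, φ, hloc, hφ⟩ := exists_center π O fun c => by
    rw [hmem]
    by_cases hc : c = 0
    · simp [hc]
    · rw [hv c hc]
  have hone : ∀ a : X.functionField, a ≠ 0 → v a ≤ 1 → v a⁻¹ ≤ 1 → v a = 1 := by
    intro a ha h1 h2
    refine le_antisymm h1 ?_
    rw [map_inv₀] at h2
    have := v.pos ha
    rwa [inv_le_one₀ this] at h2
  -- If the center is the generic point, then the valuation ring is the whole field. Otherwise `v`
  -- is trivial on the units of the local ring and is determined by its value at a uniformizer.
  obtain rfl | ⟨x, rfl⟩ := point_cases x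
  · refine Or.inl ?_
    have hle : ∀ a : X.functionField, v a ≤ 1 := fun a => by
      have h := (φ a).2
      rw [hφ a] at h
      exact (congrArg v (algebraMap_genericPoint a)).ge.trans h
    have : v = AbsoluteValue.trivial := by
      ext a
      by_cases ha : a = 0
      · simp [ha]
      · rw [abv_trivial_apply ha, hone a ha (hle _) (hle _)]
    subst this
    rfl
  · refine Or.inr ⟨x, ?_⟩
    obtain ⟨ϖ, hϖ⟩ := IsDiscreteValuationRing.exists_irreducible (X.presheaf.stalk x.1)
    have hle : ∀ a, v (algebraMap (X.presheaf.stalk x.1) X.functionField a) ≤ 1 := fun a => by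
      rw [← hφ]; exact (φ a).2
    have hϖ0 : algebraMap (X.presheaf.stalk x.1) X.functionField ϖ ≠ 0 := by
      simpa using hϖ.ne_zero
    have hlt : v (algebraMap (X.presheaf.stalk x.1) X.functionField ϖ) < 1 := by
      refine lt_of_le_of_ne (hle ϖ) fun h => hϖ.not_isUnit (hloc.map_nonunit ϖ ?_)
      have hinv : (algebraMap (X.presheaf.stalk x.1) X.functionField ϖ)⁻¹ ∈ O := by
        rw [hmem, map_inv₀, h, inv_one]
      refine .of_mul_eq_one (⟨_, hinv⟩ : O) (Subtype.ext ?_)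
      change (φ ϖ : X.functionField) * _ = 1
      rw [hφ, mul_inv_cancel₀ hϖ0]
    have hpos := v.pos hϖ0
    refine ⟨-Real.log (v (algebraMap _ X.functionField ϖ)), by
      have := Real.log_neg hpos hlt
      linarith, ?_⟩
    unfold branch
    congr 1
    ext a
    by_cases ha : a = 0
    · simp [ha]
    obtain ⟨w, hw⟩ := exists_eq_unit_mul_zpow (X.presheaf.stalk x.1) hϖ ha
    have hwv : v (algebraMap (X.presheaf.stalk x.1) X.functionField w) = 1 := by
      refine hone _ (by simp) (hle _) ?_
      convert hle (w⁻¹ : (X.presheaf.stalk x.1)ˣ) using 2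
      rw [inv_eq_iff_eq_inv]
      refine eq_inv_of_mul_eq_one_left ?_
      rw [← map_mul, Units.mul_inv, map_one]
    rw [expAbv_apply _ _ ha, max_eq_left (by linarith [Real.log_neg hpos hlt])]
    conv_lhs => rw [hw]
    rw [map_mul, hwv, one_mul, map_zpow₀, neg_neg, ← Real.rpow_intCast,
      Real.rpow_def_of_pos hpos]

/-- Over a closed point there is only the trivial absolute value, as the residue field is
algebraic over `K`. -/
lemma eq_closedPt [LocallyOfFiniteType π] (ξ : Berkovich π) (x : ClosedPoint X)
    (hξ : ξ.point = x.1) : ξ = closedPt π x := by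
  classical
  obtain ⟨p, v, hv⟩ := ξ
  obtain rfl : p = x.1 := hξ
  let : Algebra K (X.residueField x.1) := (toResidueField π x.1).toAlgebra
  have : Module.Finite K (X.residueField x.1) := finite_toResidueField π x
  let b := Module.finBasis K (X.residueField x.1)
  have hv' : ∀ c : K, v (algebraMap K _ c) ≤ 1 := fun c => by
    by_cases hc : c = 0
    · simp [hc]
    · exact (hv c hc).le
  -- `v` is bounded on the residue field, hence at most `1`, as powers of `a` are also bounded.
  have hbd : ∀ a, v a ≤ ∑ i, v (b i) := fun a => by
    conv_lhs => rw [← b.sum_repr a]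
    refine (v.sum_le _ _).trans (Finset.sum_le_sum fun i _ => ?_)
    rw [Algebra.smul_def, map_mul]
    exact mul_le_of_le_one_left (v.nonneg _) (hv' _)
  have hle : ∀ a, v a ≤ 1 := fun a => by
    by_contra! h
    obtain ⟨n, hn⟩ := pow_unbounded_of_one_lt (∑ i, v (b i)) h
    exact absurd (hbd (a ^ n)) (by rw [map_pow]; exact not_le.mpr hn)
  have : v = (closedPt π x).abv := by
    ext a
    by_cases ha : a = 0
    · rw [ha, map_zero]; exact (map_zero (closedPt π x).abv).symm
    · refine Eq.trans ?_ (abv_trivial_apply ha).symm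
      refine le_antisymm (hle a) ?_
      have := hle a⁻¹
      rwa [map_inv₀, inv_le_one₀ (v.pos ha)] at this
  subst this
  rfl

end Branches

/-! ### Green functions along the branches -/

section Germs

variable {K : Type u} [Field K] {X : Scheme.{u}} [AlgebraicGeometry.IsIntegral X]
  {π : X ⟶ Spec (CommRingCat.of K)}

lemma germValue_coe (φ : Berkovich π → ℝ) (ξ : Berkovich π) (hξ : ξ.point = genericPoint X) :
    germValue (φ : GenericGerm π) ξ hξ = φ ξ := rfl

lemma germValue_add (g h : GenericGerm π) (ξ : Berkovich π) (hξ : ξ.point = genericPoint X) :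
    germValue (g + h) ξ hξ = germValue g ξ hξ + germValue h ξ hξ :=
  Filter.Germ.inductionOn₂ g h fun _ _ => rfl

lemma germValue_sub (g h : GenericGerm π) (ξ : Berkovich π) (hξ : ξ.point = genericPoint X) :
    germValue (g - h) ξ hξ = germValue g ξ hξ - germValue h ξ hξ :=
  Filter.Germ.inductionOn₂ g h fun _ _ => rfl

lemma germValue_smul (a : ℝ) (g : GenericGerm π) (ξ : Berkovich π)
    (hξ : ξ.point = genericPoint X) : germValue (a • g) ξ hξ = a * germValue g ξ hξ :=
  Filter.Germ.inductionOn g fun _ => rfl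

lemma germValue_map (F : ℝ → ℝ) (g : GenericGerm π) (ξ : Berkovich π)
    (hξ : ξ.point = genericPoint X) : germValue (g.map F) ξ hξ = F (germValue g ξ hξ) :=
  Filter.Germ.inductionOn g fun _ => rfl

lemma isOpen_anOpen (U : X.Opens) : IsOpen (anOpen π U) :=
  TopologicalSpace.isOpen_generateFrom_of_mem (Or.inl ⟨U, rfl⟩)

lemma anOpen_mem_genericFilter {U : X.Opens} (hU : genericPoint X ∈ U) :
    anOpen π U ∈ genericFilter π :=
  Filter.mem_comap.mpr ⟨U, U.isOpen.mem_nhds hU, fun _ h => h⟩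

open Classical in
/-- The function `|f|` on `U^an`, extended by `0`. -/
noncomputable def absFun {U : X.Opens} (f : Γ(X, U)) (ξ : Berkovich π) : ℝ :=
  if h : ξ.point ∈ U then ξ.absEval h f else 0

lemma absFun_of_mem {U : X.Opens} (f : Γ(X, U)) {ξ : Berkovich π} (h : ξ.point ∈ U) :
    absFun f ξ = ξ.absEval h f := dif_pos h

lemma continuousOn_absFun {U : X.Opens} (f : Γ(X, U)) :
    ContinuousOn (absFun f : Berkovich π → ℝ) (anOpen π U) := by
  refine (continuousOn_open_iff (isOpen_anOpen U)).mpr fun A hA => ?_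
  refine TopologicalSpace.isOpen_generateFrom_of_mem (Or.inr ⟨U, f, A, hA, ?_⟩)
  ext ξ
  constructor
  · rintro ⟨h, hA⟩
    exact ⟨h, by rwa [Set.mem_preimage, absFun_of_mem f h] at hA⟩
  · rintro ⟨h, hA⟩
    exact ⟨h, by rwa [Set.mem_preimage, absFun_of_mem f h]⟩

/-- Where `f` is invertible, `log|f|` is the logarithm of `|s|`, for any section `s` that represents
`f`. -/
lemma exp_logAbsFun_eq {U : X.Opens} (hU : genericPoint X ∈ U) {f : RatUnits X} (s : Γ(X, U))
    (hs : X.presheaf.germ U (genericPoint X) hU s = f.val) {ξ : Berkovich π} (hξ : ξ.point ∈ U)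
    (hunit : ∃ a : (X.presheaf.stalk ξ.point)ˣ,
      algebraMap (X.presheaf.stalk ξ.point) X.functionField a = f.val) :
    Real.exp (logAbsFun f ξ) = absFun s ξ := by
  obtain ⟨a, ha⟩ := hunit
  have : Nonempty U := ⟨⟨_, hU⟩⟩
  have h : X.presheaf.germ U ξ.point hξ s = a.1 := by
    refine algebraMap_stalk_injective ξ.point ?_
    rw [ha, Scheme.algebraMap_germ_eq_germToFunctionField]
    exact hs
  have hpos : 0 < ξ.abv (X.residue ξ.point a.1) :=
    ξ.abv.pos ((a.isUnit.map (X.residue ξ.point).hom).ne_zero)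
  rw [logAbsFun_eq f ξ a ha, Real.exp_log hpos, absFun_of_mem s hξ, ← h]
  rfl

lemma logAbs_tmul (a : ℝ) (f : RatUnits X) :
    logAbs π (a ⊗ₜ Additive.ofMul f) = a • ((logAbsFun f : Berkovich π → ℝ) : GenericGerm π) := by
  rw [logAbs, LinearMap.liftBaseChange_tmul]
  rfl

lemma add_mem_CHat {g h : GenericGerm π} (hg : g ∈ CHat π) (hh : h ∈ CHat π) :
    g + h ∈ CHat π := by
  obtain ⟨U, hU, φ, hφ, rfl⟩ := hg
  obtain ⟨V, hV, ψ, hψ, rfl⟩ := hh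
  have hη : ∀ W : X.Opens, (W : Set X).Nonempty → genericPoint X ∈ W := fun W hW =>
    ((genericPoint_spec X).mem_open_set_iff W.isOpen).mpr (by simpa using hW)
  exact ⟨U ⊓ V, ⟨_, hη U hU, hη V hV⟩, φ + ψ,
    (hφ.mono fun ξ h => h.1).add (hψ.mono fun ξ h => h.2), rfl⟩

lemma smul_mem_CHat (a : ℝ) {g : GenericGerm π} (hg : g ∈ CHat π) : a • g ∈ CHat π := by
  obtain ⟨U, hU, φ, hφ, rfl⟩ := hg
  exact ⟨U, hU, a • φ, hφ.const_smul a, rfl⟩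

lemma logAbsFun_mem_CHat (f : RatUnits X) :
    ((logAbsFun f : Berkovich π → ℝ) : GenericGerm π) ∈ CHat π := by
  obtain ⟨U, hU, s, hs⟩ := X.presheaf.exists_germ_eq (x := genericPoint X) f.val
  obtain ⟨V, hV, hVs⟩ := Filter.mem_comap.mp (eventually_isUnit (π := π) f)
  obtain ⟨W, hWV, hWo, hW⟩ := mem_nhds_iff.mp hV
  refine ⟨U ⊓ ⟨W, hWo⟩, ⟨_, hU, hW⟩, _, ?_, rfl⟩
  have h : ∀ ξ ∈ anOpen π (U ⊓ ⟨W, hWo⟩), Real.exp (logAbsFun f ξ) = absFun s ξ := fun ξ hξ =>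
    exp_logAbsFun_eq hU s hs hξ.1 (hVs (hWV hξ.2))
  have hc : ContinuousOn (fun ξ : Berkovich π => Real.log (absFun s ξ))
      (anOpen π (U ⊓ ⟨W, hWo⟩)) :=
    ((continuousOn_absFun s).mono fun ξ h => h.1).log fun ξ hξ => by
      rw [← h ξ hξ]; exact (Real.exp_pos _).ne'
  exact hc.congr fun ξ hξ => by simp only [← h ξ hξ, Real.log_exp]

lemma logAbs_mem_CHat (s : RRat X) : logAbs π s ∈ CHat π := by
  induction s using TensorProduct.induction_on with
  | zero => exact ⟨⊤, ⟨genericPoint X, trivial⟩, 0, continuousOn_const, by rw [map_zero]; rfl⟩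
  | tmul a f => exact logAbs_tmul (π := π) a f.toMul ▸ smul_mem_CHat a (logAbsFun_mem_CHat _)
  | add s t hs ht => rw [map_add]; exact add_mem_CHat hs ht

lemma sub_mem_CHat {g h : GenericGerm π} (hg : g ∈ CHat π) (hh : h ∈ CHat π) :
    g - h ∈ CHat π := by
  rw [sub_eq_add_neg, ← neg_one_smul ℝ h]
  exact add_mem_CHat hg (smul_mem_CHat _ hh)

end Germs

section Values

variable {K : Type u} [Field K] {X : Scheme.{u}} [AlgebraicGeometry.IsIntegral X]
  {π : X ⟶ Spec (CommRingCat.of K)} [IsLocallyNoetherian X] [IsRegularCurve X]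

/-- If `g` is a Green function of `D`, then `g - log|s|` is one of `D + (s)`. -/
lemma IsGreenFunction.sub_logAbs {D : RDiv X} {g : GenericGerm π} (h : IsGreenFunction D g)
    (s : RRat X) : IsGreenFunction (D + principalRDiv X s) (g - logAbs π s) := by
  refine ⟨sub_mem_CHat h.1 (logAbs_mem_CHat s), fun U f hU hf => ?_⟩
  obtain ⟨φ, hφ, e⟩ := h.2 U (f - s) hU fun y hy => by
    have := hf y hy
    rw [map_add, stalkRDiv_principalRDiv] at this
    rw [map_sub, ← this, add_sub_cancel_right]
  refine ⟨φ, hφ, ?_⟩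
  rw [e, map_sub]; abel

lemma germValue_logAbs_branch (s : RRat X) (x : ClosedPoint X) (t : ℝ) :
    germValue (logAbs π s) (branch π x t) (branch_point x t) = -(max t 0) * ordR x s := by
  induction s using TensorProduct.induction_on with
  | zero => rw [map_zero, map_zero, mul_zero]; rfl
  | tmul a f =>
    have h := logAbs_tmul (π := π) a f.toMul
    have h' := ordR_tmul x a f.toMul
    rw [ofMul_toMul] at h h'
    rw [h, h', germValue_smul, germValue_coe]
    rw [logAbsFun_eq f.toMul (branch π x t) f.toMul (algebraMap_genericPoint f.toMul.val)]
    have := branch_residue (π := π) x t (RatUnits.val_ne_zero f.toMul)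
    refine Eq.trans (congrArg (fun r => a * Real.log r) this) ?_
    rw [Real.log_exp]; ring
  | add s t hs ht => rw [map_add, germValue_add, hs, ht, map_add, mul_add]

variable (π) in
/-- The value of a class of functions at the point of parameter `t` of the branch of `x`. -/
noncomputable def branchVal (g : GenericGerm π) (x : ClosedPoint X) (t : ℝ) : ℝ :=
  germValue g (branch π x t) (branch_point x t)

lemma branchVal_of_nonpos (g : GenericGerm π) (x : ClosedPoint X) {t : ℝ} (ht : t ≤ 0) :
    branchVal π g x t = germValue g (root π) root_point := by
  rw [branchVal]
  congr 1
  exact branch_of_nonpos x ht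

lemma continuous_branchVal {g : GenericGerm π} (hg : g ∈ CHat π) (x : ClosedPoint X) :
    Continuous (branchVal π g x) := by
  obtain ⟨U, hU, φ, hφ, rfl⟩ := hg
  exact hφ.comp_continuous (continuous_branch x) fun t => genericPoint_mem U hU

lemma tendsto_branchVal_cofinite {g : GenericGerm π} (hg : g ∈ CHat π) :
    Filter.Tendsto (fun p : ClosedPoint X × ℝ => branchVal π g p.1 p.2)
      (Filter.comap Prod.fst Filter.cofinite) (𝓝 (germValue g (root π) root_point)) := by
  obtain ⟨U, hU, φ, hφ, rfl⟩ := hg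
  exact (hφ.continuousAt ((isOpen_anOpen U).mem_nhds (genericPoint_mem U hU))).tendsto.comp
    tendsto_branch_cofinite

lemma tendsto_branchVal_of_continuousOn {φ : Berkovich π → ℝ} {U : X.Opens}
    (hφ : ContinuousOn φ (anOpen π U)) {x : ClosedPoint X} (hx : x.1 ∈ U) :
    Filter.Tendsto (branchVal π (φ : GenericGerm π) x) Filter.atTop (𝓝 (φ (closedPt π x))) :=
  (hφ.continuousAt ((isOpen_anOpen U).mem_nhds hx)).tendsto.comp (tendsto_branch_atTop x)

/-- A Green function of `D` has logarithmic growth of slope `ord_x(D)` on the branch of `x`. -/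
lemma IsGreenFunction.tendsto_branchVal_sub {D : RDiv X} {g : GenericGerm π}
    (h : IsGreenFunction D g) (x : ClosedPoint X) :
    ∃ L, Filter.Tendsto (fun t => branchVal π g x t - t * ordDiv x D) Filter.atTop (𝓝 L) := by
  obtain ⟨U, hU, f, hf⟩ := exists_isLocalEquation D x.1
  obtain ⟨φ, hφ, e⟩ := h.2 U f ⟨_, hU⟩ hf
  refine ⟨_, (tendsto_branchVal_of_continuousOn hφ hU).congr' ?_⟩
  filter_upwards [Filter.eventually_ge_atTop 0] with t ht
  rw [e, branchVal, germValue_add, germValue_logAbs_branch, hf.ordDiv_eq hU, branchVal,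
    max_eq_left ht]
  ring

/-- A class of functions which extends continuously near each point of the curve extends to a
continuous function: two local extensions agree at the ends of the branches because these are
limits of points over the generic point. -/
lemma exists_continuous_of_local [LocallyOfFiniteType π] {G : GenericGerm π}
    (hloc : ∀ x : ClosedPoint X, ∃ U : X.Opens, x.1 ∈ U ∧ ∃ ψ : Berkovich π → ℝ,
      ContinuousOn ψ (anOpen π U) ∧ (ψ : GenericGerm π) = G) :
    ∃ h : Berkovich π → ℝ, Continuous h ∧ (h : GenericGerm π) = G := by
  have hloc' : ∀ p : X, ∃ U : X.Opens, p ∈ U ∧ ∃ ψ : Berkovich π → ℝ,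
      ContinuousOn ψ (anOpen π U) ∧ (ψ : GenericGerm π) = G := fun p => by
    rcases point_cases p with rfl | ⟨x, rfl⟩
    · obtain ⟨U, hU, ψ, h⟩ := hloc (Classical.arbitrary _)
      exact ⟨U, genericPoint_mem U ⟨_, hU⟩, ψ, h⟩
    · exact hloc x
  choose U hU ψ hψ e using hloc'
  have key : ∀ p, ∀ ξ ∈ anOpen π (U p), ψ ξ.point ξ = ψ p ξ := by
    intro p ξ hξ
    rcases point_cases ξ.point with h | ⟨x, hx⟩
    · rw [← germValue_coe (ψ p) ξ h, ← germValue_coe (ψ ξ.point) ξ h, e, e]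
    · obtain rfl := eq_closedPt ξ x hx.symm
      have h1 := tendsto_branchVal_of_continuousOn (hψ x.1) (hU x.1)
      have h2 := tendsto_branchVal_of_continuousOn (hψ p) hξ
      rw [e] at h1 h2
      exact tendsto_nhds_unique h1 h2
  refine ⟨fun ξ => ψ ξ.point ξ, continuous_iff_continuousAt.mpr fun ξ => ?_, ?_⟩
  · have hn := (isOpen_anOpen (U ξ.point)).mem_nhds (hU ξ.point : ξ ∈ anOpen π (U ξ.point))
    refine ((hψ ξ.point).continuousAt hn).congr ?_
    filter_upwards [hn] with ζ hζ using (key _ ζ hζ).symm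
  · rw [← e (genericPoint X)]
    refine Filter.Germ.coe_eq.mpr ?_
    filter_upwards [anOpen_mem_genericFilter (hU (genericPoint X))] with ζ hζ using key _ ζ hζ

/-- Near `x`, a power of the uniformizer at `x` is a local equation of any divisor. -/
lemma exists_isLocalEquation_uniformizer (D : RDiv X) (x : ClosedPoint X) :
    ∃ U : X.Opens, x.1 ∈ U ∧
      IsLocalEquation D U (ordDiv x D ⊗ₜ Additive.ofMul (uniformizer x)) := by
  obtain ⟨c, rfl⟩ := pointsRDiv_surjective D
  induction c using Finsupp.induction_linear with
  | zero => exact ⟨⊤, trivial, fun y _ => by simp⟩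
  | add c d hc hd =>
    obtain ⟨U, hU, hc⟩ := hc
    obtain ⟨V, hV, hd⟩ := hd
    refine ⟨U ⊓ V, ⟨hU, hV⟩, fun y hy => ?_⟩
    rw [map_add, map_add, map_add, hc y hy.1, hd y hy.2, TensorProduct.add_tmul, map_add]
  | single z a =>
    have hp : pointsRDiv (Finsupp.single z a) = a ⊗ₜ[ℤ] Additive.ofMul (pointDiv z) := by
      rw [pointsRDiv, Finsupp.linearCombination_single, TensorProduct.smul_tmul', smul_eq_mul,
        mul_one]
    rw [ordDiv_pointsRDiv, hp]
    by_cases hz : z = x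
    · subst hz
      refine ⟨uniformizerOpen z, mem_uniformizerOpen z, fun y hy => ?_⟩
      rw [stalkRDiv, stalkRRat, LinearMap.baseChange_tmul, LinearMap.baseChange_tmul,
        Finsupp.single_eq_same]
      exact congrArg (fun q => a ⊗ₜ[ℤ] (Additive.ofMul q)) (pointDivFun_of_mem hy)
    · refine ⟨complOpen z, fun h => hz (Subtype.ext h.symm), fun y hy => ?_⟩
      rw [Finsupp.single_eq_of_ne (Ne.symm hz), TensorProduct.zero_tmul, map_zero, stalkRDiv,
        LinearMap.baseChange_tmul]
      refine Eq.trans (congrArg (fun q => a ⊗ₜ[ℤ] (Additive.ofMul q)) (pointDivFun_of_ne hy)) ?_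
      exact TensorProduct.tmul_zero _ _

/-- If `D` is effective and `g` is a Green function of `D`, then `e^{-g}` extends to a continuous
function: near a closed point `x` it is `e^{-ψ}|u|^a`, where `u` is a uniformizer, `a = ord_x(D)`,
and `ψ` is the continuous extension of `g + a log|u|`. -/
lemma IsGreenFunction.exists_local_exp {D : RDiv X} {g : GenericGerm π} (h : IsGreenFunction D g)
    (x : ClosedPoint X) (hx : 0 ≤ ordDiv x D) :
    ∃ U : X.Opens, x.1 ∈ U ∧ ∃ ψ : Berkovich π → ℝ,
      ContinuousOn ψ (anOpen π U) ∧ (ψ : GenericGerm π) = g.map (fun r => Real.exp (-r)) := by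
  obtain ⟨U, hU, hf⟩ := exists_isLocalEquation_uniformizer D x
  obtain ⟨ψ, hψ, e⟩ := h.2 U _ ⟨_, hU⟩ hf
  obtain ⟨b, hb⟩ := mem_range_of_fracOrd_nonneg (X.presheaf.stalk x.1)
    (a := (uniformizer x).val) (by rw [fracOrd_uniformizer]; exact zero_le_one)
  obtain ⟨V, hV, s, hs⟩ := X.presheaf.exists_germ_eq (x := x.1) b
  have hVη := genericPoint_mem V ⟨_, hV⟩
  have : Nonempty V := ⟨⟨_, hV⟩⟩
  have hs' : X.presheaf.germ V (genericPoint X) hVη s = (uniformizer x).val := by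
    rw [← hb, ← hs, Scheme.algebraMap_germ_eq_germToFunctionField]
  refine ⟨U ⊓ V, ⟨hU, hV⟩, fun ξ => Real.exp (-ψ ξ) * absFun s ξ ^ ordDiv x D, ?_, ?_⟩
  · refine ContinuousOn.mul ?_ ?_
    · exact Real.continuous_exp.comp_continuousOn (hψ.mono fun ξ hξ => hξ.1).neg
    · exact (Real.continuous_rpow_const hx).comp_continuousOn
        ((continuousOn_absFun s).mono fun ξ hξ => hξ.2)
  · rw [logAbs_tmul] at e
    induction g using Filter.Germ.inductionOn with
    | h φ =>
    refine Filter.Germ.coe_eq.mpr ?_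
    filter_upwards [Filter.Germ.coe_eq.mp e, eventually_isUnit (π := π) (uniformizer x),
      anOpen_mem_genericFilter hVη] with ξ h1 h2 h3
    rw [h1, ← exp_logAbsFun_eq hVη s hs' h3 h2, ← Real.exp_mul, ← Real.exp_add]
    congr 1
    change -(φ ξ + ordDiv x D * logAbsFun (uniformizer x) ξ) + _ = -φ ξ
    ring

/-- An adelic divisor is effective if and only if its divisor has non-negative orders and its Green
function is non-negative on all branches. -/
lemma AdelicDivisor.isEffective_iff [IsProper π] (A : AdelicDivisor π) :
    A.IsEffective ↔ ∀ x : ClosedPoint X, 0 ≤ ordDiv x A.D ∧ ∀ t, 0 ≤ branchVal π A.g x t := by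
  constructor
  · rintro ⟨hD, h, hc, e, hh⟩ x
    refine ⟨isEffectiveRDiv_iff.mp hD x, fun t => ?_⟩
    have h1 : h (branch π x t) = Real.exp (-branchVal π A.g x t) := by
      rw [← germValue_coe h (branch π x t) (branch_point x t), e, germValue_map]
      rfl
    have h2 := (hh (branch π x t)).2
    rw [h1, Real.exp_le_one_iff] at h2
    linarith
  · intro hA
    obtain ⟨h, hc, e⟩ := exists_continuous_of_local fun x =>
      A.isGreen.exists_local_exp x (hA x).1
    have hbr : ∀ x t, h (branch π x t) = Real.exp (-branchVal π A.g x t) := fun x t => by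
      rw [← germValue_coe h (branch π x t) (branch_point x t), e, germValue_map]
      rfl
    have hbr' : ∀ x t, h (branch π x t) ∈ Set.Icc (0 : ℝ) 1 := fun x t => by
      rw [hbr]
      exact ⟨(Real.exp_pos _).le, Real.exp_le_one_iff.mpr (neg_nonpos.mpr ((hA x).2 t))⟩
    refine ⟨isEffectiveRDiv_iff.mpr fun x => (hA x).1, h, hc, e, fun ξ => ?_⟩
    rcases point_cases ξ.point with hξ | ⟨x, hx⟩
    · rcases eq_root_or_branch ξ hξ with rfl | ⟨x, t, -, rfl⟩
      · have x : ClosedPoint X := Classical.arbitrary _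
        rw [← branch_of_nonpos x le_rfl]
        exact hbr' x 0
      · exact hbr' x t
    · obtain rfl := eq_closedPt ξ x hx.symm
      exact isClosed_Icc.mem_of_tendsto ((hc.tendsto _).comp (tendsto_branch_atTop x))
        (Filter.Eventually.of_forall fun t => hbr' x t)

/-- The Dirichlet property of `(D, g)`, in terms of the branches. -/
lemma AdelicDivisor.dirichlet_iff [IsProper π] (A : AdelicDivisor π) :
    A.Dirichlet ↔ ∃ s : RRat X, ∀ x : ClosedPoint X, 0 ≤ ordDiv x A.D + ordR x s ∧
      ∀ t, 0 ≤ branchVal π A.g x t + max t 0 * ordR x s := by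
  have hval : ∀ (s : RRat X) (x : ClosedPoint X) (t : ℝ),
      branchVal π (A.g - logAbs π s) x t = branchVal π A.g x t + max t 0 * ordR x s := by
    intro s x t
    rw [branchVal, germValue_sub, germValue_logAbs_branch, branchVal]; ring
  constructor
  · rintro ⟨B, ⟨s, hD, hg⟩, hB⟩
    refine ⟨s, fun x => ?_⟩
    have := B.isEffective_iff.mp hB x
    rw [hD, hg, map_add, ordDiv_principalRDiv] at this
    exact ⟨this.1, fun t => hval s x t ▸ this.2 t⟩
  · rintro ⟨s, hs⟩
    refine ⟨⟨_, _, A.isGreen.sub_logAbs s⟩, ⟨s, rfl, rfl⟩, (isEffective_iff _).mpr fun x => ?_⟩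
    rw [map_add, ordDiv_principalRDiv]
    exact ⟨(hs x).1, fun t => (hval s x t).ge.trans' ((hs x).2 t)⟩

lemma branchVal_addConst (A : AdelicDivisor π) (ε : ℝ) (x : ClosedPoint X) (t : ℝ) :
    branchVal π (A.addConst ε).g x t = branchVal π A.g x t + ε :=
  germValue_add _ _ _ _

/-- `μ_x(g)` is the infimum of the values of `g(ξ_{x,t}) / t`. -/
lemma mu_eq (g : GenericGerm π) (x : ClosedPoint X) :
    mu g x.1 = ⨅ (t : ℝ) (_ : 0 < t), ((branchVal π g x t / t : ℝ) : EReal) := by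
  refine iInf_congr fun t => iInf_congr fun ht => le_antisymm ?_ ?_
  · exact iInf₂_le (branch π x t) (isBranchPoint_branch x ht)
  · refine le_iInf₂ fun ξ hξ => ?_
    obtain rfl := hξ.eq_branch ht
    exact le_rfl

end Values

/-! ### Sums of extended reals -/

section Sums

lemma sum_ofReal_neg_le_iff {ι : Type*} (F : Finset ι) (r : ι → ℝ) :
    ∑ x ∈ F, ENNReal.ofReal (-r x) ≤ ∑ x ∈ F, ENNReal.ofReal (r x) ↔ 0 ≤ ∑ x ∈ F, r x := by
  have h : ∀ a : ℝ, ENNReal.ofReal a = ENNReal.ofReal (max a 0) := fun a => by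
    rcases le_total a 0 with ha | ha
    · rw [max_eq_right ha, ENNReal.ofReal_of_nonpos ha, ENNReal.ofReal_zero]
    · rw [max_eq_left ha]
  have hs : ∑ x ∈ F, r x = ∑ x ∈ F, max (r x) 0 - ∑ x ∈ F, max (-r x) 0 := by
    rw [← Finset.sum_sub_distrib]
    refine Finset.sum_congr rfl fun x _ => ?_
    rcases le_total (r x) 0 with ha | ha
    · rw [max_eq_right ha, max_eq_left (neg_nonneg.mpr ha)]; ring
    · rw [max_eq_left ha, max_eq_right (neg_nonpos.mpr ha)]; ring
  rw [Finset.sum_congr rfl fun x _ => h (-r x), Finset.sum_congr rfl fun x _ => h (r x),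
    ← ENNReal.ofReal_sum_of_nonneg fun _ _ => le_max_right _ _,
    ← ENNReal.ofReal_sum_of_nonneg fun _ _ => le_max_right _ _,
    ENNReal.ofReal_le_ofReal_iff (Finset.sum_nonneg fun _ _ => le_max_right _ _), hs, sub_nonneg]

/-- The non-negativity of a weighted sum of elements of `[-∞, +∞[`, all but finitely many of which
are non-positive, can be tested on finite sums of real upper bounds. -/
lemma zero_le_tsum_sub_tsum_iff {ι : Type*} (u : ι → EReal) (d : ι → ℕ) (hd : ∀ x, 0 < d x)
    (c : ι → ℝ) (hc : ∀ x, u x ≤ c x) (T : Finset ι) (hT : ∀ x ∉ T, c x = 0) :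
    0 ≤ ((∑' x, (u x * (d x : EReal)).toENNReal : ENNReal) : EReal) -
        ((∑' x, (-(u x * (d x : EReal))).toENNReal : ENNReal) : EReal) ↔
      ∀ F : Finset ι, T ⊆ F → ∀ m : ι → ℝ, (∀ x ∈ F, u x ≤ m x) → 0 ≤ ∑ x ∈ F, m x * d x := by
  classical
  have hsum : ∀ F, T ⊆ F → ∑' x, (u x * (d x : EReal)).toENNReal =
      ∑ x ∈ F, (u x * (d x : EReal)).toENNReal := fun F hF => by
    refine tsum_eq_sum fun x hx => EReal.toENNReal_of_nonpos ?_
    have h0 : u x ≤ 0 := by simpa [hT x fun h => hx (hF h)] using hc x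
    exact EReal.mul_nonpos_iff.mpr (Or.inr ⟨h0, by positivity⟩)
  have hd' : ∀ x, (0 : EReal) < (d x : EReal) := fun x => by exact_mod_cast hd x
  have hreal : ∀ x (r : ℝ), u x = r → u x * (d x : EReal) = ((r * d x : ℝ) : EReal) := by
    intro x r h
    rw [h]; push_cast; rfl
  have hpos : ∀ x (r : ℝ), u x = r → (u x * (d x : EReal)).toENNReal = ENNReal.ofReal (r * d x) := by
    intro x r h
    rw [hreal x r h, EReal.toENNReal_of_ne_top (EReal.coe_ne_top _), EReal.toReal_coe]
  have hneg : ∀ x (r : ℝ), u x = r →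
      (-(u x * (d x : EReal))).toENNReal = ENNReal.ofReal (-(r * d x)) := by
    intro x r h
    rw [hreal x r h, ← EReal.coe_neg, EReal.toENNReal_of_ne_top (EReal.coe_ne_top _),
      EReal.toReal_coe]
  have hP : ∑' x, (u x * (d x : EReal)).toENNReal ≠ ⊤ := by
    rw [hsum T subset_rfl]
    refine ENNReal.sum_ne_top.mpr fun x _ => ?_
    rw [Ne, EReal.toENNReal_eq_top_iff]
    refine ne_top_of_le_ne_top (b := ((c x * d x : ℝ) : EReal)) (EReal.coe_ne_top _) ?_
    push_cast
    exact mul_le_mul_of_nonneg_right (hc x) (hd' x).le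
  have hsub : ∀ P N : ENNReal, P ≠ ⊤ → (0 ≤ (P : EReal) - N ↔ N ≤ P) := by
    intro P N hP
    rw [EReal.sub_nonneg (by left; simpa using hP) (by left; simp)]
    exact EReal.coe_ennreal_le_coe_ennreal_iff
  rw [hsub _ _ hP]
  constructor
  · intro hNP F hF m hm
    have hbot : ∀ x, ∃ r : ℝ, u x = r := fun x => by
      have h1 : u x ≠ ⊥ := fun h => by
        have h2 : (-(u x * (d x : EReal))).toENNReal = ⊤ := by
          rw [h, EReal.bot_mul_of_pos (hd' x)]; simp
        exact hP (top_le_iff.mp ((h2.symm.trans_le (ENNReal.le_tsum x)).trans hNP))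
      have h2 : u x ≠ ⊤ := ne_top_of_le_ne_top (EReal.coe_ne_top _) (hc x)
      exact ⟨(u x).toReal, (EReal.coe_toReal h2 h1).symm⟩
    choose r hr using hbot
    have hle : ∀ x ∈ F, r x ≤ m x := fun x hx => by
      have := hm x hx
      rw [hr x] at this
      exact_mod_cast this
    refine le_trans ?_ (Finset.sum_le_sum fun x hx =>
      mul_le_mul_of_nonneg_right (hle x hx) (Nat.cast_nonneg (d x)))
    rw [← sum_ofReal_neg_le_iff F fun x => r x * d x]
    have h := (ENNReal.sum_le_tsum F).trans hNP
    rwa [hsum F hF, Finset.sum_congr rfl fun x _ => hneg x _ (hr x),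
      Finset.sum_congr rfl fun x _ => hpos x _ (hr x)] at h
  · intro H
    have hbot : ∀ x, ∃ r : ℝ, u x = r := fun x => by
      have h1 : u x ≠ ⊥ := fun h => by
        have hC := H (insert x T) (Finset.subset_insert x T) c fun y _ => hc y
        -- The bound `c x - (C + 1)` at `x` makes the sum of the upper bounds negative.
        set C := ∑ y ∈ insert x T, c y * d y with hCdef
        have h2 := H (insert x T) (Finset.subset_insert x T)
          (fun y => c y - if y = x then C + 1 else 0) fun y _ => by
            by_cases hy : y = x
            · rw [hy, h]; exact bot_le
            · simpa [hy] using hc y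
        have h3 : ∑ y ∈ insert x T, (c y - if y = x then C + 1 else 0) * d y =
            C - (C + 1) * d x := by
          simp only [sub_mul, Finset.sum_sub_distrib, ite_mul, zero_mul,
            Finset.sum_ite_eq', Finset.mem_insert_self, if_true, ← hCdef]
        rw [h3] at h2
        have h4 : (1 : ℝ) ≤ d x := by exact_mod_cast hd x
        nlinarith
      have h2 : u x ≠ ⊤ := ne_top_of_le_ne_top (EReal.coe_ne_top _) (hc x)
      exact ⟨(u x).toReal, (EReal.coe_toReal h2 h1).symm⟩
    choose r hr using hbot
    rw [ENNReal.tsum_eq_iSup_sum]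
    refine iSup_le fun F => ?_
    have h := (sum_ofReal_neg_le_iff (F ∪ T) fun x => r x * d x).mpr
      (H _ Finset.subset_union_right r fun x _ => (hr x).le)
    refine (Finset.sum_le_sum_of_subset (Finset.subset_union_left (s₂ := T))).trans ?_
    rwa [hsum _ (Finset.subset_union_right (s₁ := F)),
      Finset.sum_congr rfl fun x _ => hneg x _ (hr x),
      Finset.sum_congr rfl fun x _ => hpos x _ (hr x)]

end Sums

/-! ### The Dirichlet property and the invariants `μ_x` -/

section Criterion

variable {K : Type u} [Field K] {X : Scheme.{u}} [AlgebraicGeometry.IsIntegral X]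
  {π : X ⟶ Spec (CommRingCat.of K)} [IsLocallyNoetherian X] [IsRegularCurve X]

lemma mu_le (g : GenericGerm π) (x : ClosedPoint X) {t : ℝ} (ht : 0 < t) :
    mu g x.1 ≤ ((branchVal π g x t / t : ℝ) : EReal) := by
  rw [mu_eq]
  exact iInf₂_le t ht

lemma tendsto_branchVal_div (A : AdelicDivisor π) (x : ClosedPoint X) (ε : ℝ) :
    Filter.Tendsto (fun t => (branchVal π A.g x t + ε) / t) Filter.atTop
      (𝓝 (ordDiv x A.D)) := by
  obtain ⟨L, hL⟩ := A.isGreen.tendsto_branchVal_sub x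
  have h := (((hL.add_const ε).div_atTop Filter.tendsto_id).add_const (ordDiv x A.D))
  rw [zero_add] at h
  refine h.congr' ?_
  filter_upwards [Filter.eventually_gt_atTop 0] with t ht
  simp only [id]
  field_simp
  ring

lemma mu_le_ordDiv (A : AdelicDivisor π) (x : ClosedPoint X) : mu A.g x.1 ≤ ordDiv x A.D := by
  refine ge_of_tendsto (continuous_coe_real_ereal.continuousAt.tendsto.comp
    (tendsto_branchVal_div A x 0)) ?_
  filter_upwards [Filter.eventually_gt_atTop 0] with t ht
  simpa using mu_le A.g x ht

lemma zero_le_muTot_iff [LocallyOfFiniteType π] (A : AdelicDivisor π) :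
    0 ≤ muTot A.g ↔ ∀ F : Finset (ClosedPoint X), (finite_ordDiv_ne_zero A.D).toFinset ⊆ F →
      ∀ m : ClosedPoint X → ℝ, (∀ x ∈ F, mu A.g x.1 ≤ m x) →
        0 ≤ ∑ x ∈ F, m x * degreeAt π x.1 :=
  zero_le_tsum_sub_tsum_iff _ _ (degreeAt_pos π) (fun x => ordDiv x A.D) (mu_le_ordDiv A) _
    fun x hx => by simpa using hx

/-- If all `(D, g + ε)` have the Dirichlet property then `μ_tot(g) ≥ 0`: the orders of an
`ℝ`-rational function `s` for which `(D + (s), g + ε - log|s|)` is effective satisfy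
`-ord_x(s) ≤ (g(ξ_{x,t}) + ε) / t` for all `t`, and their weighted sum vanishes. -/
theorem zero_le_muTot_of_dirichlet [IsProper π] (A : AdelicDivisor π)
    (h : ∀ ε : ℝ, 0 < ε → (A.addConst ε).Dirichlet) : 0 ≤ muTot A.g := by
  classical
  refine (zero_le_muTot_iff A).mpr fun F hF m hm => ?_
  -- Choose parameters `t x` that almost realise the infima on `F`, and then `ε` small enough for
  -- `ε / t x ≤ δ`.
  have key : ∀ δ : ℝ, 0 < δ → 0 ≤ ∑ x ∈ F, (m x + 2 * δ) * degreeAt π x.1 := by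
    intro δ hδ
    have hex : ∀ x : ClosedPoint X, ∃ t : ℝ, 0 < t ∧
        (x ∈ F → branchVal π A.g x t < (m x + δ) * t) := fun x => by
      by_cases hx : x ∈ F
      · have hlt : mu A.g x.1 < ((m x + δ : ℝ) : EReal) :=
          (hm x hx).trans_lt (by exact_mod_cast lt_add_of_pos_right (m x) hδ)
        rw [mu_eq] at hlt
        obtain ⟨t, hlt⟩ := iInf_lt_iff.mp hlt
        obtain ⟨ht, hlt⟩ := iInf_lt_iff.mp hlt
        refine ⟨t, ht, fun _ => ?_⟩
        rw [← div_lt_iff₀ ht]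
        exact_mod_cast hlt
      · exact ⟨1, one_pos, fun h => absurd h hx⟩
    choose t ht htlt using hex
    obtain ⟨τ, hτ, hτt⟩ : ∃ τ : ℝ, 0 < τ ∧ ∀ x ∈ F, τ ≤ t x := by
      rcases F.eq_empty_or_nonempty with rfl | hne
      · exact ⟨1, one_pos, by simp⟩
      · obtain ⟨y, hy, hle⟩ := F.exists_min_image t hne
        exact ⟨t y, ht y, hle⟩
    obtain ⟨s, hs⟩ := (AdelicDivisor.dirichlet_iff _).mp (h (δ * τ) (mul_pos hδ hτ))
    have hle : ∀ x ∈ F, -ordR x s ≤ m x + 2 * δ := fun x hx => by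
      have h1 := (hs x).2 (t x)
      rw [branchVal_addConst, max_eq_left (ht x).le] at h1
      have h2 := htlt x hx
      have h3 := mul_le_mul_of_nonneg_left (hτt x hx) hδ.le
      have h4 : 0 ≤ t x * (m x + 2 * δ + ordR x s) := by nlinarith
      have := nonneg_of_mul_nonneg_right h4 (ht x)
      linarith
    have hS := sum_ordR_mul_degree_eq_zero π s (F ∪ (finite_ordR_ne_zero s).toFinset)
      fun x hx => by
        by_contra hne
        exact hx (Finset.mem_union_right _ (by simpa using hne))
    have hFle : ∑ x ∈ F, ordR x s * degreeAt π x.1 ≤ 0 := by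
      rw [← hS]
      refine Finset.sum_le_sum_of_subset_of_nonneg Finset.subset_union_left fun x _ hx => ?_
      have h0 : ordDiv x A.D = 0 := by
        by_contra hne
        exact hx (hF (by simpa using hne))
      have h1 := (hs x).1
      rw [show (A.addConst (δ * τ)).D = A.D from rfl, h0, zero_add] at h1
      exact mul_nonneg h1 (Nat.cast_nonneg _)
    calc (0 : ℝ) ≤ ∑ x ∈ F, -ordR x s * degreeAt π x.1 := by
          simp only [neg_mul, Finset.sum_neg_distrib]; linarith
      _ ≤ _ := Finset.sum_le_sum fun x hx =>
          mul_le_mul_of_nonneg_right (hle x hx) (Nat.cast_nonneg _)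
  have hlim : Filter.Tendsto (fun δ : ℝ => ∑ x ∈ F, (m x + 2 * δ) * degreeAt π x.1) (𝓝[>] 0)
      (𝓝 (∑ x ∈ F, (m x + 2 * 0) * degreeAt π x.1)) :=
    (Continuous.tendsto (by fun_prop) 0).mono_left nhdsWithin_le_nhds
  have := ge_of_tendsto hlim (Filter.eventually_of_mem self_mem_nhdsWithin key)
  simpa using this

/-- If `μ_tot(g) ≥ 0` then `g` is non-negative at the root, as otherwise all `μ_x(g)` would be
`-∞`. -/
lemma germValue_root_nonneg [LocallyOfFiniteType π] (A : AdelicDivisor π)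
    (h : 0 ≤ muTot A.g) : 0 ≤ germValue A.g (root π) root_point := by
  classical
  by_contra! hneg
  -- Any negative upper bound of the `μ_x` contradicts the non-negativity of the sum.
  have hmu : ∀ x : ClosedPoint X, mu A.g x.1 ≤ ((-1 : ℝ) : EReal) := fun x => by
    have h0 : branchVal π A.g x 0 < 0 := by rwa [branchVal_of_nonpos _ _ le_rfl]
    have h1 : Filter.Tendsto (fun t => branchVal π A.g x t + t) (𝓝[>] 0) (𝓝 (branchVal π A.g x 0 + 0)) :=
      (((continuous_branchVal A.isGreen.1 x).add continuous_id).tendsto 0).mono_left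
        nhdsWithin_le_nhds
    obtain ⟨t, ht, hpos⟩ := ((h1.eventually_lt_const (by rwa [add_zero])).and
      self_mem_nhdsWithin).exists
    refine (mu_le A.g x hpos).trans ?_
    have hpos : 0 < t := hpos
    have : branchVal π A.g x t / t ≤ -1 := by
      rw [div_le_iff₀ hpos]; linarith
    exact_mod_cast this
  have x₀ : ClosedPoint X := Classical.arbitrary _
  have h2 := (zero_le_muTot_iff A).mp h (insert x₀ (finite_ordDiv_ne_zero A.D).toFinset)
    (Finset.subset_insert _ _) (fun _ => -1) fun x _ => hmu x
  have h3 : 0 < ∑ x ∈ insert x₀ (finite_ordDiv_ne_zero A.D).toFinset, (degreeAt π x.1 : ℝ) :=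
    Finset.sum_pos (fun x _ => by exact_mod_cast degreeAt_pos π x) ⟨x₀, Finset.mem_insert_self _ _⟩
  simp only [neg_mul, one_mul, Finset.sum_neg_distrib] at h2
  linarith

/-- The slope `inf_{t > 0} (g(ξ_{x,t}) + ε) / t`, when `g + ε` is positive at the root. -/
lemma exists_slope (A : AdelicDivisor π) {ε : ℝ} (hε : 0 < ε)
    (hroot : 0 ≤ germValue A.g (root π) root_point) (x : ClosedPoint X) :
    ∃ M : ℝ, (∀ t, 0 < t → M * t ≤ branchVal π A.g x t + ε) ∧ M ≤ ordDiv x A.D ∧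
      mu A.g x.1 ≤ M := by
  have hcont := continuous_branchVal A.isGreen.1 x
  -- The quotient is positive near `0` and tends to `ord_x(D)` at infinity.
  have hbdd : BddBelow ((fun t => (branchVal π A.g x t + ε) / t) '' Set.Ioi 0) := by
    have h0 : 0 < branchVal π A.g x 0 + ε := by rw [branchVal_of_nonpos _ _ le_rfl]; linarith
    obtain ⟨δ, hδ, hδpos⟩ := Metric.eventually_nhds_iff.mp
      ((hcont.add continuous_const).continuousAt.eventually_const_lt h0)
    obtain ⟨R, hR⟩ := Filter.eventually_atTop.mp
      ((tendsto_branchVal_div A x ε).eventually_const_lt (sub_one_lt (ordDiv x A.D)))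
    have hK : ContinuousOn (fun t => (branchVal π A.g x t + ε) / t) (Set.Icc δ R) :=
      (hcont.add continuous_const).continuousOn.div continuousOn_id fun t ht =>
        (hδ.trans_le ht.1).ne'
    obtain ⟨b, hb⟩ := isCompact_Icc.bddBelow_image hK
    refine ⟨min b (min 0 (ordDiv x A.D - 1)), ?_⟩
    rintro _ ⟨t, ht, rfl⟩
    have ht : 0 < t := ht
    rcases lt_or_ge t δ with h1 | h1
    · refine (min_le_right _ _).trans ((min_le_left _ _).trans ?_)
      exact div_nonneg (hδpos (by rw [Real.dist_eq, sub_zero, abs_of_pos ht]; exact h1)).le ht.le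
    · rcases le_total t R with h2 | h2
      · exact (min_le_left _ _).trans (hb ⟨t, ⟨h1, h2⟩, rfl⟩)
      · exact (min_le_right _ _).trans ((min_le_right _ _).trans (hR t h2).le)
  have hle : ∀ t, 0 < t → sInf ((fun t => (branchVal π A.g x t + ε) / t) '' Set.Ioi 0) ≤
      (branchVal π A.g x t + ε) / t := fun t ht => csInf_le hbdd ⟨t, ht, rfl⟩
  refine ⟨sInf ((fun t => (branchVal π A.g x t + ε) / t) '' Set.Ioi 0), fun t ht => ?_, ?_, ?_⟩
  · rw [← le_div_iff₀ ht]; exact hle t ht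
  · refine ge_of_tendsto (tendsto_branchVal_div A x ε) ?_
    filter_upwards [Filter.eventually_gt_atTop 0] with t ht using hle t ht
  · have h1 : mu A.g x.1 ≠ ⊤ := ne_top_of_le_ne_top (EReal.coe_ne_top _) (mu_le_ordDiv A x)
    by_cases h2 : mu A.g x.1 = ⊥
    · rw [h2]; exact bot_le
    rw [← EReal.coe_toReal h1 h2, EReal.coe_le_coe_iff]
    refine le_csInf ⟨_, 1, one_pos (α := ℝ), rfl⟩ ?_
    rintro _ ⟨t, ht, rfl⟩
    have ht : 0 < t := ht
    have h3 := mu_le A.g x ht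
    rw [← EReal.coe_toReal h1 h2, EReal.coe_le_coe_iff] at h3
    exact h3.trans (div_le_div_of_nonneg_right (by linarith) ht.le)

/-- If `μ_tot(g) ≥ 0` then `(D, g + ε)` has the Dirichlet property: outside a finite set of closed
points `g + ε` is positive on the branches, the slopes of `g + ε` on the finitely many other
branches have a non-negative weighted sum, and as `Pic(X) ⊗ ℚ` is a line there is an `ℝ`-rational
function whose orders are bounded below by the opposites of these slopes. -/
theorem dirichlet_of_zero_le_muTot [IsProper π] (hpic : PicRankOne X) (A : AdelicDivisor π)
    (h : 0 ≤ muTot A.g) {ε : ℝ} (hε : 0 < ε) : (A.addConst ε).Dirichlet := by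
  classical
  have hroot := germValue_root_nonneg A h
  choose M hM hMD hMmu using exists_slope A hε hroot
  -- The branches converge uniformly to the root, where `g + ε` is positive.
  have hfin : {x : ClosedPoint X | ∃ t, branchVal π A.g x t + ε ≤ 0}.Finite := by
    have hev := Filter.eventually_comap.mp
      ((tendsto_branchVal_cofinite A.isGreen.1).eventually_const_lt
        (show -ε < germValue A.g (root π) root_point by linarith))
    refine (Filter.eventually_cofinite.mp hev).subset ?_
    rintro x ⟨t, ht⟩ hx
    linarith [hx (x, t) rfl]
  obtain ⟨F, hFD, hF⟩ : ∃ F : Finset (ClosedPoint X),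
      (finite_ordDiv_ne_zero A.D).toFinset ⊆ F ∧
        ∀ x ∉ F, ordDiv x A.D = 0 ∧ ∀ t, 0 < branchVal π A.g x t + ε := by
    refine ⟨_ ∪ hfin.toFinset, Finset.subset_union_left, fun x hx => ?_⟩
    rw [Finset.mem_union, not_or] at hx
    exact ⟨by simpa using hx.1, by simpa using hx.2⟩
  let N : ClosedPoint X →₀ ℝ := Finsupp.onFinset F (fun x => if x ∈ F then M x else 0)
    fun x hx => by by_contra h; exact hx (if_neg h)
  have hN : ∀ x, N x = if x ∈ F then M x else 0 := fun x => rfl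
  have hsum : 0 ≤ ∑ x ∈ N.support, N x * degreeAt π x.1 := by
    have h1 := (zero_le_muTot_iff A).mp h F hFD M fun x _ => hMmu x
    have h2 : ∑ x ∈ N.support, N x * (degreeAt π x.1 : ℝ) = ∑ x ∈ F, N x * degreeAt π x.1 :=
      Finset.sum_subset Finsupp.support_onFinset_subset fun x _ hx => by
        rw [Finsupp.notMem_support_iff.mp hx, zero_mul]
    rw [h2]
    refine h1.trans_eq (Finset.sum_congr rfl fun x hx => ?_)
    rw [hN, if_pos hx]
  obtain ⟨s, hs⟩ := exists_nonneg_add_ordR π hpic N hsum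
  refine (AdelicDivisor.dirichlet_iff _).mpr ⟨s, fun x => ?_⟩
  have hNx : N x ≤ ordDiv x A.D ∧ ∀ t, 0 < t → N x * t ≤ branchVal π A.g x t + ε := by
    rw [hN]
    split_ifs with hx
    · exact ⟨hMD x, hM x⟩
    · exact ⟨(hF x hx).1.ge, fun t _ => by rw [zero_mul]; exact ((hF x hx).2 t).le⟩
  refine ⟨(hs x).trans (by gcongr; exact hNx.1), fun t => ?_⟩
  rw [branchVal_addConst]
  rcases le_or_gt t 0 with ht | ht
  · rw [branchVal_of_nonpos _ _ ht, max_eq_right ht, zero_mul]; linarith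
  · rw [max_eq_left ht.le]
    have h1 := hNx.2 t ht
    have h2 := mul_nonneg ht.le (hs x)
    linarith

end Criterion

end TrivialArakelov

theorem mainTheorem3 {K : Type u} [Field K] {X : Scheme.{u}} [AlgebraicGeometry.IsIntegral X]
    [IsLocallyNoetherian X] (π : X ⟶ Spec (CommRingCat.of K)) (hproj : IsProjective π)
    (hdim : topologicalKrullDim X = 1)
    (hreg : ∀ x : X, IsRegularLocalRing (X.presheaf.stalk x))
    (hpic : PicRankOne X) (A : AdelicDivisor π) :
    (∀ ε : ℝ, 0 < ε → (A.addConst ε).Dirichlet) ↔ 0 ≤ muTot A.g := by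
  have hproper : IsProper π := hproj.isProper
  have hcompact : CompactSpace X := (quasiCompact_iff_compactSpace π).mp inferInstance
  have hcurve : IsRegularCurve X := { compact := hcompact, dim := hdim, regular := hreg }
  exact ⟨zero_le_muTot_of_dirichlet A, fun h ε hε => dirichlet_of_zero_le_muTot hpic A h hε⟩
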